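/- **Setting.** Let $S$ be a closed surface with universal cover $\tilde S$ and deck group $\Gamma=\pi_1(S)$, and let $M=S\times[0,\infty)$ carry a hyperbolic structure, smooth up to the boundary $S\times\{0\}$, with developing map $D:\tilde S\times[0,\infty)\to\mathbb H^3$ and holonomy $\rho:\Gamma\to PSL_2\mathbb C$. Assume that $M$ is a geometrically finite end (without rank one cusps): $D$ extends continuously to $\tilde S\times[0,\infty]\to\mathbb H^3\cup\widehat{\mathbb C}$ so that its restriction $D_\infty$ to $\tilde S\times\{\infty\}$ is a ($\rho$-equivariant) developing map of a projective structure $\Sigma$ on $S\times\{\infty\}$, the projective boundary. Assume also that $\partial M=S\times\{0\}$ is concave (i.e. $S\times\{0\}$ is a smooth convex surface: its second fundamental form $\langle\nabla_u n,u\rangle$ with respect to the unit normal $n$ pointing into $M$ is nonnegative), and that the paths $\{p\}\times[0,\infty)$ are the unit speed geodesic rays normal to $\partial M$. Let $\Pi:\tilde M=\tilde S\times[0,\infty)\to\tilde\Sigma$, $\Pi(p,t)=p$, be the normal projection. Identify $sl_2\mathbb C$ with the projective vector fields $k(z)\frac{\partial}{\partial z}$, $k$ a complex polynomial of degree at most $2$,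 and with the Killing fields of $\mathbb H^3$ (the Killing field corresponding to $k$ is the one that extends continuously to $k(z)\frac{\partial}{\partial z}$ on $\widehat{\mathbb C}$). Let $\tilde E=\tilde M\times sl_2\mathbb C$, with its product flat connection $d$ and the fibre metric $\langle a,b\rangle_x=\langle a(x),b(x)\rangle+\langle (ia)(x),(ib)(x)\rangle$, where $x\in\tilde M$ is read in $\mathbb H^3$ through $D$. Let $\delta$ be the formal adjoint of $d$ with respect to this metric and the hyperbolic metric, and let $\Delta=d\delta+\delta d$. For a section $s$ of $\tilde E$, $\operatorname{Re}s$ is the vector field $x\mapsto s(x)(x)$ on $\tilde M$, $\operatorname{div}$ is the hyperbolic divergence, and $\hat d$ is the differential of functions. Let $v$ be a vector field on $\tilde\Sigma$ that is conformal ($v=f(z)\frac{\partial}{\partial z}$ with $f$ holomorphic in every projective chart $z$) and automorphic ($v-\gamma_*v$ is a projective vector field for every $\gamma\in\Gamma$). Let $s_\infty:\tilde\Sigma\to sl_2\mathbb C$ be its canonical lift: at a point with coordinate $w$ in a projective chart $z$, the value of $s_\infty$ is the projective vector field $$\Big(f(w)+f'(w)(z-w)+\tfrac12 f''(w)(z-w)^2\Big)\frac{\partial}{\partial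 z}.$$ **Theorem.** Let $s=\Pi^*s_\infty$, i.e. $s(p,t)=s_\infty(p)$. Then $s$ is smooth, and the pointwise norms of $ds$, $\Delta s$, $\operatorname{div}\operatorname{Re}s$ and $\hat d(\operatorname{div}\operatorname{Re}s)$ are continuous and $\Gamma$-invariant on $\tilde M$, hence are functions on $M$. All four have finite $L^2$ norm on $M$: the integrals over $M$, with respect to the hyperbolic volume, of $\|ds\|^2$, $\|\Delta s\|^2$, $|\operatorname{div}\operatorname{Re}s|^2$ and $\|\hat d(\operatorname{div}\operatorname{Re}s)\|^2$ are finite. -/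

import Mathlib

open scoped Manifold ContDiff Topology MatrixGroups

noncomputable section

namespace HypEnd

/-! ### Hyperbolic three-space, upper half-space model -/

/-- The ambient space `ℂ × ℝ` of the upper half-space model. Hyperbolic space is the set of
`x = (w, t)` with `0 < t`, with the metric `(|dw|² + dt²) / t²`. -/
abbrev Amb : Type := ℂ × ℝ

/-- The hyperbolic inner product of two tangent vectors at `x`. -/
def hypInner (x u v : Amb) : ℝ :=
  ((u.1 * starRingEnd ℂ v.1).re + u.2 * v.2) / x.2 ^ 2

/-- The Christoffel term of the Levi-Civita connection of `(|dw|² + dt²) / t²`: the covariant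
derivative in the direction `u` of a field with value `v` at `x` is the coordinate derivative of
the field plus `christoffel x u v`. -/
def christoffel (x u v : Amb) : Amb :=
  let c : ℝ := (u.1 * starRingEnd ℂ v.1).re + u.2 * v.2
  (-(x.2)⁻¹) • (u.2 • v + v.2 • u - c • ((0, 1) : Amb))

/-- The coordinate directions `∂/∂x, ∂/∂y, ∂/∂t`. -/
def coordVec : Fin 3 → Amb := ![(1, 0), (Complex.I, 0), (0, 1)]

/-- The coordinates of a tangent vector with respect to `∂/∂x, ∂/∂y, ∂/∂t`. -/
def coordOf (v : Amb) : Fin 3 → ℝ := ![v.1.re, v.1.im, v.2]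

/-- The orthonormal frame `e₁ = t ∂/∂x, e₂ = t ∂/∂y, e₃ = t ∂/∂t`. -/
def frame (x : Amb) (i : Fin 3) : Amb := x.2 • coordVec i

/-- The hyperbolic volume `dx dy dt / t³`. -/
def hypVol : MeasureTheory.Measure Amb :=
  (MeasureTheory.volume.restrict {x : Amb | 0 < x.2}).withDensity
    (fun x => ENNReal.ofReal ((x.2 ^ 3)⁻¹))

/-- The action of `SL(2, ℂ)` on hyperbolic space by orientation preserving isometries (Poincaré
extension of Möbius transformations). -/
def hypAct (A : SL(2, ℂ)) (x : Amb) : Amb :=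
  let a := A 0 0
  let b := A 0 1
  let c := A 1 0
  let d := A 1 1
  let N : ℝ := ‖c * x.1 + d‖ ^ 2 + ‖c‖ ^ 2 * x.2 ^ 2
  (((a * x.1 + b) * starRingEnd ℂ (c * x.1 + d) + a * starRingEnd ℂ c * (x.2 : ℂ) ^ 2) / (N : ℂ),
    x.2 / N)

/-- The inclusion of the Riemann sphere in the compactification of the closed half-space
`{t ≥ 0}` by one point; the latter is the standard compactification of hyperbolic space. -/
def sphereIncl : OnePoint ℂ → OnePoint Amb := OnePoint.map (fun z => ((z, 0) : Amb))

/-! ### Projective vector fields, Killing fields, and the flat bundle -/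

/-- The Lie algebra of projective vector fields `(k₀ + k₁ z + k₂ z²) ∂/∂z` on the Riemann
sphere, i.e. `sl₂ ℂ`; it is also the Lie algebra of Killing fields of hyperbolic space. -/
abbrev ProjField : Type := Fin 3 → ℂ

/-- The value of the coefficient of a projective vector field at `z`. -/
def ProjField.eval (k : ProjField) (z : ℂ) : ℂ := k 0 + k 1 * z + k 2 * z ^ 2

/-- The pullback of a projective vector field under the Möbius transformation `A`: the quadratic
polynomial `z ↦ k((a z + b) / (c z + d)) (c z + d)²`. -/
def pullback (A : SL(2, ℂ)) (k : ProjField) : ProjField :=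
  let a := A 0 0
  let b := A 0 1
  let c := A 1 0
  let d := A 1 1
  ![k 0 * d ^ 2 + k 1 * (b * d) + k 2 * b ^ 2,
    2 * k 0 * (c * d) + k 1 * (a * d + b * c) + 2 * k 2 * (a * b),
    k 0 * c ^ 2 + k 1 * (a * c) + k 2 * a ^ 2]

/-- The value at `x = (w, t)` of the Killing field of hyperbolic space that extends the
projective vector field `k` continuously:
horizontal part `k(w) - (t² / 2) * conj (k''(w))`, vertical part `t * Re k'(w)`. -/
def killing (k : ProjField) (x : Amb) : Amb :=
  (k.eval x.1 - (x.2 : ℂ) ^ 2 * starRingEnd ℂ (k 2), x.2 * (k 1 + 2 * k 2 * x.1).re)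

/-- The inner product on the fibre at `x` of the bundle of germs of Killing fields:
`⟨k, l⟩ₓ = ⟨k(x), l(x)⟩ + ⟨(i k)(x), (i l)(x)⟩`. -/
def fibreInner (x : Amb) (k l : ProjField) : ℝ :=
  hypInner x (killing k x) (killing l x) +
    hypInner x (killing (Complex.I • k) x) (killing (Complex.I • l) x)

/-- The quadratic polynomial `a + b (z - w) + c (z - w)²` as a projective vector field. -/
def quadAt (w a b c : ℂ) : ProjField :=
  ![a - b * w + c * w ^ 2, b - 2 * c * w, c]

/-- The Killing field `Eᵢ` at `x = (w, t)` with `Eᵢ(x) = eᵢ` and `(i Eᵢ)(x) = 0`. The six fields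
`Eᵢ, i Eᵢ` are an orthonormal basis of the fibre at `x`. -/
def realLift (x : Amb) : Fin 3 → ProjField :=
  ![quadAt x.1 ((x.2 : ℂ) / 2) 0 (-1 / (2 * (x.2 : ℂ))),
    quadAt x.1 (Complex.I * (x.2 : ℂ) / 2) 0 (Complex.I / (2 * (x.2 : ℂ))),
    quadAt x.1 0 1 0]

/-- The element of the fibre at `x` that represents the real linear functional `l` with respect
to `fibreInner x`. -/
def flat (x : Amb) (l : ProjField → ℝ) : ProjField :=
  ∑ i, (l (realLift x i) • realLift x i +
    l (Complex.I • realLift x i) • (Complex.I • realLift x i))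

/-! ### Differential operators on sections over (open subsets of) hyperbolic space

The bundle of germs of Killing fields is trivialised by its flat connection, so that a section is
a function with values in `ProjField` and the flat connection `d` is the ordinary derivative. -/

/-- The square of the pointwise norm of `ds` at `x`. -/
def normSqD (s : Amb → ProjField) (x : Amb) : ℝ :=
  ∑ i, fibreInner x (fderiv ℝ s x (frame x i)) (fderiv ℝ s x (frame x i))

/-- The codifferential `δ η = -* ∂ * η` of a bundle valued one-form `η`, where `∂` is
the exterior derivative `d*` of the flat dual bundle conjugated by the metric isomorphism.
In coordinates, `⟨δ η, k⟩ₓ = - t³ ∑ᵢ ∂ᵢ (t⁻¹ ⟨η(∂ᵢ), k⟩)` for every constant section `k`. It is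
the formal adjoint of `d`. -/
def codiff (η : Amb → Amb →L[ℝ] ProjField) (x : Amb) : ProjField :=
  flat x fun k =>
    -(x.2 ^ 3) * ∑ i, fderiv ℝ
      (fun y : Amb => (y.2)⁻¹ * fibreInner y (η y (coordVec i)) k) x (coordVec i)

/-- The Laplacian `Δ s = (d δ + δ d) s = δ d s` of a section. -/
def laplacian (s : Amb → ProjField) (x : Amb) : ProjField :=
  codiff (fun y => fderiv ℝ s y) x

/-- The real part of a section: the vector field `x ↦ s(x)(x)`. -/
def realPart (s : Amb → ProjField) (x : Amb) : Amb := killing (s x) x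

/-- The hyperbolic divergence (the trace of the covariant derivative) of a vector field. -/
def divergence (v : Amb → Amb) (x : Amb) : ℝ :=
  x.2 ^ 3 * ∑ i, fderiv ℝ (fun y : Amb => (y.2 ^ 3)⁻¹ * coordOf (v y) i) x (coordVec i)

/-- The square of the pointwise hyperbolic norm of the differential of a real function. -/
def normSqDiff (g : Amb → ℝ) (x : Amb) : ℝ :=
  ∑ i, (fderiv ℝ g x (frame x i)) ^ 2

/-! ### Geometrically finite ends -/

open Classical in
/-- A local inverse near `f x` of a map `f` that is a local homeomorphism near `x`. Its germ at
`f x` is independent of choices. -/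
def localInv {X Y : Type*} [TopologicalSpace X] [TopologicalSpace Y] (f : X → Y) (x : X) :
    Y → X :=
  if h : ∃ e : OpenPartialHomeomorph X Y, x ∈ e.source ∧ Set.EqOn f e e.source then
    h.choose.symm
  else fun _ => x

/-- The derivative of a map from a surface to `ℂ × ℝ` in the direction of a tangent vector. -/
def surfDeriv {T : Type*} [TopologicalSpace T] [ChartedSpace ℂ T] (f : T → Amb) (p : T)
    (u : TangentSpace 𝓘(ℝ, ℂ) p) : Amb :=
  mfderiv 𝓘(ℝ, ℂ) 𝓘(ℝ, Amb) f p u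

/-- A geometrically finite end `M = S × [0, ∞)` with concave boundary, in normal coordinates.
`T` is the universal cover of the closed surface `S` and `Γ = π₁(S)` acts on `T` by deck
transformations. The hyperbolic structure on `M` and the projective structure on `S × {∞}` are
given by a developing map `T × [0, ∞] → ℍ³ ∪ ℂP¹`, which consists of
`dev` on `T × [0, ∞)` (its values at negative times only record that it is smooth up to the
boundary and are otherwise irrelevant) and of `devInf` on `T × {∞}`. -/
structure GeomFiniteEnd (Γ T : Type*) [Group Γ] [TopologicalSpace T] [ChartedSpace ℂ T]
    [MulAction Γ T] where
  /-- The deck group acts smoothly. -/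
  smooth_smul : ∀ γ : Γ, ContMDiff 𝓘(ℝ, ℂ) 𝓘(ℝ, ℂ) ∞ (fun p : T => γ • p)
  /-- The deck group acts freely. -/
  free : ∀ (γ : Γ) (p : T), γ • p = p → γ = 1
  /-- The surface `S = T / Γ` is compact. -/
  compact_quotient : CompactSpace (Quotient (MulAction.orbitRel Γ T))
  /-- The developing map of the hyperbolic structure. -/
  dev : T × ℝ → Amb
  /-- The developing map of the projective structure at infinity. -/
  devInf : T → OnePoint ℂ
  /-- The holonomy representation. -/
  hol : Γ →* Matrix.ProjectiveSpecialLinearGroup (Fin 2) ℂ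
  /-- The developing map takes values in hyperbolic space. -/
  dev_pos : ∀ (p : T) (t : ℝ), 0 ≤ t → 0 < (dev (p, t)).2
  /-- The developing map is a smooth local diffeomorphism, up to the boundary. -/
  dev_localDiffeo : IsLocalDiffeomorphOn (𝓘(ℝ, ℂ).prod 𝓘(ℝ, ℝ)) 𝓘(ℝ, Amb) ∞ dev
    (Set.univ ×ˢ Set.Ici 0)
  /-- The developing map of the hyperbolic structure is equivariant. -/
  dev_equivariant : ∀ (γ : Γ) (A : SL(2, ℂ)),
    (A : Matrix.ProjectiveSpecialLinearGroup (Fin 2) ℂ) = hol γ →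
    ∀ (p : T) (t : ℝ), 0 ≤ t → dev (γ • p, t) = hypAct A (dev (p, t))
  /-- The developing map of the projective structure is a local homeomorphism. -/
  devInf_localHomeo : IsLocalHomeomorph devInf
  /-- The developing map of the projective structure is equivariant. -/
  devInf_equivariant : ∀ (γ : Γ) (A : SL(2, ℂ)),
    (A : Matrix.ProjectiveSpecialLinearGroup (Fin 2) ℂ) = hol γ →
    ∀ p : T, devInf (γ • p) = (A : GL (Fin 2) ℂ) • devInf p
  /-- The projective structure compactifies the hyperbolic structure: `dev` and `devInf` together
  are continuous at `T × {∞}`. -/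
  dev_tendsto : ∀ p : T, Filter.Tendsto (fun x : T × ℝ => (dev x : OnePoint Amb))
    (𝓝 p ×ˢ Filter.atTop) (𝓝 (sphereIncl (devInf p)))
  /-- The paths `{p} × [0, ∞)` have unit speed. -/
  unit_speed : ∀ (p : T) (t : ℝ), 0 ≤ t →
    hypInner (dev (p, t)) (deriv (fun r => dev (p, r)) t) (deriv (fun r => dev (p, r)) t) = 1
  /-- The paths `{p} × [0, ∞)` are geodesics. -/
  geodesic : ∀ (p : T) (t : ℝ), 0 ≤ t →
    deriv (deriv (fun r => dev (p, r))) t +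
      christoffel (dev (p, t)) (deriv (fun r => dev (p, r)) t)
        (deriv (fun r => dev (p, r)) t) = 0
  /-- The paths `{p} × [0, ∞)` are normal to the boundary `S × {0}`. -/
  normal : ∀ (p : T) (u : TangentSpace 𝓘(ℝ, ℂ) p),
    hypInner (dev (p, 0)) (surfDeriv (fun q => dev (q, 0)) p u)
      (deriv (fun r => dev (p, r)) 0) = 0
  /-- `S × {0}` is a convex surface (`M` has concave boundary): with respect to the normal
  `n = ∂/∂t` pointing into `M`, the second fundamental form `⟨∇ᵤ n, u⟩` is nonnegative. -/
  convex : ∀ (p : T) (u : TangentSpace 𝓘(ℝ, ℂ) p),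
    0 ≤ hypInner (dev (p, 0))
      (surfDeriv (fun q => deriv (fun r => dev (q, r)) 0) p u +
        christoffel (dev (p, 0)) (surfDeriv (fun q => dev (q, 0)) p u)
          (deriv (fun r => dev (p, r)) 0))
      (surfDeriv (fun q => dev (q, 0)) p u)

namespace GeomFiniteEnd

variable {Γ T : Type*} [Group Γ] [TopologicalSpace T] [ChartedSpace ℂ T] [MulAction Γ T]
variable (M : GeomFiniteEnd Γ T)

/-! ### Vector fields on the projective boundary -/

/-- The projective chart `A ∘ devInf`; it is only used near points `p` with
`A • devInf p ≠ ∞`. -/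
def chart (A : SL(2, ℂ)) (p : T) : ℂ := ((A : GL (Fin 2) ℂ) • M.devInf p).elim 0 id

/-- The coefficient `f` of a vector field `v = f(z) ∂/∂z` in the projective chart
`z = chart A` near `p`. -/
def coeff (v : ∀ p : T, TangentSpace 𝓘(ℝ, ℂ) p) (A : SL(2, ℂ)) (p : T) : ℂ → ℂ := fun z =>
  let q := localInv M.devInf p (((A⁻¹ : SL(2, ℂ)) : GL (Fin 2) ℂ) • (z : OnePoint ℂ))
  mfderiv 𝓘(ℝ, ℂ) 𝓘(ℝ, ℂ) (M.chart A) q (v q)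

/-- A vector field on the universal cover of the projective boundary is conformal if its
coefficient is holomorphic in every projective chart. -/
def IsConformal (v : ∀ p : T, TangentSpace 𝓘(ℝ, ℂ) p) : Prop :=
  ∀ (p : T) (A : SL(2, ℂ)), (A : GL (Fin 2) ℂ) • M.devInf p ≠ OnePoint.infty →
    AnalyticAt ℂ (M.coeff v A p) (M.chart A p)

/-- A vector field `v` on the universal cover of the projective boundary is automorphic if for
every deck transformation `γ` the field `v - γ_* v` is a projective vector field `k`. (In the
chart `A ∘ devInf` the field `k` reads as its push-forward under `A`.) -/
def IsAutomorphic (v : ∀ p : T, TangentSpace 𝓘(ℝ, ℂ) p) : Prop :=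
  ∀ γ : Γ, ∃ k : ProjField, ∀ (p : T) (A : SL(2, ℂ)),
    (A : GL (Fin 2) ℂ) • M.devInf (γ • p) ≠ OnePoint.infty →
    (mfderiv 𝓘(ℝ, ℂ) 𝓘(ℝ, ℂ) (M.chart A) (γ • p)
      (v (γ • p) - mfderiv 𝓘(ℝ, ℂ) 𝓘(ℝ, ℂ) (fun q : T => γ • q) p (v p)) : ℂ) =
      (pullback A⁻¹ k).eval (M.chart A (γ • p))

/-- The projective vector field `(f(w) + f'(w) (z - w) + f''(w) / 2 (z - w)²) ∂/∂z`. -/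
def _root_.HypEnd.osculating (f : ℂ → ℂ) (w : ℂ) : ProjField :=
  quadAt w (f w) (deriv f w) (deriv (deriv f) w / 2)

/-- The inversion `z ↦ -1 / z`. -/
def _root_.HypEnd.inversion : SL(2, ℂ) := ⟨!![0, -1; 1, 0], by simp [Matrix.det_fin_two]⟩

open Classical in
/-- The canonical lift of a conformal vector field on the universal cover of the projective
boundary: its value at `p` is the projective vector field that osculates `v` at `p`, computed in
the projective chart `devInf`, or `-1 / devInf` where `devInf p = ∞`. -/
def canonicalLift (v : ∀ p : T, TangentSpace 𝓘(ℝ, ℂ) p) (p : T) : ProjField :=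
  let A : SL(2, ℂ) := if M.devInf p = OnePoint.infty then inversion else 1
  pullback A (osculating (M.coeff v A p) (M.chart A p))

/-! ### Sections on the end and their `L²` norms -/

/-- The pullback of a section at infinity under the normal projection `(p, t) ↦ p`. -/
def _root_.HypEnd.normalPullback {T : Type*} (sInf : T → ProjField) (x : T × ℝ) : ProjField :=
  sInf x.1

/-- A section near `x`, read in the hyperbolic chart given by the developing map. -/
def germ (s : T × ℝ → ProjField) (x : T × ℝ) : Amb → ProjField := s ∘ localInv M.dev x

/-- The section `s` over the universal cover `T × [0, ∞)` of `M` is smooth. -/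
def IsSmoothSection (s : T × ℝ → ProjField) : Prop :=
  ∀ x : T × ℝ, 0 ≤ x.2 → ContDiffAt ℝ ∞ (M.germ s x) (M.dev x)

/-- The pointwise norm of `ds`. -/
def normD (s : T × ℝ → ProjField) (x : T × ℝ) : ℝ :=
  √(normSqD (M.germ s x) (M.dev x))

/-- The pointwise norm of `Δ s`. -/
def normLaplacian (s : T × ℝ → ProjField) (x : T × ℝ) : ℝ :=
  √(fibreInner (M.dev x) (laplacian (M.germ s x) (M.dev x)) (laplacian (M.germ s x) (M.dev x)))

/-- The pointwise norm of `div Re s`. -/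
def normDivRe (s : T × ℝ → ProjField) (x : T × ℝ) : ℝ :=
  |divergence (realPart (M.germ s x)) (M.dev x)|

/-- The pointwise norm of the differential of `div Re s`. -/
def normDiffDivRe (s : T × ℝ → ProjField) (x : T × ℝ) : ℝ :=
  √(normSqDiff (divergence (realPart (M.germ s x))) (M.dev x))

/-- A Borel set that meets every `Γ`-orbit in exactly one point. -/
def _root_.HypEnd.IsFundamentalSet (Γ : Type*) {T : Type*} [Group Γ] [TopologicalSpace T]
    [MulAction Γ T] (F : Set T) : Prop :=
  @MeasurableSet T (borel T) F ∧ ∀ p : T, ∃! γ : Γ, γ • p ∈ F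

/-- Fundamental sets exist for the deck group of every end. -/
theorem exists_isFundamentalSet {Γ T : Type*} [Group Γ] [TopologicalSpace T]
    [ChartedSpace ℂ T] [MulAction Γ T] [T2Space T] [SecondCountableTopology T]
    [ProperlyDiscontinuousSMul Γ T] (M : GeomFiniteEnd Γ T) :
    ∃ F : Set T, IsFundamentalSet Γ F := by
  have : ContinuousConstSMul Γ T := ⟨fun γ => (M.smooth_smul γ).continuous⟩
  have : LocallyCompactSpace T := ChartedSpace.locallyCompactSpace ℂ T
  choose U hU hd using fun x : T => ProperlyDiscontinuousSMul.exists_nhds_disjoint_image Γ x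
  obtain ⟨c, hc, hcov⟩ := TopologicalSpace.countable_cover_nhds
    (fun x => interior_mem_nhds.2 (hU x))
  rcases isEmpty_or_nonempty T with hT | hT
  · exact ⟨∅, @MeasurableSet.empty T (borel T), fun p => hT.elim p⟩
  have hne : c.Nonempty := by
    obtain ⟨x⟩ := hT
    have hx : x ∈ ⋃ y ∈ c, interior (U y) := hcov ▸ Set.mem_univ x
    obtain ⟨y, hy, -⟩ := Set.mem_iUnion₂.1 hx
    exact ⟨y, hy⟩
  obtain ⟨e, rfl⟩ := hc.exists_eq_range hne
  let V : ℕ → Set T := fun n => interior (U (e n))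
  let W : ℕ → Set T := fun n => {p | ∃ γ : Γ, γ • p ∈ V n}
  have hVo : ∀ n, IsOpen (V n) := fun n => isOpen_interior
  have hWo : ∀ n, IsOpen (W n) := fun n => by
    have : W n = ⋃ γ : Γ, (fun p => γ • p) ⁻¹' V n := by ext; simp [W]
    rw [this]
    exact isOpen_iUnion fun γ => (hVo n).preimage (continuous_const_smul γ)
  have hWinv : ∀ n (γ : Γ) p, γ • p ∈ W n ↔ p ∈ W n := by
    intro n γ p
    constructor
    · rintro ⟨g, hg⟩
      exact ⟨g * γ, by rwa [mul_smul]⟩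
    · rintro ⟨g, hg⟩
      exact ⟨g * γ⁻¹, by rwa [mul_smul, inv_smul_smul]⟩
  have hex : ∀ p, ∃ n, p ∈ W n := by
    intro p
    have hp : p ∈ ⋃ y ∈ Set.range e, interior (U y) := hcov ▸ Set.mem_univ p
    simp only [Set.mem_iUnion, Set.mem_range, exists_prop, exists_exists_eq_and] at hp
    obtain ⟨n, hn⟩ := hp
    exact ⟨n, 1, by simpa [V] using hn⟩
  have hinj : ∀ n (γ : Γ) p, p ∈ V n → γ • p ∈ V n → γ = 1 := by
    intro n γ p hp hγ
    by_contra hne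
    have hx : γ • e n ≠ e n := fun h => hne (M.free γ _ h)
    exact Set.disjoint_left.1 (hd (e n) γ hx) ⟨p, interior_subset hp, rfl⟩
      (interior_subset hγ)
  refine ⟨⋃ n, (V n \ ⋃ m ∈ Finset.range n, W m), ?_, fun p => ?_⟩
  · borelize T
    exact MeasurableSet.iUnion fun n => (hVo n).measurableSet.diff
      (Finset.measurableSet_biUnion _ fun m _ => (hWo m).measurableSet)
  · classical
    have key : ∀ γ : Γ, (γ • p ∈ ⋃ n, (V n \ ⋃ m ∈ Finset.range n, W m)) ↔
        γ • p ∈ V (Nat.find (hex p)) := by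
      intro γ
      simp only [Set.mem_iUnion, Set.mem_sdiff, Finset.mem_range, exists_prop, not_exists, not_and]
      constructor
      · rintro ⟨n, hn, hm⟩
        have h1 : Nat.find (hex p) = n := by
          refine (Nat.find_eq_iff _).2 ⟨⟨γ, hn⟩, fun m hmn hW => ?_⟩
          exact hm m hmn ((hWinv m γ p).2 hW)
        rwa [h1]
      · intro h
        exact ⟨_, h, fun m hm hW => Nat.find_min (hex p) hm ((hWinv m γ p).1 hW)⟩
    obtain ⟨γ, hγ⟩ := Nat.find_spec (hex p)
    refine ⟨γ, (key γ).2 hγ, fun g hg => ?_⟩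
    have h2 := hinj _ (g * γ⁻¹) (γ • p) hγ (by
      rw [mul_smul, inv_smul_smul]; exact (key g).1 hg)
    exact mul_inv_eq_one.1 h2

/-- The integral over `F × [0, ∞)` with respect to the hyperbolic volume. As the
developing map is locally an isometry, this is an integral over hyperbolic space, in which each
point is counted once for each of its preimages in `F × [0, ∞)`. If `F` is a fundamental set
and `φ` is invariant, then it is the integral of `φ` over `M`. -/
def integralOver (F : Set T) (φ : T × ℝ → ENNReal) : ENNReal :=
  ∫⁻ y, ∑' x : {x : T × ℝ // x.1 ∈ F ∧ 0 ≤ x.2 ∧ M.dev x = y}, φ x ∂hypVol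

/-- `n`, the pointwise norm of a tensor on the universal cover, descends to a continuous function
on `M` and has a finite integral of its square over `M`. -/
def HasFiniteL2Norm (n : T × ℝ → ℝ) : Prop :=
  ContinuousOn n (Set.univ ×ˢ Set.Ici 0) ∧
  (∀ (γ : Γ) (p : T) (t : ℝ), 0 ≤ t → n (γ • p, t) = n (p, t)) ∧
  ∀ F : Set T, IsFundamentalSet Γ F → M.integralOver F (fun x => ENNReal.ofReal (n x ^ 2)) < ⊤

end GeomFiniteEnd

end HypEnd

end

/-! The section assigns to x the 2-jet of the coefficient f at the endpoint π(x) of the normal ray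
through x. Moving the base point of a Taylor polynomial only produces its top term, so ds = ½
f'''(π) (z - π)² dπ (`hasDerivAt_osculating`). After a Möbius motion that makes the endpoint finite,
π(x) = x.1 - x.2² κ(x) with κ smooth across x.2 = 0 (`LocalForm`). A quadratic field whose double
zero lies within O(x.2²) of x.1 has fibre norm O(x.2), and a unit tangent vector contributes another
factor x.2. Hence |ds| = x.2² G with G continuous up to the ideal boundary, and the same rate holds
for Δs, div Re s and its differential. The squares are integrable because x.2⁴ against the volume
density x.2⁻³ leaves x.2 on a bounded set (`IsTame.hasFiniteFibreSum`).

The smoothness of κ is the geometric point. Along a unit speed geodesic the hyperboloid coordinates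
solve u'' = u, so they are combinations of eᵗ and e⁻ᵗ (`eq_exp_combination`). The moved developing
map is therefore a smooth function `collar` of the point p and ε = e⁻ᵗ, extends to ε = 0, and has
horizontal part even in ε. It is a local diffeomorphism at ε = 0 once the endpoint map is an
immersion. Here convexity enters: the endpoint moves according to Y + ∇_Y n, and ∇_Y n = -Y
contradicts a nonnegative second fundamental form unless Y = 0 (`eq_zero_of_endVar`). The inverse
function theorem then gives `exists_localForm_infty`.

The four norms are unchanged by isometries and by adding a flat section (`IsAdapted`), while a deck
transformation changes the canonical lift exactly by a pullback and a constant
(`canonicalLift_smul`). So the norms descend to M (`normOn_smul`). Compactness of time intervals and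
of the surface reduces the integral to finitely many sets on which the developing map is injective;
an arbitrary fundamental set is cut into countably many pieces that are moved disjointly into their
union (`integralOver_lt_top`). -/

open scoped Manifold ContDiff Topology MatrixGroups

noncomputable section

namespace HypEnd

/-! ### The action of `SL(2, ℂ)` -/

/-- The denominator of the Poincaré extension. -/
def hypDen (A : SL(2, ℂ)) (x : Amb) : ℝ :=
  ‖A 1 0 * x.1 + A 1 1‖ ^ 2 + ‖A 1 0‖ ^ 2 * x.2 ^ 2

theorem det_eq (A : SL(2, ℂ)) : A 0 0 * A 1 1 - A 0 1 * A 1 0 = 1 := by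
  have := A.det_coe
  rwa [Matrix.det_fin_two] at this

theorem hypDen_pos (A : SL(2, ℂ)) {x : Amb} (hx : 0 < x.2) : 0 < hypDen A x := by
  unfold hypDen
  by_cases hc : A 1 0 = 0
  · have hd : A 1 1 ≠ 0 := by
      intro hd
      have := det_eq A
      simp [hc, hd] at this
    simp only [hc, zero_mul, zero_add, norm_zero]
    have := norm_pos_iff.2 hd
    positivity
  · have := norm_pos_iff.2 hc
    positivity

theorem hypAct_fst (A : SL(2, ℂ)) (x : Amb) : (hypAct A x).1 =
    ((A 0 0 * x.1 + A 0 1) * starRingEnd ℂ (A 1 0 * x.1 + A 1 1) +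
      A 0 0 * starRingEnd ℂ (A 1 0) * (x.2 : ℂ) ^ 2) / (hypDen A x : ℂ) := rfl

theorem hypAct_snd (A : SL(2, ℂ)) (x : Amb) : (hypAct A x).2 = x.2 / hypDen A x := rfl

theorem hypAct_pos (A : SL(2, ℂ)) {x : Amb} (hx : 0 < x.2) : 0 < (hypAct A x).2 :=
  div_pos hx (hypDen_pos A hx)

theorem hypDen_coe (A : SL(2, ℂ)) (x : Amb) : (hypDen A x : ℂ) =
    (A 1 0 * x.1 + A 1 1) * starRingEnd ℂ (A 1 0 * x.1 + A 1 1) +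
      A 1 0 * starRingEnd ℂ (A 1 0) * (x.2 : ℂ) ^ 2 := by
  simp only [hypDen, Complex.mul_conj, Complex.normSq_eq_norm_sq]
  push_cast
  ring

theorem contDiff_hypDen (A : SL(2, ℂ)) : ContDiff ℝ ∞ (hypDen A) := by
  have : hypDen A = fun x : Amb => ‖A 1 0 * x.1 + A 1 1‖ ^ 2 + ‖A 1 0‖ ^ 2 * x.2 ^ 2 := rfl
  rw [this]
  refine ContDiff.add (ContDiff.norm_sq ℝ ?_) ?_ <;> fun_prop

theorem contDiffAt_hypAct (A : SL(2, ℂ)) {x : Amb} (hx : 0 < x.2) :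
    ContDiffAt ℝ ∞ (hypAct A) x := by
  have h0 := (hypDen_pos A hx).ne'
  have hN := (contDiff_hypDen A).contDiffAt (x := x)
  have hc : ContDiffAt ℝ ∞ (fun x : Amb => (hypDen A x : ℂ)) x :=
    Complex.ofRealCLM.contDiff.contDiffAt.comp x hN
  have h2 : ContDiffAt ℝ ∞ (fun x : Amb => (x.2 : ℂ)) x :=
    Complex.ofRealCLM.contDiff.contDiffAt.comp x contDiffAt_snd
  have h3 : ContDiffAt ℝ ∞ (fun x : Amb => starRingEnd ℂ (A 1 0 * x.1 + A 1 1)) x :=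
    Complex.conjCLE.contDiff.contDiffAt.comp x (by fun_prop)
  refine ContDiffAt.prodMk (f := fun x => (hypAct A x).1) (g := fun x => (hypAct A x).2) ?_ ?_
  · simp only [hypAct_fst, div_eq_mul_inv]
    refine ContDiffAt.mul (ContDiffAt.add (ContDiffAt.mul (by fun_prop) h3)
      (ContDiffAt.mul (by fun_prop) (h2.pow 2))) (hc.inv (by exact_mod_cast h0))
  · simp only [hypAct_snd]
    exact contDiffAt_snd.div hN h0

/-- Cocycle rule for the denominators. After clearing `hypDen B x`, the two sides differ by a
multiple of |det B|² - 1; conjugates are made independent variables so that the identity becomes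
polynomial. -/
theorem hypDen_mul (A B : SL(2, ℂ)) {x : Amb} (hx : 0 < x.2) :
    hypDen (A * B) x = hypDen A (hypAct B x) * hypDen B x := by
  have hB := (hypDen_pos B hx).ne'
  have h0 : (hypDen B x : ℂ) ≠ 0 := by exact_mod_cast hB
  have key : (hypDen (A * B) x : ℂ) = (hypDen A (hypAct B x) : ℂ) * (hypDen B x : ℂ) := by
    rw [hypDen_coe A, hypAct_fst, hypAct_snd, hypDen_coe (A * B)]
    simp only [Matrix.SpecialLinearGroup.coe_mul, Matrix.mul_apply, Fin.sum_univ_two, map_add,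
      map_mul, map_div₀, Complex.conj_ofReal, Complex.conj_conj, map_pow, Complex.ofReal_div]
    field_simp
    have h1 := hypDen_coe B x
    simp only [map_add, map_mul] at h1
    have hd := det_eq B
    have hd' : starRingEnd ℂ (B 0 0) * starRingEnd ℂ (B 1 1) -
        starRingEnd ℂ (B 0 1) * starRingEnd ℂ (B 1 0) = 1 := by
      rw [← map_mul, ← map_mul, ← map_sub, hd, map_one]
    generalize starRingEnd ℂ (B 0 0) = a' at *
    generalize starRingEnd ℂ (B 0 1) = b' at *
    generalize starRingEnd ℂ (B 1 0) = c' at *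
    generalize starRingEnd ℂ (B 1 1) = d' at *
    generalize starRingEnd ℂ x.1 = y' at *
    generalize starRingEnd ℂ (A 1 0) = p' at *
    generalize starRingEnd ℂ (A 1 1) = q' at *
    generalize (x.2 : ℂ) = t at *
    generalize x.1 = y at *
    generalize (hypDen B x : ℂ) = N at *
    generalize B 0 0 = a at *
    generalize B 0 1 = b at *
    generalize B 1 0 = c at *
    generalize B 1 1 = d at *
    subst h1
    linear_combination ((A 1 0) * p' * t ^ 2 * ((a * d - b * c) * (hd') + hd))
  exact_mod_cast key

theorem hypAct_mul (A B : SL(2, ℂ)) {x : Amb} (hx : 0 < x.2) :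
    hypAct (A * B) x = hypAct A (hypAct B x) := by
  have hB := (hypDen_pos B hx).ne'
  have hA := (hypDen_pos A (hypAct_pos B hx)).ne'
  have h0 : (hypDen B x : ℂ) ≠ 0 := by exact_mod_cast hB
  have h0' : (hypDen A (hypAct B x) : ℂ) ≠ 0 := by exact_mod_cast hA
  refine Prod.ext ?_ ?_
  · rw [hypAct_fst (A * B), hypAct_fst A (hypAct B x), hypDen_mul A B hx]
    push_cast
    rw [div_eq_div_iff (mul_ne_zero h0' h0) h0', mul_comm (hypDen A _ : ℂ) (hypDen B x : ℂ),
      ← mul_assoc]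
    congr 1
    rw [hypAct_fst, hypAct_snd]
    simp only [Matrix.SpecialLinearGroup.coe_mul, Matrix.mul_apply, Fin.sum_univ_two, map_add,
      map_mul, map_div₀, Complex.conj_ofReal, Complex.conj_conj, map_pow, Complex.ofReal_div]
    field_simp
    have h1 := hypDen_coe B x
    simp only [map_add, map_mul] at h1
    have hd := det_eq B
    have hd' : starRingEnd ℂ (B 0 0) * starRingEnd ℂ (B 1 1) -
        starRingEnd ℂ (B 0 1) * starRingEnd ℂ (B 1 0) = 1 := by
      rw [← map_mul, ← map_mul, ← map_sub, hd, map_one]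
    generalize starRingEnd ℂ (B 0 0) = a' at *
    generalize starRingEnd ℂ (B 0 1) = b' at *
    generalize starRingEnd ℂ (B 1 0) = c' at *
    generalize starRingEnd ℂ (B 1 1) = d' at *
    generalize starRingEnd ℂ x.1 = y' at *
    generalize starRingEnd ℂ (A 1 0) = p' at *
    generalize starRingEnd ℂ (A 1 1) = q' at *
    generalize (x.2 : ℂ) = t at *
    generalize x.1 = y at *
    generalize (hypDen B x : ℂ) = N at *
    generalize B 0 0 = a at *
    generalize B 0 1 = b at *
    generalize B 1 0 = c at *
    generalize B 1 1 = d at *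
    subst h1
    linear_combination ((A 0 0) * p' * t ^ 2 * ((a * d - b * c) * (hd') + hd))
  · rw [hypAct_snd (A * B), hypAct_snd A, hypAct_snd B, hypDen_mul A B hx, div_div, mul_comm]

theorem hypAct_one (x : Amb) : hypAct 1 x = x := by
  refine Prod.ext ?_ ?_ <;> simp [hypAct]

theorem hypAct_inv (A : SL(2, ℂ)) {x : Amb} (hx : 0 < x.2) : hypAct A⁻¹ (hypAct A x) = x := by
  rw [← hypAct_mul _ _ hx, inv_mul_cancel, hypAct_one]

theorem hypAct_inv' (A : SL(2, ℂ)) {x : Amb} (hx : 0 < x.2) : hypAct A (hypAct A⁻¹ x) = x := by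
  rw [← hypAct_mul _ _ hx, mul_inv_cancel, hypAct_one]

/-! ### Projective fields -/

theorem pullback_mul (A B : SL(2, ℂ)) (k : ProjField) :
    pullback (A * B) k = pullback B (pullback A k) := by
  ext i
  fin_cases i <;>
  · simp [pullback, Matrix.mul_apply, Fin.sum_univ_two]
    ring

theorem pullback_one (k : ProjField) : pullback 1 k = k := by
  ext i
  fin_cases i <;> simp [pullback]

/-- The pullback of projective fields as a linear map. -/
def pullbackLin (A : SL(2, ℂ)) : ProjField →L[ℂ] ProjField :=
  LinearMap.toContinuousLinearMap
    { toFun := pullback A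
      map_add' := fun k l => by
        ext i
        fin_cases i <;>
        · simp [pullback]
          ring
      map_smul' := fun c k => by
        ext i
        fin_cases i <;>
        · simp [pullback]
          ring }

@[simp] theorem pullbackLin_apply (A : SL(2, ℂ)) (k : ProjField) :
    pullbackLin A k = pullback A k := rfl

theorem pullback_add (A : SL(2, ℂ)) (k l : ProjField) :
    pullback A (k + l) = pullback A k + pullback A l := (pullbackLin A).map_add k l

theorem pullback_smul (A : SL(2, ℂ)) (c : ℂ) (k : ProjField) :
    pullback A (c • k) = c • pullback A k := (pullbackLin A).map_smul c k

theorem pullback_inv (A : SL(2, ℂ)) (k : ProjField) : pullback A (pullback A⁻¹ k) = k := by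
  rw [← pullback_mul, inv_mul_cancel, pullback_one]

/-! ### Hyperbolic isometries -/

/-- The Poincaré extension of `A` is isometric at every point and intertwines Killing fields. -/
def ActsIsometrically (A : SL(2, ℂ)) : Prop :=
  ∀ x : Amb, 0 < x.2 →
    (∀ u v, hypInner (hypAct A x) (fderiv ℝ (hypAct A) x u) (fderiv ℝ (hypAct A) x v) =
      hypInner x u v) ∧
    ∀ k, fderiv ℝ (hypAct A) x (killing (pullback A k) x) = killing k (hypAct A x)

theorem eventually_pos {x : Amb} (hx : 0 < x.2) : ∀ᶠ y in 𝓝 x, 0 < y.2 :=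
  continuous_snd.continuousAt.eventually (lt_mem_nhds hx)

/-- By the chain rule the property passes to products, so it only has to be checked on generators:
upper triangular matrices and the inversion. -/
theorem ActsIsometrically.mul {A B : SL(2, ℂ)} (hA : ActsIsometrically A)
    (hB : ActsIsometrically B) : ActsIsometrically (A * B) := by
  intro x hx
  have hBx := hypAct_pos B hx
  have he : hypAct (A * B) =ᶠ[𝓝 x] hypAct A ∘ hypAct B := by
    filter_upwards [eventually_pos hx] with y hy
    exact hypAct_mul A B hy
  have hf : fderiv ℝ (hypAct (A * B)) x =
      (fderiv ℝ (hypAct A) (hypAct B x)).comp (fderiv ℝ (hypAct B) x) := by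
    rw [he.fderiv_eq]
    exact fderiv_comp x ((contDiffAt_hypAct A hBx).differentiableAt (by simp))
      ((contDiffAt_hypAct B hx).differentiableAt (by simp))
  refine ⟨fun u v => ?_, fun k => ?_⟩
  · rw [hf, hypAct_mul A B hx]
    simp only [ContinuousLinearMap.comp_apply]
    rw [(hA _ hBx).1, (hB _ hx).1]
  · rw [hf, hypAct_mul A B hx, pullback_mul]
    simp only [ContinuousLinearMap.comp_apply]
    rw [(hB _ hx).2, (hA _ hBx).2]

/-- With lower left entry zero the action is affine, (w, t) ↦ (a² w + ab, t / |d|²) with ad = 1, so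
its derivative is the constant map `R`. -/
theorem actsIsometrically_of_upper {A : SL(2, ℂ)} (hc : A 1 0 = 0) : ActsIsometrically A := by
  intro x hx
  have hdet := det_eq A
  simp only [hc, mul_zero, sub_zero] at hdet
  have hd : A 1 1 ≠ 0 := by
    intro hd
    simp [hd] at hdet
  have ha : A 0 0 = (A 1 1)⁻¹ := eq_inv_of_mul_eq_one_left hdet
  have hD : ∀ x, hypDen A x = ‖A 1 1‖ ^ 2 := fun x => by simp [hypDen, hc]
  have hN : (‖A 1 1‖ : ℝ) ≠ 0 := norm_ne_zero_iff.2 hd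
  let R : Amb →L[ℝ] Amb := ContinuousLinearMap.prodMap
    (((A 0 0 ^ 2) • (1 : ℂ →L[ℂ] ℂ)).restrictScalars ℝ) ((‖A 1 1‖ ^ 2)⁻¹ • (1 : ℝ →L[ℝ] ℝ))
  have hR : ∀ u, R u = (A 0 0 ^ 2 * u.1, (‖A 1 1‖ ^ 2)⁻¹ * u.2) := fun u => by
    refine Prod.ext ?_ ?_ <;> simp [R]
  have hform : hypAct A = fun x => R x + (A 0 0 * A 0 1, 0) := by
    ext1 y
    refine Prod.ext ?_ ?_
    · rw [hypAct_fst, hD, hR, ← Complex.normSq_eq_norm_sq, ← Complex.mul_conj, hc]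
      have : starRingEnd ℂ (A 1 1) ≠ 0 := by simpa using hd
      simp only [zero_mul, zero_add, map_zero, mul_zero, add_zero, Prod.fst_add]
      rw [ha]
      field_simp
    · rw [hypAct_snd, hD, hR]
      simp only [Prod.snd_add, add_zero]
      ring
  have hf : fderiv ℝ (hypAct A) x = R := by
    rw [hform]
    simp
  have hn : ‖A 0 0‖ = (‖A 1 1‖)⁻¹ := by rw [ha, norm_inv]
  rw [hf]
  refine ⟨fun u v => ?_, fun k => ?_⟩
  · unfold hypInner
    rw [hypAct_snd, hD, hR, hR]
    have h1 : A 0 0 ^ 2 * u.1 * starRingEnd ℂ (A 0 0 ^ 2 * v.1) =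
        ((‖A 0 0‖ ^ 4 : ℝ) : ℂ) * (u.1 * starRingEnd ℂ v.1) := by
      have := Complex.mul_conj (A 0 0)
      rw [Complex.normSq_eq_norm_sq] at this
      push_cast at this ⊢
      rw [map_mul, map_pow]
      linear_combination (u.1 * starRingEnd ℂ v.1) *
        ((A 0 0 * starRingEnd ℂ (A 0 0)) + (‖A 0 0‖ : ℂ) ^ 2) * this
    simp only [h1, Complex.re_ofReal_mul]
    rw [hn]
    field_simp
  · rw [hform, hR]
    refine Prod.ext ?_ ?_
    · simp only [killing, ProjField.eval, pullback, hc, hR, Matrix.cons_val]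
      have h1 := Complex.mul_conj (A 0 0)
      rw [Complex.normSq_eq_norm_sq, hn] at h1
      push_cast at h1 ⊢
      simp only [map_mul, map_add, map_pow]
      simp only [Prod.fst_add, Prod.snd_add, add_zero, map_zero]
      push_cast
      have h2 : A 0 0 * A 1 1 = 1 := hdet
      generalize starRingEnd ℂ (A 0 0) = a' at *
      generalize A 0 0 = a at *
      generalize A 1 1 = d at *
      generalize (‖d‖ : ℂ) = n at *
      have h3 : a' ^ 2 * a ^ 2 = (n ^ 2)⁻¹ ^ 2 := by
        rw [inv_pow] at h1
        rw [← h1]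
        ring
      linear_combination (-(x.2 : ℂ) ^ 2 * starRingEnd ℂ (k 2)) * h3 +
        (k 0 * (a * d + 1) + k 1 * a * (a * x.1 + A 0 1) + k 1 * 0) * h2
    · simp only [killing, pullback, hc, hR, Matrix.cons_val, Prod.snd_add, add_zero, Prod.fst_add]
      have h2 : k 1 + 2 * k 2 * (A 0 0 ^ 2 * x.1 + A 0 0 * A 0 1) =
        (2 * k 0 * (0 * A 1 1) + k 1 * (A 0 0 * A 1 1 + A 0 1 * 0) + 2 * k 2 * (A 0 0 * A 0 1)) +
        2 * (k 0 * 0 ^ 2 + k 1 * (A 0 0 * 0) + k 2 * A 0 0 ^ 2) * x.1 := by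
        linear_combination (-k 1) * hdet
      rw [h2]
      ring

theorem hypDen_inversion (x : Amb) :
    hypDen inversion x = x.1.re ^ 2 + x.1.im ^ 2 + x.2 ^ 2 := by
  simp only [hypDen, inversion]
  simp [← Complex.normSq_eq_norm_sq, Complex.normSq_apply]
  ring

theorem hypAct_inversion (x : Amb) : hypAct inversion x =
    (x.1.re ^ 2 + x.1.im ^ 2 + x.2 ^ 2)⁻¹ • ((-starRingEnd ℂ x.1, x.2) : Amb) := by
  refine Prod.ext ?_ ?_
  · rw [hypAct_fst, hypDen_inversion]
    simp [inversion, div_eq_inv_mul]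
  · rw [hypAct_snd, hypDen_inversion]
    simp [div_eq_inv_mul]

theorem fderiv_hypAct_inversion {x : Amb} (hx : 0 < x.2) (u : Amb) :
    fderiv ℝ (hypAct inversion) x u =
      (x.1.re ^ 2 + x.1.im ^ 2 + x.2 ^ 2)⁻¹ • ((-starRingEnd ℂ u.1, u.2) : Amb) -
      ((x.1.re ^ 2 + x.1.im ^ 2 + x.2 ^ 2)⁻¹ ^ 2 *
        (2 * (x.1.re * u.1.re + x.1.im * u.1.im + x.2 * u.2))) •
        ((-starRingEnd ℂ x.1, x.2) : Amb) := by
  have hpos : 0 < x.1.re ^ 2 + x.1.im ^ 2 + x.2 ^ 2 := by positivity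
  have hform : hypAct inversion = fun x : Amb => (x.1.re ^ 2 + x.1.im ^ 2 + x.2 ^ 2)⁻¹ •
    ((ContinuousLinearMap.prodMap (-Complex.conjCLE.toContinuousLinearMap)
      (1 : ℝ →L[ℝ] ℝ) : Amb →L[ℝ] Amb) x) := by
    ext1 y
    rw [hypAct_inversion]
    refine Prod.ext ?_ ?_ <;> simp
  have h1 : HasFDerivAt (fun x : Amb => x.1.re)
      (Complex.reCLM.comp (ContinuousLinearMap.fst ℝ ℂ ℝ)) x :=
    (Complex.reCLM.comp (ContinuousLinearMap.fst ℝ ℂ ℝ)).hasFDerivAt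
  have h2 : HasFDerivAt (fun x : Amb => x.1.im)
      (Complex.imCLM.comp (ContinuousLinearMap.fst ℝ ℂ ℝ)) x :=
    (Complex.imCLM.comp (ContinuousLinearMap.fst ℝ ℂ ℝ)).hasFDerivAt
  have h3 : HasFDerivAt (fun x : Amb => x.2) (ContinuousLinearMap.snd ℝ ℂ ℝ) x :=
    (ContinuousLinearMap.snd ℝ ℂ ℝ).hasFDerivAt
  have h4 := (((h1.pow 2).add (h2.pow 2)).add (h3.pow 2))
  have h5 := (hasDerivAt_inv hpos.ne').comp_hasFDerivAt x h4
  have h6 := h5.smul (ContinuousLinearMap.prodMap (-Complex.conjCLE.toContinuousLinearMap)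
      (1 : ℝ →L[ℝ] ℝ) : Amb →L[ℝ] Amb).hasFDerivAt
  rw [hform]
  erw [h6.fderiv]
  refine Prod.ext ?_ ?_
  · simp
    ring
  · simp
    ring

theorem actsIsometrically_inversion : ActsIsometrically inversion := by
  intro x hx
  have hpos : 0 < x.1.re ^ 2 + x.1.im ^ 2 + x.2 ^ 2 := by positivity
  have hne := hpos.ne'
  have hx' := hx.ne'
  refine ⟨fun u v => ?_, fun k => ?_⟩
  · rw [fderiv_hypAct_inversion hx, fderiv_hypAct_inversion hx, hypAct_inversion]
    simp only [hypInner, Prod.fst_sub, Prod.snd_sub, Prod.smul_fst, Prod.smul_snd, Complex.mul_re,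
      Complex.sub_re, Complex.sub_im, Complex.smul_re, Complex.smul_im, Complex.conj_re,
      Complex.conj_im, Complex.neg_re, Complex.neg_im, smul_eq_mul]
    field_simp
    ring
  · rw [fderiv_hypAct_inversion hx, hypAct_inversion]
    refine Prod.ext (Complex.ext ?_ ?_) ?_
    all_goals
      simp only [killing, pullback, ProjField.eval, inversion, pow_two, Prod.fst_sub, Prod.snd_sub,
        Prod.smul_fst, Prod.smul_snd, Complex.mul_re, Complex.mul_im, Complex.sub_re,
        Complex.sub_im, Complex.add_re, Complex.add_im, Complex.smul_re, Complex.smul_im,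
        Complex.conj_re, Complex.conj_im, Complex.neg_re, Complex.neg_im, smul_eq_mul,
        Complex.ofReal_re, Complex.ofReal_im, Matrix.SpecialLinearGroup.coe_mk, Matrix.of_apply,
        Matrix.cons_val, Matrix.cons_val', Complex.zero_re, Complex.zero_im, Complex.one_re,
        Complex.one_im, Complex.re_ofNat, Complex.im_ofNat]
      field_simp
      ring

/-- Hyperbolic space is acted on by orientation preserving isometries. -/
theorem actsIsometrically (A : SL(2, ℂ)) : ActsIsometrically A := by
  by_cases hc : A 1 0 = 0
  · exact actsIsometrically_of_upper hc
  · have hdet := det_eq A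
    let U : SL(2, ℂ) := ⟨!![1, A 0 0 / A 1 0; 0, 1], by simp [Matrix.det_fin_two]⟩
    let V : SL(2, ℂ) := ⟨!![A 1 0, A 1 1; 0, (A 1 0)⁻¹], by simp [Matrix.det_fin_two, hc]⟩
    -- Bruhat decomposition of a matrix with nonzero lower left entry.
    have h : A = U * (inversion * V) := by
      ext i j
      simp only [Matrix.SpecialLinearGroup.coe_mul, Matrix.mul_apply, Fin.sum_univ_two]
      fin_cases i <;> fin_cases j
      · simp [U, V, inversion]
        field_simp
      · simp [U, V, inversion]
        field_simp
        linear_combination -hdet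
      · simp [U, V, inversion]
      · simp [U, V, inversion]
    rw [h]
    exact (actsIsometrically_of_upper (A := U) (by simp [U])).mul
      (actsIsometrically_inversion.mul (actsIsometrically_of_upper (A := V) (by simp [V])))

/-- Pullback commutes with multiplication by i, so each of the two summands of the fibre metric is
carried to its counterpart by the isometry. -/
theorem fibreInner_pullback (A : SL(2, ℂ)) {x : Amb} (hx : 0 < x.2) (k l : ProjField) :
    fibreInner x (pullback A k) (pullback A l) = fibreInner (hypAct A x) k l := by
  have h := actsIsometrically A x hx
  unfold fibreInner
  rw [← pullback_smul, ← pullback_smul, ← h.1, ← h.1, h.2, h.2, h.2, h.2]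

/-! ### Orthonormal frames and the hyperbolic volume -/

theorem hypInner_eq_sum (x u v : Amb) :
    hypInner x u v = (∑ i, coordOf u i * coordOf v i) / x.2 ^ 2 := by
  simp [hypInner, coordOf, Fin.sum_univ_three]

theorem sum_coordOf (u : Amb) : ∑ i, coordOf u i • coordVec i = u := by
  refine Prod.ext (Complex.ext ?_ ?_) ?_ <;> simp [coordOf, coordVec, Fin.sum_univ_three]

theorem coordOf_coordVec (i j : Fin 3) : coordOf (coordVec i) j = if i = j then 1 else 0 := by
  fin_cases i <;> fin_cases j <;> simp [coordOf, coordVec]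

theorem coordOf_add (u v : Amb) : coordOf (u + v) = coordOf u + coordOf v := by
  ext i
  fin_cases i <;> simp [coordOf]

theorem coordOf_smul (c : ℝ) (u : Amb) : coordOf (c • u) = c • coordOf u := by
  ext i
  fin_cases i <;> simp [coordOf]

/-- The coordinates of tangent vectors as a continuous linear map. -/
def coordLin : Amb →L[ℝ] (Fin 3 → ℝ) :=
  LinearMap.toContinuousLinearMap
    { toFun := coordOf
      map_add' := coordOf_add
      map_smul' := coordOf_smul }

@[simp] theorem coordLin_apply (u : Amb) : coordLin u = coordOf u := rfl

/-- The basis `∂/∂x, ∂/∂y, ∂/∂t` of the ambient space. -/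
def coordBasis : Module.Basis (Fin 3) ℝ Amb :=
  Module.Basis.ofEquivFun
    { coordLin.toLinearMap with
      invFun := fun c => ∑ i, c i • coordVec i
      left_inv := sum_coordOf
      right_inv := fun c => by
        ext i
        fin_cases i <;> simp [coordOf, coordVec, Fin.sum_univ_three] }

theorem coordBasis_apply (i : Fin 3) : coordBasis i = coordVec i := by
  rw [coordBasis, Module.Basis.coe_ofEquivFun]
  change ∑ j, (Pi.single i 1 : Fin 3 → ℝ) j • coordVec j = _
  simp [Pi.single_apply]

theorem coordBasis_repr (u : Amb) (i : Fin 3) : coordBasis.repr u i = coordOf u i := rfl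

/-- A linear map between tangent spaces of hyperbolic space that preserves the metric. -/
structure IsTangentIsometry (x y : Amb) (L : Amb →L[ℝ] Amb) : Prop where
  left_pos : 0 < x.2
  right_pos : 0 < y.2
  inner_eq : ∀ u v, hypInner y (L u) (L v) = hypInner x u v

theorem isTangentIsometry_hypAct (A : SL(2, ℂ)) {x : Amb} (hx : 0 < x.2) :
    IsTangentIsometry x (hypAct A x) (fderiv ℝ (hypAct A) x) :=
  ⟨hx, hypAct_pos A hx, (actsIsometrically A x hx).1⟩

namespace IsTangentIsometry

variable {x y : Amb} {L : Amb →L[ℝ] Amb}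

/-- Both metrics are conformal to the Euclidean one, so after division by the ratio of the conformal
factors the matrix of `L` is orthogonal. -/
theorem mul_transpose (h : IsTangentIsometry x y L) :
    (Matrix.of fun i j => x.2 / y.2 * coordOf (L (coordVec i)) j) *
      (Matrix.of fun i j => x.2 / y.2 * coordOf (L (coordVec i)) j).transpose = 1 := by
  have hx := h.left_pos.ne'
  have hy := h.right_pos.ne'
  ext i j
  have := h.inner_eq (coordVec i) (coordVec j)
  rw [hypInner_eq_sum, hypInner_eq_sum, div_eq_div_iff (pow_ne_zero _ hy)
      (pow_ne_zero _ hx)] at this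
  simp only [coordOf_coordVec, ite_mul, one_mul, zero_mul, Finset.sum_ite_eq, Finset.mem_univ,
    if_true] at this
  simp only [Matrix.mul_apply, Matrix.transpose_apply, Matrix.of_apply, Matrix.one_apply]
  have h2 : ∑ k, x.2 / y.2 * coordOf (L (coordVec i)) k * (x.2 / y.2 * coordOf (L (coordVec j)) k) =
      (∑ k, coordOf (L (coordVec i)) k * coordOf (L (coordVec j)) k) * x.2 ^ 2 / y.2 ^ 2 := by
    rw [Finset.sum_mul, Finset.sum_div]
    refine Finset.sum_congr rfl fun k _ => ?_
    field_simp
  rw [h2, this]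
  rcases eq_or_ne i j with rfl | hij
  · simp [hy]
  · simp [hij, hij.symm]

theorem transpose_mul (h : IsTangentIsometry x y L) (j k : Fin 3) :
    ∑ i, (x.2 / y.2 * coordOf (L (coordVec i)) j) * (x.2 / y.2 * coordOf (L (coordVec i)) k) =
      if j = k then 1 else 0 := by
  have := congrArg (fun m : Matrix (Fin 3) (Fin 3) ℝ => m j k)
    (mul_eq_one_comm.1 h.mul_transpose)
  simpa [Matrix.mul_apply, Matrix.one_apply] using this

theorem map_frame (h : IsTangentIsometry x y L) (i : Fin 3) :
    L (frame x i) = ∑ j, (x.2 / y.2 * coordOf (L (coordVec i)) j) • frame y j := by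
  have hy := h.right_pos.ne'
  conv_lhs => rw [frame, map_smul, ← sum_coordOf (L (coordVec i)), Finset.smul_sum]
  refine Finset.sum_congr rfl fun j _ => ?_
  rw [frame, smul_smul, smul_smul]
  congr 1
  field_simp

/-- Traces of bilinear forms are invariant under isometries. -/
theorem sum_map_frame (h : IsTangentIsometry x y L) (b : Amb →ₗ[ℝ] Amb →ₗ[ℝ] ℝ) :
    ∑ i, b (L (frame x i)) (L (frame x i)) = ∑ j, b (frame y j) (frame y j) := by
  have h1 : ∀ i, b (L (frame x i)) (L (frame x i)) = ∑ j, ∑ k,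
      ((x.2 / y.2 * coordOf (L (coordVec i)) j) * (x.2 / y.2 * coordOf (L (coordVec i)) k)) *
        b (frame y j) (frame y k) := by
    intro i
    rw [h.map_frame]
    simp only [map_sum, map_smul, LinearMap.sum_apply, LinearMap.smul_apply, smul_eq_mul,
      Finset.mul_sum]
    rw [Finset.sum_comm]
    refine Finset.sum_congr rfl fun j _ => Finset.sum_congr rfl fun k _ => by ring
  simp only [h1]
  rw [Finset.sum_comm]
  refine Finset.sum_congr rfl fun j _ => ?_
  rw [Finset.sum_comm]
  simp only [← Finset.sum_mul, h.transpose_mul]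
  simp

theorem abs_det (h : IsTangentIsometry x y L) : |L.det| = (y.2 / x.2) ^ 3 := by
  have hx := h.left_pos
  have hy := h.right_pos
  have h1 := congrArg Matrix.det h.mul_transpose
  rw [Matrix.det_mul, Matrix.det_transpose, Matrix.det_one] at h1
  have h2 : (Matrix.of fun i j => x.2 / y.2 * coordOf (L (coordVec i)) j) =
      (x.2 / y.2) • (LinearMap.toMatrix coordBasis coordBasis L.toLinearMap).transpose := by
    ext i j
    simp [LinearMap.toMatrix_apply, coordBasis_apply, coordBasis_repr]
  rw [h2, Matrix.det_smul, Matrix.det_transpose, LinearMap.det_toMatrix] at h1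
  have h3 : ((x.2 / y.2) ^ 3 * L.det) ^ 2 = 1 := by
    rw [← h1, Fintype.card_fin]
    change _ = (x.2 / y.2) ^ 3 * L.det * ((x.2 / y.2) ^ 3 * L.det)
    ring
  have h4 : |(x.2 / y.2) ^ 3 * L.det| = 1 := by
    rw [← sq_eq_sq₀ (abs_nonneg _) zero_le_one, sq_abs, h3, one_pow]
  rw [abs_mul, abs_of_pos (by positivity)] at h4
  rw [div_pow] at h4 ⊢
  field_simp at h4 ⊢
  linarith

end IsTangentIsometry

theorem measurableSet_upper : MeasurableSet {x : Amb | 0 < x.2} :=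
  (isOpen_lt continuous_const continuous_snd).measurableSet

open MeasureTheory in
theorem lintegral_hypVol (f : Amb → ENNReal) : ∫⁻ y, f y ∂hypVol =
    ∫⁻ y in {x : Amb | 0 < x.2}, ENNReal.ofReal ((y.2 ^ 3)⁻¹) * f y := by
  rw [hypVol, lintegral_withDensity_eq_lintegral_mul_non_measurable _ (by fun_prop)
    (Filter.Eventually.of_forall fun x => ENNReal.ofReal_lt_top)]
  rfl

open MeasureTheory in
/-- The hyperbolic volume is invariant under isometries. -/
theorem lintegral_comp_hypAct (A : SL(2, ℂ)) (f : Amb → ENNReal) :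
    ∫⁻ y, f (hypAct A y) ∂hypVol = ∫⁻ y, f y ∂hypVol := by
  have himage : hypAct A '' {x : Amb | 0 < x.2} = {x : Amb | 0 < x.2} := by
    ext y
    constructor
    · rintro ⟨x, hx, rfl⟩
      exact hypAct_pos A hx
    · intro hy
      exact ⟨hypAct A⁻¹ y, hypAct_pos _ hy, hypAct_inv' A hy⟩
  have hinj : Set.InjOn (hypAct A) {x : Amb | 0 < x.2} := by
    intro x hx y hy hxy
    rw [← hypAct_inv A hx, hxy, hypAct_inv A hy]
  have : (volume : Measure Amb).IsAddHaarMeasure := by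
    rw [Measure.volume_eq_prod]
    infer_instance
  have := lintegral_image_eq_lintegral_abs_det_fderiv_mul volume measurableSet_upper
    (f' := fun x => fderiv ℝ (hypAct A) x)
    (fun x hx => ((contDiffAt_hypAct A hx).differentiableAt
      (by simp)).hasFDerivAt.hasFDerivWithinAt) hinj
    (fun y => ENNReal.ofReal ((y.2 ^ 3)⁻¹) * f y)
  rw [himage] at this
  rw [lintegral_hypVol, lintegral_hypVol, this]
  refine setLIntegral_congr_fun measurableSet_upper fun x hx => ?_
  have h := isTangentIsometry_hypAct A hx
  have hx' : x.2 ≠ 0 := (show 0 < x.2 from hx).ne'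
  have hy' := (hypAct_pos A hx).ne'
  simp only [h.abs_det]
  rw [← mul_assoc, ← ENNReal.ofReal_mul (by have := h.right_pos; have := h.left_pos; positivity)]
  congr 2
  field_simp

/-! ### The fibre metric -/

theorem killing_add (k l : ProjField) (x : Amb) :
    killing (k + l) x = killing k x + killing l x := by
  refine Prod.ext ?_ ?_
  · simp [killing, ProjField.eval]
    ring
  · simp [killing]
    ring

theorem killing_smul (c : ℝ) (k : ProjField) (x : Amb) :
    killing (c • k) x = c • killing k x := by
  refine Prod.ext ?_ ?_
  · simp [killing, ProjField.eval]
    ring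
  · simp [killing]
    ring

/-- The value at `x` of Killing fields as a real linear map. -/
def killingLin (x : Amb) : ProjField →L[ℝ] Amb :=
  LinearMap.toContinuousLinearMap
    { toFun := fun k => killing k x
      map_add' := fun k l => killing_add k l x
      map_smul' := fun c k => killing_smul c k x }

@[simp] theorem killingLin_apply (x : Amb) (k : ProjField) : killingLin x k = killing k x := rfl

/-- The hyperbolic inner product as a bilinear form. -/
def hypBilin (x : Amb) : Amb →ₗ[ℝ] Amb →ₗ[ℝ] ℝ :=
  LinearMap.mk₂ ℝ (hypInner x)
    (fun a b c => by simp only [hypInner_eq_sum, coordOf_add, Pi.add_apply, add_mul,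
        Finset.sum_add_distrib, add_div])
    (fun r a b => by
      simp only [hypInner_eq_sum, coordOf_smul, Pi.smul_apply, smul_eq_mul, mul_assoc,
        ← Finset.mul_sum, mul_div_assoc])
    (fun a b c => by simp only [hypInner_eq_sum, coordOf_add, Pi.add_apply, mul_add,
        Finset.sum_add_distrib, add_div])
    (fun r a b => by
      simp only [hypInner_eq_sum, coordOf_smul, Pi.smul_apply, smul_eq_mul, mul_left_comm,
        ← Finset.mul_sum, mul_div_assoc])

@[simp] theorem hypBilin_apply (x u v : Amb) : hypBilin x u v = hypInner x u v := rfl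

/-- The fibre metric as a bilinear form. -/
def fibreBilin (x : Amb) : ProjField →ₗ[ℝ] ProjField →ₗ[ℝ] ℝ :=
  (hypBilin x).compl₁₂ (killingLin x).toLinearMap (killingLin x).toLinearMap +
    (hypBilin x).compl₁₂
      ((killingLin x).toLinearMap ∘ₗ ((Complex.I • LinearMap.id :
          ProjField →ₗ[ℂ] ProjField).restrictScalars ℝ))
      ((killingLin x).toLinearMap ∘ₗ ((Complex.I • LinearMap.id :
          ProjField →ₗ[ℂ] ProjField).restrictScalars ℝ))

@[simp] theorem fibreBilin_apply (x : Amb) (k l : ProjField) :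
    fibreBilin x k l = fibreInner x k l := rfl

/-- The fibre metric in terms of the Taylor coefficients at the base point. -/
theorem fibreInner_eq {x : Amb} (hx : x.2 ≠ 0) (k l : ProjField) : fibreInner x k l =
    (2 * (x.2 ^ 2)⁻¹ * (k.eval x.1 * starRingEnd ℂ (l.eval x.1)).re +
      ((k 1 + 2 * k 2 * x.1) * starRingEnd ℂ (l 1 + 2 * l 2 * x.1)).re +
      2 * x.2 ^ 2 * (k 2 * starRingEnd ℂ (l 2)).re) := by
  have h1 : ∀ k : ProjField, (Complex.I • k).eval x.1 = Complex.I * k.eval x.1 := fun k => by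
    simp [ProjField.eval]
    ring
  have h2 : ∀ k : ProjField, (Complex.I • k) 1 + 2 * (Complex.I • k) 2 * x.1 =
      Complex.I * (k 1 + 2 * k 2 * x.1) := fun k => by
    simp
    ring
  have h3 : ∀ k : ProjField, (Complex.I • k) 2 = Complex.I * k 2 := fun k => by simp
  unfold fibreInner hypInner killing
  simp only [h1, h2]
  simp only [h3]
  generalize k.eval x.1 = a
  generalize l.eval x.1 = a'
  generalize k 1 + 2 * k 2 * x.1 = b
  generalize l 1 + 2 * l 2 * x.1 = b'
  simp [pow_two]
  field_simp
  ring

/-- Projective fields are determined by their Taylor coefficients at a point. -/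
theorem quadAt_taylor (k : ProjField) (w : ℂ) :
    quadAt w (k.eval w) (k 1 + 2 * k 2 * w) (k 2) = k := by
  ext i
  fin_cases i <;> simp [quadAt, ProjField.eval]
  ring

theorem eval_quadAt (w a b c : ℂ) : (quadAt w a b c).eval w = a := by
  simp [quadAt, ProjField.eval]
  ring

theorem deriv_quadAt (w a b c : ℂ) : quadAt w a b c 1 + 2 * quadAt w a b c 2 * w = b := by
  simp [quadAt]

theorem quadAt_two (w a b c : ℂ) : quadAt w a b c 2 = c := rfl

theorem smul_quadAt (w a b c d : ℂ) : d • quadAt w a b c = quadAt w (d * a) (d * b) (d * c) := by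
  ext i
  fin_cases i <;> simp [quadAt] <;> ring

theorem real_smul_quadAt (w a b c : ℂ) (d : ℝ) :
    d • quadAt w a b c = quadAt w (d * a) (d * b) (d * c) := by
  rw [← smul_quadAt]
  ext i
  simp

theorem add_quadAt (w a b c a' b' c' : ℂ) :
    quadAt w a b c + quadAt w a' b' c' = quadAt w (a + a') (b + b') (c + c') := by
  ext i
  fin_cases i <;> simp [quadAt] <;> ring

theorem fibreInner_quadAt {x : Amb} (hx : x.2 ≠ 0) (a b c a' b' c' : ℂ) :
    fibreInner x (quadAt x.1 a b c) (quadAt x.1 a' b' c') =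
      2 * (x.2 ^ 2)⁻¹ * (a * starRingEnd ℂ a').re + (b * starRingEnd ℂ b').re +
        2 * x.2 ^ 2 * (c * starRingEnd ℂ c').re := by
  rw [fibreInner_eq hx, eval_quadAt, eval_quadAt, deriv_quadAt, deriv_quadAt, quadAt_two,
    quadAt_two]

/-- The expansion of an element of the fibre in the orthonormal basis `Eᵢ, i Eᵢ`. -/
theorem sum_realLift {x : Amb} (hx : x.2 ≠ 0) (k : ProjField) :
    ∑ i, (fibreInner x (realLift x i) k • realLift x i +
      fibreInner x (Complex.I • realLift x i) k • (Complex.I • realLift x i)) = k := by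
  conv_rhs => rw [← quadAt_taylor k x.1]
  rw [← quadAt_taylor k x.1, eval_quadAt, deriv_quadAt, quadAt_two]
  have hx' : (x.2 : ℂ) ≠ 0 := by exact_mod_cast hx
  simp only [Fin.sum_univ_three, realLift, Matrix.cons_val, smul_quadAt, fibreInner_quadAt hx,
    real_smul_quadAt, add_quadAt]
  generalize k.eval x.1 = a
  generalize k 1 + 2 * k 2 * x.1 = b
  generalize k 2 = c
  have hre : ∀ z w : ℂ, (z * starRingEnd ℂ w).re = z.re * w.re + z.im * w.im := fun z w => by simp
  have e1 : (x.2 / 2 : ℂ) = ((x.2 / 2 : ℝ) : ℂ) := by push_cast; ring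
  have e2 : (-1 / (2 * x.2) : ℂ) = ((-1 / (2 * x.2) : ℝ) : ℂ) := by push_cast; ring
  have e3 : (Complex.I * x.2 / 2 : ℂ) = Complex.I * ((x.2 / 2 : ℝ) : ℂ) := by push_cast; ring
  have e4 : (Complex.I / (2 * x.2) : ℂ) = Complex.I * ((1 / (2 * x.2) : ℝ) : ℂ) := by
    push_cast; ring
  simp only [e1, e2, e3, e4]
  congr 1
  all_goals
    apply Complex.ext
    all_goals
      simp only [hre, Complex.add_re, Complex.add_im, Complex.mul_re, Complex.mul_im,
        Complex.ofReal_re, Complex.ofReal_im, Complex.I_re, Complex.I_im, Complex.zero_re,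
        Complex.zero_im, Complex.one_re, Complex.one_im]
      field_simp
      ring

theorem fibreInner_comm (x : Amb) (k l : ProjField) : fibreInner x k l = fibreInner x l k := by
  simp only [fibreInner, hypInner_eq_sum, mul_comm]

/-- `flat` represents real linear functionals. -/
theorem fibreInner_flat {x : Amb} (hx : x.2 ≠ 0) (l : ProjField →ₗ[ℝ] ℝ) (k : ProjField) :
    fibreInner x (flat x l) k = l k := by
  conv_rhs => rw [← sum_realLift hx k]
  rw [← fibreBilin_apply, flat]
  simp only [map_sum, map_add, map_smul, LinearMap.sum_apply, LinearMap.add_apply,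
    LinearMap.smul_apply, fibreBilin_apply, smul_eq_mul, mul_comm]

theorem fibreInner_nondegenerate {x : Amb} (hx : x.2 ≠ 0) {k l : ProjField}
    (h : ∀ m, fibreInner x k m = fibreInner x l m) : k = l := by
  rw [← sum_realLift hx k, ← sum_realLift hx l]
  simp only [fibreInner_comm x _ k, fibreInner_comm x _ l, h]

theorem contDiffAt_fibreInner {n : WithTop ℕ∞} {a b : Amb → ProjField} {x : Amb} (hx : x.2 ≠ 0)
    (ha : ContDiffAt ℝ n a x) (hb : ContDiffAt ℝ n b x) :
    ContDiffAt ℝ n (fun y => fibreInner y (a y) (b y)) x := by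
  have he : (fun y => fibreInner y (a y) (b y)) =ᶠ[𝓝 x] fun y =>
      (2 * (y.2 ^ 2)⁻¹ * ((a y).eval y.1 * starRingEnd ℂ ((b y).eval y.1)).re +
      (((a y) 1 + 2 * (a y) 2 * y.1) * starRingEnd ℂ ((b y) 1 + 2 * (b y) 2 * y.1)).re +
      2 * y.2 ^ 2 * ((a y) 2 * starRingEnd ℂ ((b y) 2)).re) := by
    have : ∀ᶠ y in 𝓝 x, y.2 ≠ 0 := continuous_snd.continuousAt.eventually_ne hx
    filter_upwards [this] with y hy
    exact fibreInner_eq hy _ _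
  refine ContDiffAt.congr_of_eventuallyEq ?_ he
  have h1 : ∀ i, ContDiffAt ℝ n (fun y => a y i) x := fun i => contDiffAt_pi.1 ha i
  have h2 : ∀ i, ContDiffAt ℝ n (fun y => b y i) x := fun i => contDiffAt_pi.1 hb i
  have hconj : ∀ f : Amb → ℂ, ContDiffAt ℝ n f x → ContDiffAt ℝ n (fun y =>
      starRingEnd ℂ (f y)) x :=
    fun f hf => Complex.conjCLE.contDiff.contDiffAt.comp x hf
  have hre : ∀ f : Amb → ℂ, ContDiffAt ℝ n f x → ContDiffAt ℝ n (fun y => (f y).re) x :=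
    fun f hf => Complex.reCLM.contDiff.contDiffAt.comp x hf
  have f1 : ContDiffAt ℝ n (fun y : Amb => y.1) x := contDiffAt_fst
  have f2 : ContDiffAt ℝ n (fun y : Amb => y.2) x := contDiffAt_snd
  have a0 : ContDiffAt ℝ n (fun y => (a y).eval y.1) x :=
    ((h1 0).add ((h1 1).mul f1)).add ((h1 2).mul (f1.pow 2))
  have b0 : ContDiffAt ℝ n (fun y => (b y).eval y.1) x :=
    ((h2 0).add ((h2 1).mul f1)).add ((h2 2).mul (f1.pow 2))
  have a1 : ContDiffAt ℝ n (fun y => (a y) 1 + 2 * (a y) 2 * y.1) x :=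
    (h1 1).add ((contDiffAt_const.mul (h1 2)).mul f1)
  have b1 : ContDiffAt ℝ n (fun y => (b y) 1 + 2 * (b y) 2 * y.1) x :=
    (h2 1).add ((contDiffAt_const.mul (h2 2)).mul f1)
  exact (((contDiffAt_const.mul ((f2.pow 2).inv (pow_ne_zero _ hx))).mul
    (hre _ (a0.mul (hconj _ b0)))).add (hre _ (a1.mul (hconj _ b1)))).add
    ((contDiffAt_const.mul (f2.pow 2)).mul (hre _ ((h1 2).mul (hconj _ (h2 2)))))

/-! ### Behaviour of the differential operators under isometries -/

theorem fderiv_eq_of_hasDerivAt {f : Amb → ℝ} {x u : Amb} {d : ℝ} (hf : DifferentiableAt ℝ f x)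
    (h : HasDerivAt (fun r : ℝ => f (x + r • u)) d 0) : fderiv ℝ f x u = d := by
  rw [← hf.lineDeriv_eq_fderiv]
  exact HasLineDerivAt.lineDeriv h

theorem coordOf_killing_zero (k : ProjField) (x : Amb) : coordOf (killing k x) 0 =
    (k.eval x.1).re - x.2 ^ 2 * (k 2).re := by
  simp [coordOf, killing, pow_two]

theorem coordOf_killing_one (k : ProjField) (x : Amb) : coordOf (killing k x) 1 =
    (k.eval x.1).im + x.2 ^ 2 * (k 2).im := by
  simp [coordOf, killing, pow_two]

theorem coordOf_killing_two (k : ProjField) (x : Amb) : coordOf (killing k x) 2 =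
    x.2 * (k 1 + 2 * k 2 * x.1).re := rfl

theorem contDiff_coordOf_killing (i : Fin 3) :
    ContDiff ℝ ∞ (fun z : ProjField × Amb => coordOf (killing z.1 z.2) i) := by
  have hre : ∀ f : ProjField × Amb → ℂ, ContDiff ℝ ∞ f → ContDiff ℝ ∞ (fun y => (f y).re) :=
    fun f hf => Complex.reCLM.contDiff.comp hf
  have him : ∀ f : ProjField × Amb → ℂ, ContDiff ℝ ∞ f → ContDiff ℝ ∞ (fun y => (f y).im) :=
    fun f hf => Complex.imCLM.contDiff.comp hf
  have h1 : ∀ i, ContDiff ℝ ∞ (fun z : ProjField × Amb => z.1 i) := fun i =>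
    (contDiff_apply ℝ ℂ i).comp contDiff_fst
  have h2 : ContDiff ℝ ∞ (fun z : ProjField × Amb => z.2.1) := contDiff_fst.comp contDiff_snd
  have h3 : ContDiff ℝ ∞ (fun z : ProjField × Amb => z.2.2) := contDiff_snd.comp contDiff_snd
  have h4 : ContDiff ℝ ∞ (fun z : ProjField × Amb => z.1.eval z.2.1) :=
    ((h1 0).add ((h1 1).mul h2)).add ((h1 2).mul (h2.pow 2))
  have hall : ∀ j : Fin 3, j = 0 ∨ j = 1 ∨ j = 2 := by decide
  rcases hall i with rfl | rfl | rfl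
  · simp only [coordOf_killing_zero]
    exact (hre _ h4).sub ((h3.pow 2).mul (hre _ (h1 2)))
  · simp only [coordOf_killing_one]
    exact (him _ h4).add ((h3.pow 2).mul (him _ (h1 2)))
  · simp only [coordOf_killing_two]
    exact h3.mul (hre _ ((h1 1).add ((contDiff_const.mul (h1 2)).mul h2)))

theorem contDiffAt_divergence_integrand (i : Fin 3) (k : ProjField) {x : Amb} (hx : 0 < x.2) :
    ContDiffAt ℝ ∞ (fun z : ProjField × Amb => (z.2.2 ^ 3)⁻¹ * coordOf (killing z.1 z.2) i)
      (k, x) :=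
  (((contDiffAt_snd.comp (k, x) contDiffAt_snd).pow 3).inv (pow_ne_zero _ hx.ne')).mul
    (contDiff_coordOf_killing i).contDiffAt

/-- Killing fields are divergence free. -/
theorem divergence_killing (k : ProjField) {x : Amb} (hx : 0 < x.2) :
    ∑ i, fderiv ℝ (fun y : Amb => (y.2 ^ 3)⁻¹ * coordOf (killing k y) i) x (coordVec i) = 0 := by
  have hd : ∀ i, DifferentiableAt ℝ (fun y : Amb => (y.2 ^ 3)⁻¹ * coordOf (killing k y) i) x :=
    fun i => ((contDiffAt_divergence_integrand i k hx).comp x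
      (contDiffAt_const.prodMk contDiffAt_id)).differentiableAt (by simp)
  have hpoly : ∀ c : ℂ, HasDerivAt (fun r : ℝ => k.eval (x.1 + r * c))
      ((k 1 + 2 * k 2 * x.1) * c) 0 := by
    intro c
    have h0 : HasDerivAt (fun r : ℝ => x.1 + (r : ℂ) * c) c 0 := by
      simpa using ((Complex.ofRealCLM.hasDerivAt (x := 0)).mul_const c).const_add x.1
    have h1 := ((h0.const_mul (k 1)).const_add (k 0)).add ((h0.pow 2).const_mul (k 2))
    refine (h1.congr_deriv ?_)
    simp
    ring
  have e0 : fderiv ℝ (fun y : Amb => (y.2 ^ 3)⁻¹ * coordOf (killing k y) 0) x (coordVec 0) =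
      (x.2 ^ 3)⁻¹ * (k 1 + 2 * k 2 * x.1).re := by
    refine fderiv_eq_of_hasDerivAt (hd 0) ?_
    have h1 := Complex.reCLM.hasFDerivAt.comp_hasDerivAt (0 : ℝ) (hpoly 1)
    have h2 := ((h1.sub_const (x.2 ^ 2 * (k 2).re)).const_mul ((x.2 ^ 3)⁻¹))
    refine (h2.congr_deriv (by simp)).congr_of_eventuallyEq (Filter.Eventually.of_forall fun r =>
        ?_)
    simp [coordOf_killing_zero, coordVec]
  have e1 : fderiv ℝ (fun y : Amb => (y.2 ^ 3)⁻¹ * coordOf (killing k y) 1) x (coordVec 1) =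
      (x.2 ^ 3)⁻¹ * (k 1 + 2 * k 2 * x.1).re := by
    refine fderiv_eq_of_hasDerivAt (hd 1) ?_
    have h1 := Complex.imCLM.hasFDerivAt.comp_hasDerivAt (0 : ℝ) (hpoly Complex.I)
    have h2 := ((h1.add_const (x.2 ^ 2 * (k 2).im)).const_mul ((x.2 ^ 3)⁻¹))
    refine (h2.congr_deriv (by simp)).congr_of_eventuallyEq (Filter.Eventually.of_forall fun r =>
        ?_)
    simp [coordOf_killing_one, coordVec]
  have e2 : fderiv ℝ (fun y : Amb => (y.2 ^ 3)⁻¹ * coordOf (killing k y) 2) x (coordVec 2) =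
      -2 * (x.2 ^ 3)⁻¹ * (k 1 + 2 * k 2 * x.1).re := by
    refine fderiv_eq_of_hasDerivAt (hd 2) ?_
    have h0 : HasDerivAt (fun r : ℝ => x.2 + r) 1 0 := (hasDerivAt_id (0 : ℝ)).const_add x.2
    have h1 := ((h0.pow 3).fun_inv (by simpa using hx.ne')).fun_mul
      (h0.mul_const (k 1 + 2 * k 2 * x.1).re)
    refine (h1.congr_deriv ?_).congr_of_eventuallyEq (Filter.Eventually.of_forall fun r => ?_)
    · simp
      field_simp
      ring
    · simp [coordOf_killing_two, coordVec]
  rw [Fin.sum_univ_three, e0, e1, e2]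
  ring

/-- The divergence of the real part of a section is the trace of `u ↦ Re (∇ᵤ s)`. -/
theorem divergence_realPart {s : Amb → ProjField} {x : Amb} (hx : 0 < x.2)
    (hs : DifferentiableAt ℝ s x) : divergence (realPart s) x =
      ∑ i, coordOf (killing (fderiv ℝ s x (coordVec i)) x) i := by
  -- Product rule: one term differentiates the section, the other moves the evaluation point with
  -- the section frozen. The second is the divergence of a Killing field and sums to zero.
  have key : ∀ i, fderiv ℝ (fun y : Amb => (y.2 ^ 3)⁻¹ * coordOf (realPart s y) i) x (coordVec i) =
      (x.2 ^ 3)⁻¹ * coordOf (killing (fderiv ℝ s x (coordVec i)) x) i +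
      fderiv ℝ (fun y : Amb => (y.2 ^ 3)⁻¹ * coordOf (killing (s x) y) i) x (coordVec i) := by
    intro i
    have hF := ((contDiffAt_divergence_integrand i (s x) hx).differentiableAt
      (by simp)).hasFDerivAt
    have h1 : HasFDerivAt (fun y : Amb => (y.2 ^ 3)⁻¹ * coordOf (realPart s y) i) _ x :=
      hF.comp (f := fun y : Amb => (s y, y)) x (hs.hasFDerivAt.prodMk (hasFDerivAt_id x))
    have h2 : HasFDerivAt (fun y : Amb => (y.2 ^ 3)⁻¹ * coordOf (killing (s x) y) i) _ x :=
      hF.comp (f := fun y : Amb => (s x,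
          y)) x ((hasFDerivAt_const (s x) x).prodMk (hasFDerivAt_id x))
    have h3 : HasFDerivAt (fun k : ProjField => (x.2 ^ 3)⁻¹ * coordOf (killing k x) i) _ (s x) :=
      hF.comp (f := fun k : ProjField => (k, x)) (s x)
        ((hasFDerivAt_id (s x)).prodMk (hasFDerivAt_const x (s x)))
    have h4 : HasFDerivAt (fun k : ProjField => (x.2 ^ 3)⁻¹ * coordOf (killing k x) i)
        ((x.2 ^ 3)⁻¹ • ((ContinuousLinearMap.proj i).comp (coordLin.comp (killingLin x)))) (s x) :=
      ((x.2 ^ 3)⁻¹ • ((ContinuousLinearMap.proj i).comp (coordLin.comp (killingLin x))) :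
        ProjField →L[ℝ] ℝ).hasFDerivAt
    have h5 := congrArg (fun L => L (fderiv ℝ s x (coordVec i))) (h3.unique h4)
    rw [h1.fderiv, h2.fderiv]
    simp only [ContinuousLinearMap.comp_apply, ContinuousLinearMap.prod_apply,
      ContinuousLinearMap.id_apply, zero_apply, smul_apply,
      smul_eq_mul, ContinuousLinearMap.proj_apply, killingLin_apply, coordLin_apply] at h5 ⊢
    rw [← h5, ← map_add]
    simp
  unfold divergence
  simp only [key, Finset.sum_add_distrib, divergence_killing (s x) hx, add_zero, ← Finset.mul_sum]
  rw [← mul_assoc, mul_inv_cancel₀ (pow_ne_zero _ hx.ne'), one_mul]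

/-- Written as a trace of a bilinear form over an orthonormal frame, the divergence is visibly
invariant under isometries. -/
theorem divergence_realPart_frame {s : Amb → ProjField} {x : Amb} (hx : 0 < x.2)
    (hs : DifferentiableAt ℝ s x) : divergence (realPart s) x =
      ∑ i, hypInner x (killing (fderiv ℝ s x (frame x i)) x) (frame x i) := by
  rw [divergence_realPart hx hs]
  refine Finset.sum_congr rfl fun i _ => ?_
  have hx' := hx.ne'
  rw [hypInner_eq_sum, frame, map_smul, killing_smul]
  simp only [coordOf_smul, Pi.smul_apply, coordOf_coordVec, smul_eq_mul, mul_ite, mul_one,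
    mul_zero, Finset.sum_ite_eq, Finset.mem_univ, if_true]
  field_simp

/-- The differential of a section that is transformed by an isometry. -/
theorem fderiv_transform (A : SL(2, ℂ)) (c : ProjField) {s : Amb → ProjField} {x : Amb}
    (hx : 0 < x.2) (hs : DifferentiableAt ℝ s (hypAct A x)) (u : Amb) :
    fderiv ℝ (fun y => pullback A (s (hypAct A y)) + c) x u =
      pullback A (fderiv ℝ s (hypAct A x) (fderiv ℝ (hypAct A) x u)) := by
  have h1 := ((contDiffAt_hypAct A hx).differentiableAt (by simp)).hasFDerivAt
  have h2 := (((pullbackLin A).restrictScalars ℝ).hasFDerivAt.comp x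
    (hs.hasFDerivAt.comp x h1)).add_const c
  have h3 : HasFDerivAt (fun y => pullback A (s (hypAct A y)) + c) _ x := h2
  rw [h3.fderiv]
  rfl

theorem differentiableAt_transform (A : SL(2, ℂ)) (c : ProjField) {s : Amb → ProjField} {x : Amb}
    (hx : 0 < x.2) (hs : DifferentiableAt ℝ s (hypAct A x)) :
    DifferentiableAt ℝ (fun y => pullback A (s (hypAct A y)) + c) x := by
  have h1 := ((contDiffAt_hypAct A hx).differentiableAt (by simp)).hasFDerivAt
  have h2 := (((pullbackLin A).restrictScalars ℝ).hasFDerivAt.comp x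
    (hs.hasFDerivAt.comp x h1)).add_const c
  exact h2.differentiableAt

theorem normSqD_transform (A : SL(2, ℂ)) (c : ProjField) {s : Amb → ProjField} {x : Amb}
    (hx : 0 < x.2) (hs : DifferentiableAt ℝ s (hypAct A x)) :
    normSqD (fun y => pullback A (s (hypAct A y)) + c) x = normSqD s (hypAct A x) := by
  unfold normSqD
  simp only [fderiv_transform A c hx hs, fibreInner_pullback A hx]
  exact (isTangentIsometry_hypAct A hx).sum_map_frame
    ((fibreBilin (hypAct A x)).compl₁₂ (fderiv ℝ s (hypAct A x)).toLinearMap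
      (fderiv ℝ s (hypAct A x)).toLinearMap)

theorem divergence_transform (A : SL(2, ℂ)) (c : ProjField) {s : Amb → ProjField} {x : Amb}
    (hx : 0 < x.2) (hs : DifferentiableAt ℝ s (hypAct A x)) :
    divergence (realPart (fun y => pullback A (s (hypAct A y)) + c)) x =
      divergence (realPart s) (hypAct A x) := by
  rw [divergence_realPart_frame hx (differentiableAt_transform A c hx hs),
    divergence_realPart_frame (hypAct_pos A hx) hs]
  have h := isTangentIsometry_hypAct A hx
  simp only [fderiv_transform A c hx hs, ← h.inner_eq, (actsIsometrically A x hx).2]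
  exact h.sum_map_frame
    ((hypBilin (hypAct A x)).compl₁₂ ((killingLin (hypAct A x)).toLinearMap ∘ₗ
      (fderiv ℝ s (hypAct A x)).toLinearMap) LinearMap.id)

theorem normSqDiff_comp (A : SL(2, ℂ)) {F : Amb → ℝ} {x : Amb}
    (hx : 0 < x.2) (hF : DifferentiableAt ℝ F (hypAct A x)) :
    normSqDiff (F ∘ hypAct A) x = normSqDiff F (hypAct A x) := by
  unfold normSqDiff
  rw [fderiv_comp x hF ((contDiffAt_hypAct A hx).differentiableAt (by simp))]
  simp only [ContinuousLinearMap.comp_apply, pow_two]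
  exact (isTangentIsometry_hypAct A hx).sum_map_frame
    ((LinearMap.mul ℝ ℝ).compl₁₂ (fderiv ℝ F (hypAct A x)).toLinearMap
      (fderiv ℝ F (hypAct A x)).toLinearMap)

/-! ### The Laplacian under isometries -/

theorem two_le_infty : (2 : WithTop ℕ∞) ≤ ∞ := WithTop.coe_le_coe.2 (le_top : (2 : ℕ∞) ≤ ⊤)

theorem one_add_one_le_infty : (1 : WithTop ℕ∞) + 1 ≤ ∞ := by
  rw [one_add_one_eq_two]
  exact two_le_infty

/-- A family of continuous linear maps is smooth at a point if all its applications are. -/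
theorem contDiffAt_clm_of_apply {D E F : Type*} [NormedAddCommGroup D] [NormedSpace ℝ D]
    [NormedAddCommGroup E] [NormedSpace ℝ E] [NormedAddCommGroup F] [NormedSpace ℝ F]
    {n : WithTop ℕ∞} {f : D → E →L[ℝ] F} {s : D} [FiniteDimensional ℝ E]
    (h : ∀ y, ContDiffAt ℝ n (fun x => f x y) s) : ContDiffAt ℝ n f s := by
  let d := Module.finrank ℝ E
  have hd : d = Module.finrank ℝ (Fin d → ℝ) := (Module.finrank_fin_fun ℝ).symm
  let e₁ := ContinuousLinearEquiv.ofFinrankEq hd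
  let e₂ := (e₁.arrowCongr (1 : F ≃L[ℝ] F)).trans (ContinuousLinearEquiv.piRing (Fin d))
  rw [← Function.id_comp f, ← e₂.symm_comp_self]
  exact e₂.symm.contDiff.contDiffAt.comp s (contDiffAt_pi.mpr fun i => h _)

/-- The hyperbolic divergence of the vector field dual to a one-form. -/
def formDiv (η : Amb → Amb →L[ℝ] ℝ) (x : Amb) : ℝ :=
  x.2 ^ 3 * ∑ i, fderiv ℝ (fun y : Amb => y.2⁻¹ * η y (coordVec i)) x (coordVec i)

/-- The zeroth order term comes from differentiating the weight y.2⁻¹, which is the volume density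
y.2⁻³ times the inverse metric y.2². -/
theorem formDiv_eq {η : Amb → Amb →L[ℝ] ℝ} {x : Amb} (hx : 0 < x.2)
    (hη : DifferentiableAt ℝ η x) : formDiv η x =
      ∑ i, fderiv ℝ η x (frame x i) (frame x i) - x.2 * η x (coordVec 2) := by
  have hx' := hx.ne'
  have key : ∀ i, fderiv ℝ (fun y : Amb => y.2⁻¹ * η y (coordVec i)) x (coordVec i) =
      x.2⁻¹ * fderiv ℝ η x (coordVec i) (coordVec i) -
        (x.2 ^ 2)⁻¹ * (coordVec i).2 * η x (coordVec i) := by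
    intro i
    have h1 : HasFDerivAt (fun y : Amb => y.2⁻¹) _ x :=
      (hasDerivAt_inv hx').comp_hasFDerivAt x (hasFDerivAt_snd (𝕜 := ℝ) (E := ℂ) (F := ℝ) (p := x))
    have h2 := hη.hasFDerivAt.clm_apply (hasFDerivAt_const (coordVec i) x)
    have h3 : HasFDerivAt (fun y : Amb => y.2⁻¹ * η y (coordVec i)) _ x := h1.mul h2
    rw [h3.fderiv]
    simp
    ring
  unfold formDiv
  simp only [key, frame, map_smul, smul_apply, smul_eq_mul]
  rw [Fin.sum_univ_three, Fin.sum_univ_three]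
  simp [coordVec]
  field_simp
  ring

/-- The Euclidean inner product in coordinates. -/
def euc (u v : Amb) : ℝ := ∑ i, coordOf u i * coordOf v i

theorem hypInner_eq_euc (x u v : Amb) : hypInner x u v = euc u v / x.2 ^ 2 := hypInner_eq_sum x u v

/-- The Euclidean inner product as a continuous bilinear map. -/
def eucBilin : Amb →L[ℝ] Amb →L[ℝ] ℝ :=
  ∑ i, ((ContinuousLinearMap.proj i).comp coordLin).smulRight
    ((ContinuousLinearMap.proj i).comp coordLin)

theorem eucBilin_apply (u v : Amb) : eucBilin u v = euc u v := by
  simp [eucBilin, euc]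

theorem euc_comm (u v : Amb) : euc u v = euc v u := by
  simp only [euc, mul_comm]

theorem euc_coordVec (i : Fin 3) (v : Amb) : euc (coordVec i) v = coordOf v i := by
  simp [euc, coordOf_coordVec]

/-- A rescaling of `L` is orthogonal in both senses, so the images of the coordinate vectors span;
orthogonality of the columns recovers each coordinate of `z`. -/
theorem IsTangentIsometry.eq_zero_of_euc {x y : Amb} {L : Amb →L[ℝ] Amb}
    (h : IsTangentIsometry x y L) {z : Amb} (hz : ∀ v, euc z (L v) = 0) : z = 0 := by
  have hx := h.left_pos.ne'
  have hy := h.right_pos.ne'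
  have h1 : ∀ j, coordOf z j = 0 := by
    intro j
    have h2 : ∑ k, coordOf z k * (if k = j then 1 else 0) = coordOf z j := by simp
    rw [← h2]
    simp only [← h.transpose_mul, Finset.mul_sum]
    rw [Finset.sum_comm]
    refine Finset.sum_eq_zero fun i _ => ?_
    have h3 := hz (coordVec i)
    have h4 : ∑ k, coordOf z k * (x.2 / y.2 * coordOf (L (coordVec i)) k *
        (x.2 / y.2 * coordOf (L (coordVec i)) j)) =
        euc z (L (coordVec i)) * (x.2 / y.2 * (x.2 / y.2 * coordOf (L (coordVec i)) j)) := by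
      rw [euc, Finset.sum_mul]
      exact Finset.sum_congr rfl fun k _ => by ring
    rw [h4, h3, zero_mul]
  rw [← sum_coordOf z]
  simp [h1]

/-- The components of an isometry satisfy the equation of harmonic maps. -/
theorem sum_second_fderiv_hypAct (A : SL(2, ℂ)) {x : Amb} (hx : 0 < x.2) :
    x.2 ^ 2 • ∑ i, fderiv ℝ (fderiv ℝ (hypAct A)) x (coordVec i) (coordVec i) =
      x.2 • fderiv ℝ (hypAct A) x (coordVec 2) - (hypAct A x).2 • coordVec 2 := by
  have hiso := isTangentIsometry_hypAct A hx
  have hx' := hx.ne'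
  have hy' := hiso.right_pos.ne'
  set g := hypAct A with hg
  have hsm : ContDiffAt ℝ ∞ g x := contDiffAt_hypAct A hx
  have hg1 : HasFDerivAt g (fderiv ℝ g x) x := (hsm.differentiableAt (by simp)).hasFDerivAt
  have hg2 : HasFDerivAt (fderiv ℝ g) (fderiv ℝ (fderiv ℝ g) x) x :=
    ((hsm.fderiv_right (m := 1) one_add_one_le_infty).differentiableAt (by simp)).hasFDerivAt
  have hsymm : ∀ u v, fderiv ℝ (fderiv ℝ g) x u v = fderiv ℝ (fderiv ℝ g) x v u := fun u v =>
    (hsm.isSymmSndFDerivAt (by simpa using two_le_infty)).eq u v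
  have hlam : DifferentiableAt ℝ (fun y : Amb => ((g y).2 / y.2) ^ 2) x :=
    (((hg1.differentiableAt.snd).mul (differentiableAt_snd.inv hx')).congr_of_eventuallyEq
      (Filter.Eventually.of_forall fun y => div_eq_mul_inv _ _)).pow 2
  -- The conformality relation ⟨Dg u, Dg v⟩ = λ ⟨u, v⟩, with λ = (g.2 / y.2)², differentiated in the
  -- direction a.
  have hprod : ∀ u v a, euc (fderiv ℝ (fderiv ℝ g) x a u) (fderiv ℝ g x v) +
      euc (fderiv ℝ g x u) (fderiv ℝ (fderiv ℝ g) x a v) =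
      fderiv ℝ (fun y : Amb => ((g y).2 / y.2) ^ 2) x a * euc u v := by
    intro u v a
    have e1 : (fun y => eucBilin (fderiv ℝ g y u) (fderiv ℝ g y v)) =ᶠ[𝓝 x]
        fun y => ((g y).2 / y.2) ^ 2 * euc u v := by
      filter_upwards [eventually_pos hx] with y hy
      have hy1 := (isTangentIsometry_hypAct A hy)
      have hy2 := hy1.right_pos.ne'
      have hy3 := hy.ne'
      have := hy1.inner_eq u v
      rw [hypInner_eq_euc, hypInner_eq_euc] at this
      rw [eucBilin_apply]
      field_simp at this ⊢
      linarith
    have e2 : HasFDerivAt (fun y => eucBilin (fderiv ℝ g y u) (fderiv ℝ g y v)) _ x :=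
      eucBilin.hasFDerivAt_of_bilinear (hg2.clm_apply (hasFDerivAt_const u x))
        (hg2.clm_apply (hasFDerivAt_const v x))
    have e3 := hlam.hasFDerivAt.mul_const (euc u v)
    have e4 := congrArg (fun L => L a) (e2.unique (e3.congr_of_eventuallyEq e1))
    simp [eucBilin_apply] at e4
    linarith
  have hm : ∀ a, fderiv ℝ (fun y : Amb => ((g y).2 / y.2) ^ 2) x a =
      2 * ((g x).2 / x.2) * ((fderiv ℝ g x a).2 / x.2 - (g x).2 * a.2 / x.2 ^ 2) := by
    intro a
    have e1 : HasFDerivAt (fun y : Amb => (g y).2) _ x := hg1.snd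
    have e2 : HasFDerivAt (fun y : Amb => ((g y).2 / y.2) ^ 2) _ x :=
      (e1.mul ((hasDerivAt_inv hx').comp_hasFDerivAt x (hasFDerivAt_snd (𝕜 := ℝ) (E := ℂ) (F := ℝ)
          (p := x)))).pow 2
    rw [e2.fderiv]
    simp
    field_simp
    ring
  have hE : ∀ u v, euc (fderiv ℝ g x u) (fderiv ℝ g x v) = ((g x).2 / x.2) ^ 2 * euc u v := by
    intro u v
    have := hiso.inner_eq u v
    rw [hypInner_eq_euc, hypInner_eq_euc] at this
    field_simp at this ⊢
    linarith
  have main : ∀ v, euc (∑ i, fderiv ℝ (fderiv ℝ g) x (coordVec i) (coordVec i)) (fderiv ℝ g x v) =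
      -(fderiv ℝ (fun y : Amb => ((g y).2 / y.2) ^ 2) x v) / 2 := by
    intro v
    have s1 : ∑ i, (euc (fderiv ℝ (fderiv ℝ g) x (coordVec i) (coordVec i)) (fderiv ℝ g x v) +
        euc (fderiv ℝ g x (coordVec i)) (fderiv ℝ (fderiv ℝ g) x (coordVec i) v)) =
        fderiv ℝ (fun y : Amb => ((g y).2 / y.2) ^ 2) x v := by
      simp only [hprod, euc_coordVec]
      conv_rhs => rw [← sum_coordOf v, map_sum]
      simp [mul_comm]
    -- With u = v = eᵢ and symmetry of D²g, every summand equals dλ(v), and there are three of them.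
    -- Together with `s1` this gives dλ(v) - (3/2) dλ(v) = -dλ(v)/2.
    have s2 : ∑ i, (2 * euc (fderiv ℝ g x (coordVec i)) (fderiv ℝ (fderiv ℝ g) x (coordVec i) v)) =
        3 * fderiv ℝ (fun y : Amb => ((g y).2 / y.2) ^ 2) x v := by
      have : ∀ i, 2 * euc (fderiv ℝ g x (coordVec i)) (fderiv ℝ (fderiv ℝ g) x (coordVec i) v) =
          fderiv ℝ (fun y : Amb => ((g y).2 / y.2) ^ 2) x v := by
        intro i
        have := hprod (coordVec i) (coordVec i) v
        rw [euc_coordVec, coordOf_coordVec, if_pos rfl, mul_one,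
          euc_comm (fderiv ℝ (fderiv ℝ g) x v (coordVec i))] at this
        rw [hsymm (coordVec i) v, two_mul, this]
      simp [this]
    have s3 : euc (∑ i, fderiv ℝ (fderiv ℝ g) x (coordVec i) (coordVec i)) (fderiv ℝ g x v) =
        ∑ i, euc (fderiv ℝ (fderiv ℝ g) x (coordVec i) (coordVec i)) (fderiv ℝ g x v) := by
      simp only [← eucBilin_apply, map_sum, sum_apply]
    rw [s3]
    rw [Finset.sum_add_distrib] at s1
    rw [← Finset.mul_sum] at s2
    linarith
  rw [← sub_eq_zero]
  refine hiso.eq_zero_of_euc fun v => ?_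
  rw [← eucBilin_apply]
  simp only [map_sub, map_smul, sub_apply, smul_apply, smul_eq_mul, eucBilin_apply, main, hE,
    euc_coordVec, hm]
  have c2 : ∀ u : Amb, coordOf u 2 = u.2 := fun u => rfl
  simp only [c2]
  field_simp
  ring

/-- The divergence of one-forms is invariant under isometries. -/
theorem formDiv_comp (A : SL(2, ℂ)) {η η' : Amb → Amb →L[ℝ] ℝ} {x : Amb} (hx : 0 < x.2)
    (hη : DifferentiableAt ℝ η (hypAct A x))
    (h : η' =ᶠ[𝓝 x] fun y => (η (hypAct A y)).comp (fderiv ℝ (hypAct A) y)) :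
    formDiv η' x = formDiv η (hypAct A x) := by
  have hiso := isTangentIsometry_hypAct A hx
  have hsm := contDiffAt_hypAct A hx
  have hg1 : HasFDerivAt (hypAct A) (fderiv ℝ (hypAct A) x) x :=
    (hsm.differentiableAt (by simp)).hasFDerivAt
  have hg2 : HasFDerivAt (fderiv ℝ (hypAct A)) (fderiv ℝ (fderiv ℝ (hypAct A)) x) x :=
    ((hsm.fderiv_right (m := 1) one_add_one_le_infty).differentiableAt (by simp)).hasFDerivAt
  have hη' := ((hη.hasFDerivAt.comp x hg1).clm_comp hg2).congr_of_eventuallyEq h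
  have hkey := sum_second_fderiv_hypAct A hx
  rw [formDiv_eq hx hη'.differentiableAt, formDiv_eq hiso.right_pos hη, hη'.fderiv, h.eq_of_nhds]
  have h1 := hiso.sum_map_frame
    (LinearMap.mk₂ ℝ (fun u v => fderiv ℝ η (hypAct A x) u v) (by simp) (by simp) (by simp)
      (by simp))
  simp only [LinearMap.mk₂_apply] at h1
  rw [← h1]
  -- The chain rule leaves η applied to the trace of D²g. The harmonic map equation turns it into
  -- precisely the difference of the zeroth order terms of `formDiv_eq` at x and at its image.
  have h2 := congrArg (η (hypAct A x)) hkey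
  simp only [map_smul, map_sum, map_sub, smul_eq_mul, Finset.mul_sum] at h2
  simp only [ContinuousLinearMap.comp_apply, add_apply, ContinuousLinearMap.compL_apply,
    ContinuousLinearMap.flip_apply, Finset.sum_add_distrib]
  have h3 : ∑ i, (η (hypAct A x)) (fderiv ℝ (fderiv ℝ (hypAct A)) x (frame x i) (frame x i)) =
      ∑ i, x.2 ^ 2 * (η (hypAct A x))
        (fderiv ℝ (fderiv ℝ (hypAct A)) x (coordVec i) (coordVec i)) := by
    refine Finset.sum_congr rfl fun i _ => ?_
    simp only [frame, map_smul, smul_apply, smul_eq_mul]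
    ring
  simp only [Function.comp_apply]
  rw [h3, h2]
  ring

/-- The one-form `u ↦ ⟨∇ᵤ s, k⟩`. -/
def pairing (s : Amb → ProjField) (k : ProjField) (y : Amb) : Amb →L[ℝ] ℝ :=
  (((fibreBilin y).flip k).toContinuousLinearMap).comp (fderiv ℝ s y)

theorem pairing_apply (s : Amb → ProjField) (k : ProjField) (y u : Amb) :
    pairing s k y u = fibreInner y (fderiv ℝ s y u) k := rfl

theorem contDiffAt_pairing {s : Amb → ProjField} {x : Amb} (hx : 0 < x.2)
    (hs : ContDiffAt ℝ ∞ s x) (k : ProjField) : ContDiffAt ℝ ∞ (pairing s k) x := by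
  refine contDiffAt_clm_of_apply fun u => ?_
  exact contDiffAt_fibreInner hx.ne'
    ((hs.fderiv_right (m := ∞) (mod_cast le_top)).clm_apply contDiffAt_const) contDiffAt_const

theorem laplacian_eq_flat (s : Amb → ProjField) (x : Amb) :
    laplacian s x = flat x fun k => -formDiv (pairing s k) x := by
  unfold laplacian codiff formDiv
  simp only [pairing_apply, neg_mul]

/-- The linear functional represented by the Laplacian. -/
def lapForm {s : Amb → ProjField} {x : Amb} (hx : 0 < x.2) (hs : ContDiffAt ℝ ∞ s x) :
    ProjField →ₗ[ℝ] ℝ where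
  toFun k := -formDiv (pairing s k) x
  map_add' k l := by
    have hk := (contDiffAt_pairing hx hs k).differentiableAt (by simp)
    have hl := (contDiffAt_pairing hx hs l).differentiableAt (by simp)
    have : pairing s (k + l) = pairing s k + pairing s l := by
      refine funext fun y => ContinuousLinearMap.ext fun u => ?_
      simp only [pairing_apply, Pi.add_apply, add_apply, ← fibreBilin_apply, map_add]
    rw [this, formDiv_eq hx (hk.add hl), formDiv_eq hx hk, formDiv_eq hx hl, fderiv_add hk hl]
    simp only [add_apply, Pi.add_apply, Finset.sum_add_distrib]
    ring
  map_smul' c k := by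
    have hk := (contDiffAt_pairing hx hs k).differentiableAt (by simp)
    have : pairing s (c • k) = c • pairing s k := by
      refine funext fun y => ContinuousLinearMap.ext fun u => ?_
      simp only [pairing_apply, Pi.smul_apply, smul_apply, ← fibreBilin_apply, map_smul]
    rw [this, formDiv_eq hx (hk.const_smul c), formDiv_eq hx hk, fderiv_const_smul hk c]
    simp only [smul_apply, Pi.smul_apply, smul_eq_mul, ← Finset.mul_sum, RingHom.id_apply]
    ring

theorem fibreInner_laplacian {s : Amb → ProjField} {x : Amb} (hx : 0 < x.2)
    (hs : ContDiffAt ℝ ∞ s x) (k : ProjField) :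
    fibreInner x (laplacian s x) k = -formDiv (pairing s k) x := by
  rw [laplacian_eq_flat]
  exact fibreInner_flat hx.ne' (lapForm hx hs) k

theorem eventually_contDiffAt {E : Type*} [NormedAddCommGroup E] [NormedSpace ℝ E]
    {F : Type*} [NormedAddCommGroup F] [NormedSpace ℝ F] {s : E → F} {x : E}
    (hs : ContDiffAt ℝ 1 s x) : ∀ᶠ y in 𝓝 x, DifferentiableAt ℝ s y :=
  (hs.eventually (by simp)).mono fun _ h => h.differentiableAt (by simp)

theorem contDiffAt_transform (A : SL(2, ℂ)) (c : ProjField) {s : Amb → ProjField} {x : Amb}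
    (hx : 0 < x.2) (hs : ContDiffAt ℝ ∞ s (hypAct A x)) :
    ContDiffAt ℝ ∞ (fun y => pullback A (s (hypAct A y)) + c) x :=
  ((((pullbackLin A).restrictScalars ℝ).contDiff.contDiffAt (x := s (hypAct A x))).comp x
    (hs.comp x (contDiffAt_hypAct A hx))).add contDiffAt_const

theorem eventually_differentiableAt_hypAct (A : SL(2, ℂ)) {F : Type*} [NormedAddCommGroup F]
    [NormedSpace ℝ F] {s : Amb → F} {x : Amb} (hx : 0 < x.2)
    (hs : ContDiffAt ℝ ∞ s (hypAct A x)) :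
    ∀ᶠ y in 𝓝 x, 0 < y.2 ∧ DifferentiableAt ℝ s (hypAct A y) := by
  have h1 := (contDiffAt_hypAct A hx).continuousAt.eventually
    (eventually_contDiffAt (hs.of_le (by simp)))
  exact (eventually_pos hx).and h1

/-- Tested against a constant section k, the Laplacian is minus the divergence of the one-form u ↦
⟨∇ᵤ s, k⟩. Writing k as `pullback A (pullback A⁻¹ k)` makes this form the pullback of the
corresponding form at the image, and `formDiv_comp` applies. The constant c disappears under
differentiation. -/
theorem laplacian_transform (A : SL(2, ℂ)) (c : ProjField) {s : Amb → ProjField} {x : Amb}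
    (hx : 0 < x.2) (hs : ContDiffAt ℝ ∞ s (hypAct A x)) :
    laplacian (fun y => pullback A (s (hypAct A y)) + c) x =
      pullback A (laplacian s (hypAct A x)) := by
  refine fibreInner_nondegenerate hx.ne' fun k => ?_
  have hk := pullback_inv A k
  rw [fibreInner_laplacian hx (contDiffAt_transform A c hx hs), ← hk, fibreInner_pullback A hx,
    fibreInner_laplacian (hypAct_pos A hx) hs]
  congr 1
  refine formDiv_comp A hx
    ((contDiffAt_pairing (hypAct_pos A hx) hs _).differentiableAt (by simp)) ?_
  filter_upwards [eventually_differentiableAt_hypAct A hx hs] with y hy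
  refine ContinuousLinearMap.ext fun u => ?_
  simp only [pairing_apply, ContinuousLinearMap.comp_apply]
  rw [fderiv_transform A c hy.1 hy.2, fibreInner_pullback A hy.1]

/-! ### Sections that osculate a holomorphic vector field along a normal projection -/

/-- The derivative of a Taylor polynomial in its base point telescopes: only the third derivative
survives, multiplying (z - w)² / 2. -/
theorem hasDerivAt_osculating {f : ℂ → ℂ} {w : ℂ} (hf : AnalyticAt ℂ f w) :
    HasDerivAt (osculating f) (quadAt w 0 0 (deriv (deriv (deriv f)) w / 2)) w := by
  have h0 := hf.differentiableAt.hasDerivAt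
  have h1 := hf.deriv.differentiableAt.hasDerivAt
  have h2 := hf.deriv.deriv.differentiableAt.hasDerivAt
  have hid := hasDerivAt_id w
  refine hasDerivAt_pi.2 fun i => ?_
  have hall : ∀ j : Fin 3, j = 0 ∨ j = 1 ∨ j = 2 := by decide
  rcases hall i with rfl | rfl | rfl
  · have := (h0.sub (h1.mul hid)).add ((h2.div_const 2).mul (hid.pow 2))
    refine (this.congr_deriv ?_)
    simp [quadAt]
    ring
  · have := h1.sub (((h2.div_const 2).const_mul 2).mul hid)
    refine (this.congr_deriv ?_)
    simp [quadAt]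
    ring
  · exact h2.div_const 2

theorem contDiffAt_osculating {f : ℂ → ℂ} {w : ℂ} (hf : AnalyticAt ℂ f w) :
    ContDiffAt ℝ ∞ (osculating f) w := by
  have h0 : ContDiffAt ℂ ∞ f w := hf.contDiffAt
  have h1 : ContDiffAt ℂ ∞ (deriv f) w := hf.deriv.contDiffAt
  have h2 : ContDiffAt ℂ ∞ (deriv (deriv f)) w := hf.deriv.deriv.contDiffAt
  have : ContDiffAt ℂ ∞ (osculating f) w := by
    refine contDiffAt_pi.2 fun i => ?_
    have hall : ∀ j : Fin 3, j = 0 ∨ j = 1 ∨ j = 2 := by decide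
    rcases hall i with rfl | rfl | rfl
    · exact (h0.sub (h1.mul contDiffAt_id)).add ((h2.div_const 2).mul (contDiffAt_id.pow 2))
    · exact h1.sub ((contDiffAt_const.mul (h2.div_const 2)).mul contDiffAt_id)
    · exact h2.div_const 2
  exact this.restrict_scalars ℝ

/-- The section `s` osculates the holomorphic vector field `f ∂/∂z` along the map
`x ↦ x.1 - x.2² κ(x)`; here `κ` is smooth, also where `O` meets the boundary `x.2 = 0`. -/
structure LocalForm (O : Set Amb) (κ : Amb → ℂ) (f : ℂ → ℂ) (s : Amb → ProjField) : Prop where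
  isOpen : IsOpen O
  smooth : ∀ x ∈ O, ContDiffAt ℝ ∞ κ x
  analytic : ∀ x ∈ O, AnalyticAt ℂ f (x.1 - (x.2 : ℂ) ^ 2 * κ x)
  eq : ∀ x ∈ O, s x = osculating f (x.1 - (x.2 : ℂ) ^ 2 * κ x)

namespace LocalForm

/-- The projection along which the section is constant. -/
def proj (κ : Amb → ℂ) (x : Amb) : ℂ := x.1 - (x.2 : ℂ) ^ 2 * κ x

/-- The coefficient of the derivative of the section in a direction `u`. -/
def dcoeff (κ : Amb → ℂ) (f : ℂ → ℂ) (u x : Amb) : ℂ :=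
  deriv (deriv (deriv f)) (proj κ x) / 2 * fderiv ℝ (proj κ) x u

variable {O : Set Amb} {κ : Amb → ℂ} {f : ℂ → ℂ} {s : Amb → ProjField}

theorem contDiffAt_ofReal_snd (x : Amb) : ContDiffAt ℝ ∞ (fun y : Amb => (y.2 : ℂ)) x :=
  Complex.ofRealCLM.contDiff.contDiffAt.comp x contDiffAt_snd

theorem contDiffAt_proj (h : LocalForm O κ f s) {x : Amb} (hx : x ∈ O) :
    ContDiffAt ℝ ∞ (proj κ) x :=
  contDiffAt_fst.sub (((contDiffAt_ofReal_snd x).pow 2).mul (h.smooth x hx))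

theorem contDiffAt_dcoeff (h : LocalForm O κ f s) {x : Amb} (hx : x ∈ O) (u : Amb) :
    ContDiffAt ℝ ∞ (dcoeff κ f u) x := by
  have h3 : ContDiffAt ℂ ∞ (deriv (deriv (deriv f))) (proj κ x) :=
    (h.analytic x hx).deriv.deriv.deriv.contDiffAt
  have hp := h.contDiffAt_proj hx
  exact (((h3.restrict_scalars ℝ).comp x hp).div_const 2).mul
    ((hp.fderiv_right (m := ∞) (mod_cast le_top)).clm_apply contDiffAt_const)

theorem eventually_eq (h : LocalForm O κ f s) {x : Amb} (hx : x ∈ O) :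
    s =ᶠ[𝓝 x] osculating f ∘ proj κ := by
  filter_upwards [h.isOpen.mem_nhds hx] with y hy
  exact h.eq y hy

theorem contDiffAt (h : LocalForm O κ f s) {x : Amb} (hx : x ∈ O) : ContDiffAt ℝ ∞ s x :=
  ((contDiffAt_osculating (h.analytic x hx)).comp x (h.contDiffAt_proj hx)).congr_of_eventuallyEq
    (h.eventually_eq hx)

/-- The derivative is a multiple of (z - π)². Recentring at x.1 through z - π = (z - x.1) + x.2² κ
exhibits the powers of x.2 in the lower Taylor coefficients, which offset the weights of the fibre
metric. -/
theorem fderiv_eq (h : LocalForm O κ f s) {x : Amb} (hx : x ∈ O) (u : Amb) : fderiv ℝ s x u =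
    quadAt x.1 (dcoeff κ f u x * ((x.2 : ℂ) ^ 2 * κ x) ^ 2)
      (2 * dcoeff κ f u x * ((x.2 : ℂ) ^ 2 * κ x)) (dcoeff κ f u x) := by
  have h1 := (hasDerivAt_osculating (h.analytic x hx)).hasFDerivAt.restrictScalars ℝ
  have h2 := ((h.contDiffAt_proj hx).differentiableAt (by simp)).hasFDerivAt
  have h3 : HasFDerivAt (osculating f ∘ proj κ) _ x := h1.comp x h2
  rw [(h3.congr_of_eventuallyEq (h.eventually_eq hx)).fderiv]
  simp only [ContinuousLinearMap.comp_apply, dcoeff, ContinuousLinearMap.coe_restrictScalars']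
  generalize fderiv ℝ (proj κ) x u = a
  change (a • quadAt _ _ _ _ : ProjField) = _
  simp only [proj]
  ext i
  fin_cases i <;> simp [quadAt] <;> ring

/-- The three terms of the fibre metric form a perfect square with a factor x.2²; the frame vectors
x.2 ∂ᵢ supply the other x.2². -/
theorem normSqD_eq (h : LocalForm O κ f s) {x : Amb} (hx : x ∈ O) (ht : 0 < x.2) :
    normSqD s x = (x.2 ^ 2) ^ 2 *
      ∑ i, 2 * Complex.normSq (dcoeff κ f (coordVec i) x) *
        (1 + x.2 ^ 2 * Complex.normSq (κ x)) ^ 2 := by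
  have ht' := ht.ne'
  rw [normSqD, Finset.mul_sum]
  refine Finset.sum_congr rfl fun i _ => ?_
  rw [frame, map_smul, h.fderiv_eq hx, real_smul_quadAt, fibreInner_quadAt ht']
  generalize dcoeff κ f (coordVec i) x = c
  simp only [Complex.mul_conj, Complex.ofReal_re, Complex.normSq_mul, Complex.normSq_ofReal,
    map_pow, Complex.normSq_ofNat]
  field_simp
  ring

/-- The rescaled pairing `x.2⁻¹ ⟨∇ᵤ s, k⟩` as a function that is smooth up to the boundary. -/
def scaledPairing (κ : Amb → ℂ) (f : ℂ → ℂ) (u : Amb) (z : ProjField × Amb) : ℝ :=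
  2 * z.2.2 * (dcoeff κ f u z.2 * (κ z.2 ^ 2 * starRingEnd ℂ (z.1.eval z.2.1) +
    κ z.2 * starRingEnd ℂ (z.1 1 + 2 * z.1 2 * z.2.1) + starRingEnd ℂ (z.1 2))).re

theorem scaledPairing_smul (u : Amb) (r : ℝ) (k : ProjField) (y : Amb) :
    scaledPairing κ f u (r • k, y) = r * scaledPairing κ f u (k, y) := by
  have h1 : (r • k).eval y.1 = (r : ℂ) * k.eval y.1 := by
    simp [ProjField.eval]
    ring
  have h2 : ((r • k) 1 + 2 * (r • k) 2 * y.1) = (r : ℂ) * (k 1 + 2 * k 2 * y.1) := by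
    simp
    ring
  have h3 : (r • k) 2 = (r : ℂ) * k 2 := by simp
  unfold scaledPairing
  simp only [h1, h2]
  simp only [h3, map_mul, Complex.conj_ofReal]
  have : dcoeff κ f u y * (κ y ^ 2 * (↑r * starRingEnd ℂ (k.eval y.1)) +
      κ y * (↑r * starRingEnd ℂ (k 1 + 2 * k 2 * y.1)) + ↑r * starRingEnd ℂ (k 2)) =
      (r : ℂ) * (dcoeff κ f u y * (κ y ^ 2 * starRingEnd ℂ (k.eval y.1) +
      κ y * starRingEnd ℂ (k 1 + 2 * k 2 * y.1) + starRingEnd ℂ (k 2))) := by ring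
  rw [this, Complex.re_ofReal_mul]
  ring

/-- All three terms of the pairing carry the same factor 2 x.2². Even after division by x.2 nothing
singular is left at the boundary. -/
theorem pairing_eq (h : LocalForm O κ f s) {x : Amb} (hx : x ∈ O) (ht : 0 < x.2) (u : Amb)
    (k : ProjField) : x.2⁻¹ * pairing s k x u = scaledPairing κ f u (k, x) := by
  have ht' := ht.ne'
  rw [pairing_apply, h.fderiv_eq hx]
  conv_lhs => rw [← quadAt_taylor k x.1]
  rw [fibreInner_quadAt ht', scaledPairing]
  simp only
  generalize dcoeff κ f u x = c
  generalize starRingEnd ℂ (k.eval x.1) = p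
  generalize starRingEnd ℂ (k 1 + 2 * k 2 * x.1) = q
  generalize starRingEnd ℂ (k 2) = r
  have e1 : c * (((x.2 : ℂ) ^ 2 * κ x) ^ 2) * p = ((x.2 ^ 4 : ℝ) : ℂ) * (c * κ x ^ 2 * p) := by
    push_cast; ring
  have e2 : 2 * c * ((x.2 : ℂ) ^ 2 * κ x) * q = ((2 * x.2 ^ 2 : ℝ) : ℂ) * (c * κ x * q) := by
    push_cast; ring
  have e3 : c * (κ x ^ 2 * p + κ x * q + r) = c * κ x ^ 2 * p + c * κ x * q + c * r := by ring
  rw [e1, e2, e3, Complex.re_ofReal_mul, Complex.re_ofReal_mul, Complex.add_re, Complex.add_re]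
  field_simp

theorem contDiffAt_scaledPairing (h : LocalForm O κ f s) {x : Amb} (hx : x ∈ O) (u : Amb)
    (k : ProjField) : ContDiffAt ℝ ∞ (scaledPairing κ f u) (k, x) := by
  have h1 : ∀ i, ContDiffAt ℝ ∞ (fun z : ProjField × Amb => z.1 i) (k, x) := fun i =>
    (contDiff_apply ℝ ℂ i).contDiffAt.comp (k, x) contDiffAt_fst
  have h2 : ContDiffAt ℝ ∞ (fun z : ProjField × Amb => z.2.1) (k, x) :=
    contDiffAt_fst.comp (k, x) contDiffAt_snd
  have h3 : ContDiffAt ℝ ∞ (fun z : ProjField × Amb => z.2.2) (k, x) :=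
    contDiffAt_snd.comp (k, x) contDiffAt_snd
  have h4 : ContDiffAt ℝ ∞ (fun z : ProjField × Amb => z.1.eval z.2.1) (k, x) :=
    ((h1 0).add ((h1 1).mul h2)).add ((h1 2).mul (h2.pow 2))
  have h5 : ContDiffAt ℝ ∞ (fun z : ProjField × Amb => z.1 1 + 2 * z.1 2 * z.2.1) (k, x) :=
    (h1 1).add ((contDiffAt_const.mul (h1 2)).mul h2)
  have h6 : ContDiffAt ℝ ∞ (fun z : ProjField × Amb => κ z.2) (k, x) :=
    (h.smooth x hx).comp (k, x) contDiffAt_snd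
  have h7 : ContDiffAt ℝ ∞ (fun z : ProjField × Amb => dcoeff κ f u z.2) (k, x) :=
    (h.contDiffAt_dcoeff hx u).comp (k, x) contDiffAt_snd
  have hconj : ∀ g : ProjField × Amb → ℂ, ContDiffAt ℝ ∞ g (k, x) →
      ContDiffAt ℝ ∞ (fun y => starRingEnd ℂ (g y)) (k, x) :=
    fun g hg => Complex.conjCLE.contDiff.contDiffAt.comp (k, x) hg
  have hre : ∀ g : ProjField × Amb → ℂ, ContDiffAt ℝ ∞ g (k, x) →
      ContDiffAt ℝ ∞ (fun y => (g y).re) (k, x) :=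
    fun g hg => Complex.reCLM.contDiff.contDiffAt.comp (k, x) hg
  exact (contDiffAt_const.mul h3).mul (hre _ (h7.mul ((((h6.pow 2).mul (hconj _ h4)).add
    (h6.mul (hconj _ h5))).add (hconj _ (h1 2)))))

/-- The pairing of the Laplacian with projective fields, without the factor `x.2³`. -/
def lapDensity (κ : Amb → ℂ) (f : ℂ → ℂ) (z : ProjField × Amb) : ℝ :=
  ∑ i, fderiv ℝ (scaledPairing κ f (coordVec i)) z (0, coordVec i)

theorem continuousAt_lapDensity (h : LocalForm O κ f s) {x : Amb} (hx : x ∈ O) (k : ProjField) :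
    ContinuousAt (lapDensity κ f) (k, x) :=
  tendsto_finsetSum _ fun i _ =>
    (((h.contDiffAt_scaledPairing hx (coordVec i) k).fderiv_right (m := 0)
      (by simp)).clm_apply contDiffAt_const).continuousAt

theorem lapDensity_eq (h : LocalForm O κ f s) {x : Amb} (hx : x ∈ O) (k : ProjField) :
    lapDensity κ f (k, x) =
      ∑ i, fderiv ℝ (fun y => scaledPairing κ f (coordVec i) (k, y)) x (coordVec i) := by
  refine Finset.sum_congr rfl fun i _ => ?_
  have h1 := ((h.contDiffAt_scaledPairing hx (coordVec i) k).differentiableAt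
    (by simp)).hasFDerivAt
  have h2 : HasFDerivAt (fun y => scaledPairing κ f (coordVec i) (k, y)) _ x :=
    h1.comp (f := fun y : Amb => (k, y)) x ((hasFDerivAt_const k x).prodMk (hasFDerivAt_id x))
  rw [h2.fderiv]
  rfl

theorem lapDensity_smul (h : LocalForm O κ f s) {x : Amb} (hx : x ∈ O) (r : ℝ) (k : ProjField) :
    lapDensity κ f (r • k, x) = r * lapDensity κ f (k, x) := by
  rw [h.lapDensity_eq hx, h.lapDensity_eq hx, Finset.mul_sum]
  refine Finset.sum_congr rfl fun i _ => ?_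
  simp only [scaledPairing_smul]
  have h1 : DifferentiableAt ℝ (fun y => scaledPairing κ f (coordVec i) (k, y)) x :=
    ((h.contDiffAt_scaledPairing hx (coordVec i) k).differentiableAt (by simp)).comp
      (f := fun y : Amb => (k, y)) x ((differentiableAt_const k).prodMk differentiableAt_id)
  rw [fderiv_const_mul h1]
  rfl

/-- The rescaled pairing is exactly what the divergence differentiates, so x.2³ is the only singular
weight that remains. -/
theorem formDiv_pairing (h : LocalForm O κ f s) {x : Amb} (hx : x ∈ O) (ht : 0 < x.2)
    (k : ProjField) : formDiv (pairing s k) x = x.2 ^ 3 * lapDensity κ f (k, x) := by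
  rw [formDiv, h.lapDensity_eq hx]
  congr 1
  refine Finset.sum_congr rfl fun i _ => ?_
  have : (fun y : Amb => y.2⁻¹ * pairing s k y (coordVec i)) =ᶠ[𝓝 x]
      fun y => scaledPairing κ f (coordVec i) (k, y) := by
    filter_upwards [h.isOpen.mem_nhds hx, eventually_pos ht] with y hy hy'
    exact h.pairing_eq hy hy' _ _
  rw [this.fderiv_eq]

/-- The fields `x.2 Eᵢ`, which extend continuously to the boundary. -/
def scaledLift (x : Amb) : Fin 3 → ProjField :=
  ![quadAt x.1 ((x.2 : ℂ) ^ 2 / 2) 0 (-1 / 2),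
    quadAt x.1 (Complex.I * (x.2 : ℂ) ^ 2 / 2) 0 (Complex.I / 2),
    quadAt x.1 0 (x.2 : ℂ) 0]

theorem realLift_eq {x : Amb} (ht : x.2 ≠ 0) (i : Fin 3) :
    realLift x i = x.2⁻¹ • scaledLift x i := by
  have ht' : (x.2 : ℂ) ≠ 0 := by exact_mod_cast ht
  have hall : ∀ j : Fin 3, j = 0 ∨ j = 1 ∨ j = 2 := by decide
  rcases hall i with rfl | rfl | rfl <;>
  · simp only [realLift, scaledLift, Matrix.cons_val, real_smul_quadAt]
    push_cast
    congr 1 <;> field_simp <;> simp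

theorem continuous_quadAt {X : Type*} [TopologicalSpace X] {w a b c : X → ℂ} (hw : Continuous w)
    (ha : Continuous a) (hb : Continuous b) (hc : Continuous c) :
    Continuous fun x => quadAt (w x) (a x) (b x) (c x) := by
  refine continuous_pi fun i => ?_
  have hall : ∀ j : Fin 3, j = 0 ∨ j = 1 ∨ j = 2 := by decide
  rcases hall i with rfl | rfl | rfl
  · exact (ha.sub (hb.mul hw)).add (hc.mul (hw.pow 2))
  · exact hb.sub ((continuous_const.mul hc).mul hw)
  · exact hc

theorem continuous_scaledLift (i : Fin 3) : Continuous fun x => scaledLift x i := by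
  have hall : ∀ j : Fin 3, j = 0 ∨ j = 1 ∨ j = 2 := by decide
  rcases hall i with rfl | rfl | rfl
  · exact continuous_quadAt continuous_fst (by fun_prop) (by fun_prop) (by fun_prop)
  · exact continuous_quadAt continuous_fst (by fun_prop) (by fun_prop) (by fun_prop)
  · exact continuous_quadAt continuous_fst (by fun_prop) (by fun_prop) (by fun_prop)

/-- Parseval in the orthonormal basis Eᵢ, i Eᵢ. Each pairing is of order x.2³, but Eᵢ is x.2⁻¹ times
a field continuous up to the boundary, so each component is of order x.2². -/
theorem normSq_laplacian_eq (h : LocalForm O κ f s) {x : Amb} (hx : x ∈ O) (ht : 0 < x.2) :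
    fibreInner x (laplacian s x) (laplacian s x) = (x.2 ^ 2) ^ 2 *
      ∑ i, (lapDensity κ f (scaledLift x i, x) ^ 2 +
        lapDensity κ f (Complex.I • scaledLift x i, x) ^ 2) := by
  have ht' := ht.ne'
  have hs := h.contDiffAt hx
  have h1 : ∀ i, fibreInner x (realLift x i) (laplacian s x) =
      -(x.2 ^ 2 * lapDensity κ f (scaledLift x i, x)) := by
    intro i
    rw [fibreInner_comm, fibreInner_laplacian ht hs, h.formDiv_pairing hx ht, realLift_eq ht',
      h.lapDensity_smul hx]
    field_simp
  have h2 : ∀ i, fibreInner x (Complex.I • realLift x i) (laplacian s x) =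
      -(x.2 ^ 2 * lapDensity κ f (Complex.I • scaledLift x i, x)) := by
    intro i
    rw [fibreInner_comm, fibreInner_laplacian ht hs, h.formDiv_pairing hx ht, realLift_eq ht',
      smul_comm, h.lapDensity_smul hx]
    field_simp
  have h3 : fibreInner x (laplacian s x) (laplacian s x) =
      ∑ i, (fibreInner x (realLift x i) (laplacian s x) ^ 2 +
        fibreInner x (Complex.I • realLift x i) (laplacian s x) ^ 2) := by
    conv_lhs => rw [← fibreBilin_apply]; arg 1; rw [← sum_realLift ht' (laplacian s x)]
    simp only [map_sum, map_add, map_smul, LinearMap.sum_apply, LinearMap.add_apply,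
      LinearMap.smul_apply, fibreBilin_apply, smul_eq_mul, pow_two]
  rw [h3, Finset.mul_sum]
  refine Finset.sum_congr rfl fun i _ => ?_
  rw [h1, h2]
  ring

/-- The divergence of the real part of the section, without the factor `x.2²`. -/
def divDensity (κ : Amb → ℂ) (f : ℂ → ℂ) (x : Amb) : ℝ :=
  (dcoeff κ f (coordVec 0) x * ((x.2 : ℂ) ^ 2 * κ x ^ 2)).re - (dcoeff κ f (coordVec 0) x).re +
    ((dcoeff κ f (coordVec 1) x * ((x.2 : ℂ) ^ 2 * κ x ^ 2)).im +
      (dcoeff κ f (coordVec 1) x).im) +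
    2 * x.2 * (dcoeff κ f (coordVec 2) x * κ x).re

theorem contDiffAt_divDensity (h : LocalForm O κ f s) {x : Amb} (hx : x ∈ O) :
    ContDiffAt ℝ ∞ (divDensity κ f) x := by
  have hre : ∀ g : Amb → ℂ, ContDiffAt ℝ ∞ g x → ContDiffAt ℝ ∞ (fun y => (g y).re) x :=
    fun g hg => Complex.reCLM.contDiff.contDiffAt.comp x hg
  have him : ∀ g : Amb → ℂ, ContDiffAt ℝ ∞ g x → ContDiffAt ℝ ∞ (fun y => (g y).im) x :=
    fun g hg => Complex.imCLM.contDiff.contDiffAt.comp x hg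
  have h0 := h.contDiffAt_dcoeff hx (coordVec 0)
  have h1 := h.contDiffAt_dcoeff hx (coordVec 1)
  have h2 := h.contDiffAt_dcoeff hx (coordVec 2)
  have hk := h.smooth x hx
  have ht := (contDiffAt_ofReal_snd x).pow 2
  exact (((hre _ (h0.mul (ht.mul (hk.pow 2)))).sub (hre _ h0)).add
    ((him _ (h1.mul (ht.mul (hk.pow 2)))).add (him _ h1))).add
    ((contDiffAt_const.mul contDiffAt_snd).mul (hre _ (h2.mul hk)))

theorem divergence_eq (h : LocalForm O κ f s) {x : Amb} (hx : x ∈ O) (ht : 0 < x.2) :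
    divergence (realPart s) x = x.2 ^ 2 * divDensity κ f x := by
  rw [divergence_realPart ht ((h.contDiffAt hx).differentiableAt (by simp)), Fin.sum_univ_three,
    coordOf_killing_zero, coordOf_killing_one, coordOf_killing_two]
  simp only [h.fderiv_eq hx, eval_quadAt, deriv_quadAt]
  simp only [quadAt_two]
  unfold divDensity
  generalize dcoeff κ f (coordVec 0) x = a
  generalize dcoeff κ f (coordVec 1) x = b
  generalize dcoeff κ f (coordVec 2) x = c
  have e1 : ∀ a : ℂ, a * ((x.2 : ℂ) ^ 2 * κ x) ^ 2 =
      ((x.2 ^ 2 : ℝ) : ℂ) * (a * ((x.2 : ℂ) ^ 2 * κ x ^ 2)) := fun a => by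
    push_cast; ring
  have e2 : 2 * c * ((x.2 : ℂ) ^ 2 * κ x) = ((2 * x.2 ^ 2 : ℝ) : ℂ) * (c * κ x) := by
    push_cast; ring
  rw [e1, e1, e2, Complex.re_ofReal_mul, Complex.im_ofReal_mul, Complex.re_ofReal_mul]
  ring

/-- Differentiating x.2² loses one power of x.2, which the hyperbolic frame x.2 ∂ᵢ restores. -/
theorem normSqDiff_divergence_eq (h : LocalForm O κ f s) {x : Amb} (hx : x ∈ O) (ht : 0 < x.2) :
    normSqDiff (divergence (realPart s)) x = (x.2 ^ 2) ^ 2 *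
      ∑ i, (2 * (coordVec i).2 * divDensity κ f x +
        x.2 * fderiv ℝ (divDensity κ f) x (coordVec i)) ^ 2 := by
  have he : divergence (realPart s) =ᶠ[𝓝 x] fun y => y.2 ^ 2 * divDensity κ f y := by
    filter_upwards [h.isOpen.mem_nhds hx, eventually_pos ht] with y hy hy'
    exact h.divergence_eq hy hy'
  have h1 : HasFDerivAt (fun y : Amb => y.2 ^ 2 * divDensity κ f y) _ x :=
    ((hasFDerivAt_snd (𝕜 := ℝ) (E := ℂ) (F := ℝ) (p := x)).pow 2).mul
      ((h.contDiffAt_divDensity hx).differentiableAt (by simp)).hasFDerivAt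
  unfold normSqDiff
  rw [he.fderiv_eq, h1.fderiv, Finset.mul_sum]
  refine Finset.sum_congr rfl fun i _ => ?_
  simp [frame]
  ring

end LocalForm

/-- The properties of the pointwise norms of differential operators that determine the behaviour
of the norms on an end. -/
structure IsAdapted (N : (Amb → ProjField) → Amb → ℝ) : Prop where
  congr : ∀ {s s' : Amb → ProjField} {x : Amb}, s =ᶠ[𝓝 x] s' → N s x = N s' x
  transform : ∀ (A : SL(2, ℂ)) (c : ProjField) {s : Amb → ProjField} {x : Amb}, 0 < x.2 →
    ContDiffAt ℝ ∞ s (hypAct A x) →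
    N (fun y => pullback A (s (hypAct A y)) + c) x = N s (hypAct A x)
  local_form : ∀ {O : Set Amb} {κ : Amb → ℂ} {f : ℂ → ℂ} {s : Amb → ProjField},
    LocalForm O κ f s → ∃ G : Amb → ℝ, ContinuousOn G O ∧
      ∀ x ∈ O, 0 < x.2 → N s x = x.2 ^ 2 * G x

/-! ### The four pointwise norms: locality, invariance and decay -/

theorem sqrt_scaled (t g : ℝ) : √((t ^ 2) ^ 2 * g) = t ^ 2 * √g := by
  rw [Real.sqrt_mul (by positivity), Real.sqrt_sq (by positivity)]

theorem laplacian_congr {s s' : Amb → ProjField} {x : Amb} (h : s =ᶠ[𝓝 x] s') :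
    laplacian s x = laplacian s' x := by
  rw [laplacian_eq_flat, laplacian_eq_flat]
  congr 1
  ext k
  unfold formDiv
  congr 2
  refine Finset.sum_congr rfl fun i _ => ?_
  have : (fun y : Amb => y.2⁻¹ * pairing s k y (coordVec i)) =ᶠ[𝓝 x]
      fun y : Amb => y.2⁻¹ * pairing s' k y (coordVec i) := by
    filter_upwards [h.fderiv (𝕜 := ℝ)] with y hy
    rw [pairing_apply, pairing_apply, hy]
  rw [this.fderiv_eq]

theorem divergence_congr {s s' : Amb → ProjField} {x : Amb} (h : s =ᶠ[𝓝 x] s') :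
    divergence (realPart s) x = divergence (realPart s') x := by
  unfold divergence
  congr 1
  refine Finset.sum_congr rfl fun i _ => ?_
  have : (fun y : Amb => (y.2 ^ 3)⁻¹ * coordOf (realPart s y) i) =ᶠ[𝓝 x]
      fun y : Amb => (y.2 ^ 3)⁻¹ * coordOf (realPart s' y) i := by
    filter_upwards [h] with y hy
    rw [realPart, realPart, hy]
  rw [this.fderiv_eq]

theorem isAdapted_normD : IsAdapted fun s x => √(normSqD s x) where
  congr h := by simp only [normSqD, h.fderiv_eq]
  transform A c s x hx hs := by
    rw [normSqD_transform A c hx (hs.differentiableAt (by simp))]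
  local_form {O κ f s} h := by
    refine ⟨_, ?_, fun x hx ht => by rw [h.normSqD_eq hx ht, sqrt_scaled]⟩
    refine ContinuousOn.sqrt (continuousOn_finsetSum _ fun i _ => ?_)
    have h1 : ContinuousOn (fun x => LocalForm.dcoeff κ f (coordVec i) x) O := fun x hx =>
      (h.contDiffAt_dcoeff hx _).continuousAt.continuousWithinAt
    have h2 : ContinuousOn κ O := fun x hx => (h.smooth x hx).continuousAt.continuousWithinAt
    have h3 := Complex.continuous_normSq.comp_continuousOn h1
    have h4 := Complex.continuous_normSq.comp_continuousOn h2
    exact (continuousOn_const.mul h3).mul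
      ((continuousOn_const.add ((continuousOn_snd.pow 2).mul h4)).pow 2)

theorem isAdapted_normLaplacian :
    IsAdapted fun s x => √(fibreInner x (laplacian s x) (laplacian s x)) where
  congr h := by simp only [laplacian_congr h]
  transform A c s x hx hs := by
    rw [laplacian_transform A c hx hs, fibreInner_pullback A hx]
  local_form {O κ f s} h := by
    refine ⟨_, ?_, fun x hx ht => by rw [h.normSq_laplacian_eq hx ht, sqrt_scaled]⟩
    refine ContinuousOn.sqrt (continuousOn_finsetSum _ fun i _ => ?_)
    have h1 := LocalForm.continuous_scaledLift i
    have h2 : ContinuousOn (fun x => LocalForm.lapDensity κ f (LocalForm.scaledLift x i, x)) O :=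
      fun x hx => (ContinuousAt.comp (f := fun x => (LocalForm.scaledLift x i, x))
        (h.continuousAt_lapDensity hx _) (by fun_prop)).continuousWithinAt
    have h3 : ContinuousOn
        (fun x => LocalForm.lapDensity κ f (Complex.I • LocalForm.scaledLift x i, x)) O :=
      fun x hx => (ContinuousAt.comp (f := fun x => (Complex.I • LocalForm.scaledLift x i, x))
        (h.continuousAt_lapDensity hx _) (by fun_prop)).continuousWithinAt
    exact (h2.pow 2).add (h3.pow 2)

theorem isAdapted_normDivRe : IsAdapted fun s x => |divergence (realPart s) x| where
  congr h := by simp only [divergence_congr h]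
  transform A c s x hx hs := by
    rw [divergence_transform A c hx (hs.differentiableAt (by simp))]
  local_form {O κ f s} h := by
    refine ⟨fun x => |LocalForm.divDensity κ f x|, ?_, fun x hx ht => by
      rw [h.divergence_eq hx ht, abs_mul, abs_of_pos (by positivity)]⟩
    exact fun x hx => (h.contDiffAt_divDensity hx).continuousAt.abs.continuousWithinAt

theorem isAdapted_normDiffDivRe :
    IsAdapted fun s x => √(normSqDiff (divergence (realPart s)) x) where
  congr {s s' x} h := by
    have : divergence (realPart s) =ᶠ[𝓝 x] divergence (realPart s') := by
      filter_upwards [h.eventuallyEq_nhds] with y hy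
      exact divergence_congr hy
    simp only [normSqDiff, this.fderiv_eq]
  transform A c s x hx hs := by
    have he : divergence (realPart (fun y => pullback A (s (hypAct A y)) + c)) =ᶠ[𝓝 x]
        divergence (realPart s) ∘ hypAct A := by
      filter_upwards [eventually_differentiableAt_hypAct A hx hs] with y hy
      exact divergence_transform A c hy.1 hy.2
    -- Since s is smooth near the point, the divergence agrees nearby with the pointwise trace of
    -- ∇s, a smooth expression in the first derivatives.
    have hF : DifferentiableAt ℝ (divergence (realPart s)) (hypAct A x) := by
      have hpos := hypAct_pos A hx
      have h1 : divergence (realPart s) =ᶠ[𝓝 (hypAct A x)] fun y =>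
          ∑ i, coordOf (killing (fderiv ℝ s y (coordVec i)) y) i := by
        filter_upwards [eventually_pos hpos,
            eventually_contDiffAt (hs.of_le (by simp))] with y h1 h2
        exact divergence_realPart h1 h2
      refine DifferentiableAt.congr_of_eventuallyEq ?_ h1
      refine DifferentiableAt.fun_sum fun i _ => ?_
      have h2 : DifferentiableAt ℝ (fun y => fderiv ℝ s y (coordVec i)) (hypAct A x) :=
        ((hs.fderiv_right (m := 1) one_add_one_le_infty).differentiableAt
          (by simp)).clm_apply (differentiableAt_const _)
      exact ((contDiff_coordOf_killing i).differentiable (by simp)).differentiableAt.comp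
        (f := fun y => (fderiv ℝ s y (coordVec i), y)) _ (h2.prodMk differentiableAt_id)
    rw [← normSqDiff_comp A hx hF]
    simp only [normSqDiff, he.fderiv_eq]
  local_form {O κ f s} h := by
    refine ⟨_, ?_, fun x hx ht => by rw [h.normSqDiff_divergence_eq hx ht, sqrt_scaled]⟩
    refine ContinuousOn.sqrt (continuousOn_finsetSum _ fun i _ => ?_)
    have h1 : ContinuousOn (LocalForm.divDensity κ f) O := fun x hx =>
      (h.contDiffAt_divDensity hx).continuousAt.continuousWithinAt
    have h2 : ContinuousOn (fun x => fderiv ℝ (LocalForm.divDensity κ f) x (coordVec i)) O :=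
      fun x hx => (((h.contDiffAt_divDensity hx).fderiv_right (m := 0)
        (by simp)).clm_apply contDiffAt_const).continuousAt.continuousWithinAt
    exact ((continuousOn_const.mul h1).add (continuousOn_snd.mul h2)).pow 2

/-! ### Geodesics in the hyperboloid model

The functions `1 / t`, `w / t` and `(|w|² + t²) / t` of `(w, t)` are the coordinates of the
hyperboloid model; along a unit speed geodesic they are combinations of `eᵗ` and `e⁻ᵗ`. -/

/-- For a solution of u'' = u the combinations e⁻ᵗ(u + u') and eᵗ(u - u') are constant. -/
theorem eq_exp_combination {E : Type*} [NormedAddCommGroup E] [NormedSpace ℝ E] {u u' : ℝ → E}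
    (h : ∀ t, 0 ≤ t → HasDerivAt u (u' t) t) (h' : ∀ t, 0 ≤ t → HasDerivAt u' (u t) t) {t : ℝ}
    (ht : 0 ≤ t) : u t = Real.exp t • ((1 / 2 : ℝ) • (u 0 + u' 0)) +
      Real.exp (-t) • ((1 / 2 : ℝ) • (u 0 - u' 0)) := by
  have e1 : ∀ r, 0 ≤ r → HasDerivAt (fun r => Real.exp (-r) • (u r + u' r)) 0 r := by
    intro r hr
    have h1 := ((Real.hasDerivAt_exp (-r)).comp r (hasDerivAt_neg r)).smul ((h r hr).add (h' r hr))
    refine h1.congr_deriv ?_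
    simp only [Function.comp_apply, Pi.add_apply]
    module
  have e2 : ∀ r, 0 ≤ r → HasDerivAt (fun r => Real.exp r • (u r - u' r)) 0 r := by
    intro r hr
    have h1 := (Real.hasDerivAt_exp r).smul ((h r hr).sub (h' r hr))
    refine h1.congr_deriv ?_
    simp only [Pi.sub_apply]
    module
  have c1 := constant_of_has_deriv_right_zero (a := 0) (b := t)
    (fun r hr => (e1 r hr.1).continuousAt.continuousWithinAt)
    (fun r hr => (e1 r hr.1).hasDerivWithinAt) t ⟨ht, le_rfl⟩
  have c2 := constant_of_has_deriv_right_zero (a := 0) (b := t)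
    (fun r hr => (e2 r hr.1).continuousAt.continuousWithinAt)
    (fun r hr => (e2 r hr.1).hasDerivWithinAt) t ⟨ht, le_rfl⟩
  simp only [neg_zero, Real.exp_zero, one_smul] at c1 c2
  rw [← c1, ← c2]
  simp only [smul_smul, smul_add, smul_sub]
  have h1 : Real.exp t * ((1 / 2) * Real.exp (-t)) = 1 / 2 := by
    rw [mul_left_comm, ← Real.exp_add]; simp
  have h2 : Real.exp (-t) * ((1 / 2) * Real.exp t) = 1 / 2 := by
    rw [mul_left_comm, ← Real.exp_add]; simp
  rw [h1, h2]
  module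

/-- The expanding part of `1 / t` along the geodesic through `x` with velocity `n`. -/
def sigP (x n : Amb) : ℝ := (1 / 2) * (x.2⁻¹ + -n.2 / x.2 ^ 2)

/-- The contracting part of `1 / t`. -/
def sigM (x n : Amb) : ℝ := (1 / 2) * (x.2⁻¹ - -n.2 / x.2 ^ 2)

/-- The expanding part of `w / t`. -/
def muP (x n : Amb) : ℂ := (1 / 2 : ℝ) • (x.2⁻¹ • x.1 + (x.2⁻¹ • n.1 + (-n.2 / x.2 ^ 2) • x.1))

/-- The contracting part of `w / t`. -/
def muM (x n : Amb) : ℂ := (1 / 2 : ℝ) • (x.2⁻¹ • x.1 - (x.2⁻¹ • n.1 + (-n.2 / x.2 ^ 2) • x.1))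

/-- The function `(|w|² + t²) / t`. -/
def rho (x : Amb) : ℝ := (x.1.re ^ 2 + x.1.im ^ 2) * x.2⁻¹ + x.2

/-- The differential of `rho` at `x`. -/
def dRho (x n : Amb) : ℝ := 2 * (x.1.re * n.1.re + x.1.im * n.1.im) * x.2⁻¹ +
  (x.1.re ^ 2 + x.1.im ^ 2) * (-n.2 / x.2 ^ 2) + n.2

/-- The expanding part of `(|w|² + t²) / t`. -/
def rhoP (x n : Amb) : ℝ := (1 / 2) * (rho x + dRho x n)

/-- The contracting part of `(|w|² + t²) / t`. -/
def rhoM (x n : Amb) : ℝ := (1 / 2) * (rho x - dRho x n)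

/-- A unit speed geodesic ray, smooth up to its starting point. -/
structure IsGeodesicRay (c : ℝ → Amb) : Prop where
  smooth : ∀ t, 0 ≤ t → ContDiffAt ℝ ∞ c t
  pos : ∀ t, 0 ≤ t → 0 < (c t).2
  unit_speed : ∀ t, 0 ≤ t → hypInner (c t) (deriv c t) (deriv c t) = 1
  geodesic : ∀ t, 0 ≤ t → deriv (deriv c) t + christoffel (c t) (deriv c t) (deriv c t) = 0

theorem unit_speed_iff {x n : Amb} (hx : 0 < x.2) :
    hypInner x n n = 1 ↔ n.1.re ^ 2 + n.1.im ^ 2 + n.2 ^ 2 = x.2 ^ 2 := by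
  rw [hypInner, div_eq_one_iff_eq (pow_ne_zero _ hx.ne')]
  simp [pow_two]

namespace IsGeodesicRay

variable {c : ℝ → Amb} {t : ℝ}

theorem speed (hc : IsGeodesicRay c) (ht : 0 ≤ t) :
    (deriv c t).1.re ^ 2 + (deriv c t).1.im ^ 2 + (deriv c t).2 ^ 2 = (c t).2 ^ 2 :=
  (unit_speed_iff (hc.pos t ht)).1 (hc.unit_speed t ht)

theorem hasDerivAt (hc : IsGeodesicRay c) (ht : 0 ≤ t) : HasDerivAt c (deriv c t) t :=
  ((hc.smooth t ht).differentiableAt (by simp)).hasDerivAt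

theorem hasDerivAt_deriv (hc : IsGeodesicRay c) (ht : 0 ≤ t) :
    HasDerivAt (deriv c) (deriv (deriv c) t) t := by
  have h1 : ContDiffAt ℝ 1 (deriv c) t := by
    have := (hc.smooth t ht).fderiv_right (m := 1) one_add_one_le_infty
    exact this.clm_apply contDiffAt_const
  exact (h1.differentiableAt (by simp)).hasDerivAt

theorem deriv_deriv_fst (hc : IsGeodesicRay c) (ht : 0 ≤ t) :
    (deriv (deriv c) t).1 = (2 * (c t).2⁻¹ * (deriv c t).2) • (deriv c t).1 := by
  have h := congrArg Prod.fst (hc.geodesic t ht)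
  simp only [christoffel, Prod.fst_add, Prod.smul_fst, Prod.fst_sub, smul_zero, sub_zero,
    Prod.fst_zero] at h
  rw [eq_neg_of_add_eq_zero_left h]
  module

/-- Unit speed eliminates the horizontal velocity from the geodesic equation; this is what makes the
equation for 1 / x.2 linear. -/
theorem deriv_deriv_snd (hc : IsGeodesicRay c) (ht : 0 ≤ t) : (deriv (deriv c) t).2 =
    (c t).2⁻¹ * (2 * (deriv c t).2 ^ 2 - (c t).2 ^ 2) := by
  have h := congrArg Prod.snd (hc.geodesic t ht)
  have hs := hc.speed ht
  simp [christoffel] at h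
  rw [← hs]
  linear_combination h

theorem hasDerivAt_fst (hc : IsGeodesicRay c) (ht : 0 ≤ t) :
    HasDerivAt (fun r => (c r).1) (deriv c t).1 t :=
  (ContinuousLinearMap.fst ℝ ℂ ℝ).hasFDerivAt.comp_hasDerivAt t (hc.hasDerivAt ht)

theorem hasDerivAt_snd (hc : IsGeodesicRay c) (ht : 0 ≤ t) :
    HasDerivAt (fun r => (c r).2) (deriv c t).2 t :=
  (ContinuousLinearMap.snd ℝ ℂ ℝ).hasFDerivAt.comp_hasDerivAt t (hc.hasDerivAt ht)

theorem hasDerivAt_deriv_fst (hc : IsGeodesicRay c) (ht : 0 ≤ t) :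
    HasDerivAt (fun r => (deriv c r).1)
    ((2 * (c t).2⁻¹ * (deriv c t).2) • (deriv c t).1) t := by
  rw [← hc.deriv_deriv_fst ht]
  exact (ContinuousLinearMap.fst ℝ ℂ ℝ).hasFDerivAt.comp_hasDerivAt t (hc.hasDerivAt_deriv ht)

theorem hasDerivAt_deriv_snd (hc : IsGeodesicRay c) (ht : 0 ≤ t) :
    HasDerivAt (fun r => (deriv c r).2)
    ((c t).2⁻¹ * (2 * (deriv c t).2 ^ 2 - (c t).2 ^ 2)) t := by
  rw [← hc.deriv_deriv_snd ht]
  exact (ContinuousLinearMap.snd ℝ ℂ ℝ).hasFDerivAt.comp_hasDerivAt t (hc.hasDerivAt_deriv ht)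

theorem hasDerivAt_inv_snd (hc : IsGeodesicRay c) (ht : 0 ≤ t) :
    HasDerivAt (fun r => (c r).2⁻¹) (-(deriv c t).2 / (c t).2 ^ 2) t :=
  (hc.hasDerivAt_snd ht).inv (hc.pos t ht).ne'

theorem hasDerivAt_inv_snd' (hc : IsGeodesicRay c) (ht : 0 ≤ t) :
    HasDerivAt (fun r => -(deriv c r).2 / (c r).2 ^ 2) ((c t).2⁻¹) t := by
  have h0 := (hc.pos t ht).ne'
  have := (hc.hasDerivAt_deriv_snd ht).neg.div ((hc.hasDerivAt_snd ht).pow 2) (pow_ne_zero _ h0)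
  refine this.congr_deriv ?_
  simp
  field_simp
  ring

theorem inv_snd_eq (hc : IsGeodesicRay c) (ht : 0 ≤ t) :
    (c t).2⁻¹ = Real.exp t * sigP (c 0) (deriv c 0) +
    Real.exp (-t) * sigM (c 0) (deriv c 0) :=
  eq_exp_combination (u := fun r => (c r).2⁻¹) (fun _ h => hc.hasDerivAt_inv_snd h)
    (fun _ h => hc.hasDerivAt_inv_snd' h) ht

theorem fst_eq (hc : IsGeodesicRay c) (ht : 0 ≤ t) :
    (c t).2⁻¹ • (c t).1 = Real.exp t • muP (c 0) (deriv c 0) +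
    Real.exp (-t) • muM (c 0) (deriv c 0) := by
  refine eq_exp_combination (u := fun r => (c r).2⁻¹ • (c r).1)
    (u' := fun r => (c r).2⁻¹ • (deriv c r).1 + (-(deriv c r).2 / (c r).2 ^ 2) • (c r).1)
    (fun _ h => (hc.hasDerivAt_inv_snd h).smul (hc.hasDerivAt_fst h)) (fun r h => ?_) ht
  have h0 := (hc.pos r h).ne'
  have := ((hc.hasDerivAt_inv_snd h).smul (hc.hasDerivAt_deriv_fst h)).add
    ((hc.hasDerivAt_inv_snd' h).smul (hc.hasDerivAt_fst h))
  refine this.congr_deriv ?_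
  module

theorem rho_eq (hc : IsGeodesicRay c) (ht : 0 ≤ t) :
    rho (c t) = Real.exp t * rhoP (c 0) (deriv c 0) +
    Real.exp (-t) * rhoM (c 0) (deriv c 0) := by
  have hre : ∀ r, 0 ≤ r → HasDerivAt (fun r => (c r).1.re) (deriv c r).1.re r := fun r h =>
    Complex.reCLM.hasFDerivAt.comp_hasDerivAt r (hc.hasDerivAt_fst h)
  have him : ∀ r, 0 ≤ r → HasDerivAt (fun r => (c r).1.im) (deriv c r).1.im r := fun r h =>
    Complex.imCLM.hasFDerivAt.comp_hasDerivAt r (hc.hasDerivAt_fst h)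
  have hre' : ∀ r, 0 ≤ r → HasDerivAt (fun r => (deriv c r).1.re) _ r := fun r h =>
    Complex.reCLM.hasFDerivAt.comp_hasDerivAt r (hc.hasDerivAt_deriv_fst h)
  have him' : ∀ r, 0 ≤ r → HasDerivAt (fun r => (deriv c r).1.im) _ r := fun r h =>
    Complex.imCLM.hasFDerivAt.comp_hasDerivAt r (hc.hasDerivAt_deriv_fst h)
  refine eq_exp_combination (u := fun r => rho (c r)) (u' := fun r => dRho (c r) (deriv c r))
    (fun r h => ?_) (fun r h => ?_) ht
  · have := ((((hre r h).pow 2).add ((him r h).pow 2)).mul (hc.hasDerivAt_inv_snd h)).add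
      (hc.hasDerivAt_snd h)
    refine this.congr_deriv ?_
    simp only [dRho, Pi.add_apply, Pi.pow_apply]
    push_cast
    ring
  · have h0 := (hc.pos r h).ne'
    have := (((((hre r h).mul (hre' r h)).add ((him r h).mul (him' r h))).const_mul 2).mul
      (hc.hasDerivAt_inv_snd h)).add ((((hre r h).pow 2).add ((him r h).pow 2)).mul
      (hc.hasDerivAt_inv_snd' h)) |>.add (hc.hasDerivAt_deriv_snd h)
    refine this.congr_deriv ?_
    have hs := hc.speed h
    simp [rho]
    field_simp
    linear_combination 2 * (c r).2 * hs

end IsGeodesicRay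

/-! ### The endpoint of a geodesic ray -/

section Endpoint

variable {x n : Amb}

/-- The expanding part is position plus unit velocity in the hyperboloid model, hence a light-like
vector. Its line is the endpoint on the sphere, and this quadric relation compares the endpoint in
the two charts z and -1 / z. -/
theorem sigP_mul_rhoP (hx : 0 < x.2) (hn : hypInner x n n = 1) :
    sigP x n * rhoP x n = (muP x n).re ^ 2 + (muP x n).im ^ 2 := by
  rw [unit_speed_iff hx] at hn
  have h0 := hx.ne'
  simp only [sigP, rhoP, muP, rho, dRho, Complex.smul_re, Complex.smul_im, Complex.add_re,
    Complex.add_im, smul_eq_mul]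
  field_simp
  linear_combination (-x.2 ^ 2) * hn

theorem snd_le_of_unit (hx : 0 < x.2) (hn : hypInner x n n = 1) : n.2 ≤ x.2 := by
  rw [unit_speed_iff hx] at hn
  nlinarith [sq_nonneg n.1.re, sq_nonneg n.1.im]

theorem sigP_eq (hx : 0 < x.2) : sigP x n = (x.2 - n.2) / (2 * x.2 ^ 2) := by
  have h0 := hx.ne'
  unfold sigP
  field_simp
  ring

theorem sigP_nonneg (hx : 0 < x.2) (hn : hypInner x n n = 1) : 0 ≤ sigP x n := by
  rw [sigP_eq hx]
  have := snd_le_of_unit hx hn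
  exact div_nonneg (by linarith) (by positivity)

/-- Vanishing of the expanding part of 1 / x.2 means that the vertical component exhausts the whole
speed: the ray goes straight up to ∞. -/
theorem vertical_of_sigP_eq_zero (hx : 0 < x.2) (hn : hypInner x n n = 1) (h : sigP x n = 0) :
    n = (0, x.2) := by
  rw [sigP_eq hx, div_eq_zero_iff] at h
  have h2 : n.2 = x.2 := by
    rcases h with h | h
    · linarith
    · have : 0 < 2 * x.2 ^ 2 := by positivity
      exact absurd h this.ne'
  rw [unit_speed_iff hx, h2] at hn
  have h3 : n.1.re ^ 2 + n.1.im ^ 2 = 0 := by linarith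
  have h4 : n.1.re = 0 := by nlinarith [sq_nonneg n.1.re, sq_nonneg n.1.im]
  have h5 : n.1.im = 0 := by nlinarith [sq_nonneg n.1.re, sq_nonneg n.1.im]
  exact Prod.ext (Complex.ext h4 h5) h2

theorem rhoP_of_vertical (hx : 0 < x.2) : rhoP x (0, x.2) = x.2 := by
  have h0 := hx.ne'
  simp [rhoP, rho, dRho]
  field_simp
  ring

theorem muP_of_vertical (hx : 0 < x.2) : muP x (0, x.2) = 0 := by
  have h0 := hx.ne'
  have : -x.2 / x.2 ^ 2 = -x.2⁻¹ := by
    field_simp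
  simp [muP, this]

end Endpoint

/-! ### Variation of the endpoint -/

/-- The derivative of the velocity field along a surface, as a tangent vector. -/
def covDeriv (x n Y Ndot : Amb) : Amb := Ndot + christoffel x Y n

section Variation

variable {X N : ℝ → Amb} {Y Ndot : Amb}

/-- In curvature -1 the normal Jacobi field with data Y and ∇_Y n grows like eᵗ (Y + ∇_Y n) / 2
along parallel fields, so only this sum enters the variation of the expanding part. Orthogonality of
Y and n removes the metric term of the Christoffel expression. -/
theorem hasDerivAt_sigP (hx : 0 < (X 0).2) (hX : HasDerivAt X Y 0) (hN : HasDerivAt N Ndot 0)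
    (horth : hypInner (X 0) Y (N 0) = 0) :
    HasDerivAt (fun r => sigP (X r) (N r))
      (-(Y + covDeriv (X 0) (N 0) Y Ndot).2 / (2 * (X 0).2 ^ 2)) 0 := by
  have h0 := hx.ne'
  have hX2 : HasDerivAt (fun r => (X r).2) Y.2 0 :=
    (ContinuousLinearMap.snd ℝ ℂ ℝ).hasFDerivAt.comp_hasDerivAt 0 hX
  have hN2 : HasDerivAt (fun r => (N r).2) Ndot.2 0 :=
    (ContinuousLinearMap.snd ℝ ℂ ℝ).hasFDerivAt.comp_hasDerivAt 0 hN
  have := ((hX2.fun_inv h0).add (hN2.fun_neg.div (hX2.pow 2) (pow_ne_zero _ h0))).const_mul (1 / 2)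
  refine this.congr_deriv ?_
  rw [hypInner, div_eq_zero_iff, or_iff_left (pow_ne_zero _ h0)] at horth
  simp only [covDeriv, christoffel, horth]
  simp
  field_simp
  ring

theorem hasDerivAt_muP (hx : 0 < (X 0).2) (hX : HasDerivAt X Y 0) (hN : HasDerivAt N Ndot 0)
    (horth : hypInner (X 0) Y (N 0) = 0) :
    HasDerivAt (fun r => muP (X r) (N r))
      ((1 / 2 : ℝ) • ((X 0).2⁻¹ • (Y + covDeriv (X 0) (N 0) Y Ndot).1 -
        ((Y + covDeriv (X 0) (N 0) Y Ndot).2 / (X 0).2 ^ 2) • (X 0).1)) 0 := by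
  have h0 := hx.ne'
  have hX2 : HasDerivAt (fun r => (X r).2) Y.2 0 :=
    (ContinuousLinearMap.snd ℝ ℂ ℝ).hasFDerivAt.comp_hasDerivAt 0 hX
  have hN2 : HasDerivAt (fun r => (N r).2) Ndot.2 0 :=
    (ContinuousLinearMap.snd ℝ ℂ ℝ).hasFDerivAt.comp_hasDerivAt 0 hN
  have hX1 : HasDerivAt (fun r => (X r).1) Y.1 0 :=
    (ContinuousLinearMap.fst ℝ ℂ ℝ).hasFDerivAt.comp_hasDerivAt 0 hX
  have hN1 : HasDerivAt (fun r => (N r).1) Ndot.1 0 :=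
    (ContinuousLinearMap.fst ℝ ℂ ℝ).hasFDerivAt.comp_hasDerivAt 0 hN
  have := (((hX2.fun_inv h0).smul hX1).add (((hX2.fun_inv h0).smul hN1).add
    ((hN2.fun_neg.div (hX2.pow 2) (pow_ne_zero _ h0)).smul hX1))).const_smul (1 / 2 : ℝ)
  refine this.congr_deriv ?_
  rw [hypInner, div_eq_zero_iff, or_iff_left (pow_ne_zero _ h0)] at horth
  simp only [covDeriv, christoffel, horth]
  refine Complex.ext ?_ ?_
  all_goals
    simp only [Complex.smul_re, Complex.smul_im, Complex.add_re, Complex.add_im, Complex.sub_re,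
      Complex.sub_im, Pi.div_apply, Pi.pow_apply, Prod.fst_add, Prod.snd_add, Prod.smul_fst,
      Prod.smul_snd, smul_eq_mul, sub_zero, zero_smul]
    push_cast
    field_simp
    ring

/-- The covariant derivative of a unit field is orthogonal to it. -/
theorem hypInner_covDeriv (hx : 0 < (X 0).2) (hX : HasDerivAt X Y 0) (hN : HasDerivAt N Ndot 0)
    (horth : hypInner (X 0) Y (N 0) = 0)
    (hunit : ∀ᶠ r in 𝓝 (0 : ℝ), 0 < (X r).2 ∧ hypInner (X r) (N r) (N r) = 1) :
    euc (Y + covDeriv (X 0) (N 0) Y Ndot) (N 0) = 0 := by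
  have h0 := hx.ne'
  have hX2 : HasDerivAt (fun r => (X r).2) Y.2 0 :=
    (ContinuousLinearMap.snd ℝ ℂ ℝ).hasFDerivAt.comp_hasDerivAt 0 hX
  have h1 : HasDerivAt (fun r => euc (N r) (N r)) (euc Ndot (N 0) + euc (N 0) Ndot) 0 := by
    have := eucBilin.hasFDerivAt_of_bilinear hN.hasFDerivAt hN.hasFDerivAt
    have h2 := this.hasDerivAt
    simp [eucBilin_apply] at h2
    exact h2.congr_deriv (add_comm _ _)
  have h2 := (hX2.pow 2).congr_of_eventuallyEq (f₁ := fun r => euc (N r) (N r)) (by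
    filter_upwards [hunit] with r hr
    have := hr.2
    rw [hypInner_eq_euc, div_eq_one_iff_eq (pow_ne_zero _ hr.1.ne')] at this
    simpa using this)
  have h3 := h1.unique h2
  rw [euc_comm (N 0)] at h3
  have h4 := hunit.self_of_nhds.2
  rw [hypInner_eq_euc, div_eq_one_iff_eq (pow_ne_zero _ h0)] at h4
  rw [hypInner_eq_euc, div_eq_zero_iff, or_iff_left (pow_ne_zero _ h0)] at horth
  have e : (Y.1 * starRingEnd ℂ (N 0).1).re + Y.2 * (N 0).2 = euc Y (N 0) := by
    simp [euc, coordOf, Fin.sum_univ_three]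
  have e2 : euc ((0, 1) : Amb) (N 0) = (N 0).2 := euc_coordVec 2 (N 0)
  simp only [covDeriv, christoffel, e, horth, zero_smul, sub_zero]
  rw [← eucBilin_apply]
  simp only [map_add, map_smul, add_apply, smul_apply, eucBilin_apply, horth, h4, smul_eq_mul]
  have h5 : euc Ndot (N 0) = (X 0).2 * Y.2 := by
    simp at h3
    linarith
  rw [h5]
  field_simp
  ring

/-- If the endpoint of the normal geodesics of a convex surface is stationary in a direction, then
this direction is trivial. -/
theorem variation_eq_zero {x n Z : Amb} (hx : 0 < x.2) (hn : hypInner x n n = 1)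
    (horth : euc Z n = 0)
    (h : ((1 / 2 : ℝ) • (x.2⁻¹ • Z.1 - (Z.2 / x.2 ^ 2) • x.1)) * (sigP x n : ℂ) =
      muP x n * ((-Z.2 / (2 * x.2 ^ 2) : ℝ) : ℂ)) (hs : sigP x n ≠ 0) : Z = 0 := by
  have h0 := hx.ne'
  rw [sigP_eq hx] at h hs
  have hne : x.2 - n.2 ≠ 0 := fun h => hs (by rw [h, zero_div])
  have e1 : Z.1.re * (x.2 - n.2) + n.1.re * Z.2 = 0 := by
    have := congrArg Complex.re h
    simp only [muP, Complex.mul_re, Complex.smul_re, Complex.smul_im, Complex.sub_re,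
      Complex.ofReal_re, Complex.ofReal_im, Complex.add_re, smul_eq_mul, mul_zero, sub_zero] at this
    field_simp at this
    refine mul_left_cancel₀ h0 ?_
    linear_combination this
  have e2 : Z.1.im * (x.2 - n.2) + n.1.im * Z.2 = 0 := by
    have := congrArg Complex.im h
    simp only [muP, Complex.mul_im, Complex.smul_re, Complex.smul_im, Complex.sub_im,
      Complex.ofReal_re, Complex.ofReal_im, Complex.add_im, smul_eq_mul, mul_zero, zero_add] at this
    field_simp at this
    refine mul_left_cancel₀ h0 ?_
    linear_combination this
  rw [unit_speed_iff hx] at hn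
  have e3 : Z.1.re * n.1.re + Z.1.im * n.1.im + Z.2 * n.2 = 0 := by
    simpa [euc, coordOf, Fin.sum_univ_three] using horth
  -- The stationarity equations determine the horizontal part of Z from Z.2. Inserting them in
  -- orthogonality to n and using unit length of n leaves a nonzero multiple of Z.2.
  have e4 : Z.2 * ((x.2 - n.2) * x.2) = 0 := by
    linear_combination n.1.re * e1 + n.1.im * e2 - (x.2 - n.2) * e3 - Z.2 * hn
  have e5 : Z.2 = 0 := (mul_eq_zero.1 e4).resolve_right (mul_ne_zero hne h0)
  rw [e5, mul_zero, add_zero] at e1 e2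
  exact Prod.ext (Complex.ext ((mul_eq_zero.1 e1).resolve_right hne)
    ((mul_eq_zero.1 e2).resolve_right hne)) e5

/-- Convexity excludes that the velocity field is minus the identity. -/
theorem eq_zero_of_convex {x Y P : Amb} (hx : 0 < x.2) (h : Y + P = 0)
    (hconv : 0 ≤ hypInner x P Y) : Y = 0 := by
  rw [eq_neg_of_add_eq_zero_right h, hypInner] at hconv
  have h1 : 0 < x.2 ^ 2 := by positivity
  rw [le_div_iff₀ h1] at hconv
  simp at hconv
  have h2 : Y.1.re = 0 := by nlinarith [sq_nonneg Y.1.re, sq_nonneg Y.1.im, sq_nonneg Y.2]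
  have h3 : Y.1.im = 0 := by nlinarith [sq_nonneg Y.1.re, sq_nonneg Y.1.im, sq_nonneg Y.2]
  have h4 : Y.2 = 0 := by nlinarith [sq_nonneg Y.1.re, sq_nonneg Y.1.im, sq_nonneg Y.2]
  exact Prod.ext (Complex.ext h2 h3) h4

end Variation

/-! ### Smoothness of the hyperboloid coordinates in position and velocity -/

theorem contDiffAt_sigP {z : Amb × Amb} (hz : z.1.2 ≠ 0) :
    ContDiffAt ℝ ∞ (fun z : Amb × Amb => sigP z.1 z.2) z := by
  unfold sigP
  fun_prop (disch := simpa using hz)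

theorem contDiffAt_sigM {z : Amb × Amb} (hz : z.1.2 ≠ 0) :
    ContDiffAt ℝ ∞ (fun z : Amb × Amb => sigM z.1 z.2) z := by
  unfold sigM
  fun_prop (disch := simpa using hz)

theorem contDiffAt_muP {z : Amb × Amb} (hz : z.1.2 ≠ 0) :
    ContDiffAt ℝ ∞ (fun z : Amb × Amb => muP z.1 z.2) z := by
  unfold muP
  fun_prop (disch := simpa using hz)

theorem contDiffAt_muM {z : Amb × Amb} (hz : z.1.2 ≠ 0) :
    ContDiffAt ℝ ∞ (fun z : Amb × Amb => muM z.1 z.2) z := by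
  unfold muM
  fun_prop (disch := simpa using hz)

theorem contDiff_re {E : Type*} [NormedAddCommGroup E] [NormedSpace ℝ E] {f : E → ℂ} {x : E}
    (hf : ContDiffAt ℝ ∞ f x) : ContDiffAt ℝ ∞ (fun y => (f y).re) x :=
  Complex.reCLM.contDiff.contDiffAt.comp x hf

theorem contDiff_im {E : Type*} [NormedAddCommGroup E] [NormedSpace ℝ E] {f : E → ℂ} {x : E}
    (hf : ContDiffAt ℝ ∞ f x) : ContDiffAt ℝ ∞ (fun y => (f y).im) x :=
  Complex.imCLM.contDiff.contDiffAt.comp x hf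

theorem contDiffAt_rho {z : Amb × Amb} (hz : z.1.2 ≠ 0) :
    ContDiffAt ℝ ∞ (fun z : Amb × Amb => rho z.1) z := by
  have h1 : ContDiffAt ℝ ∞ (fun z : Amb × Amb => z.1.1) z := by fun_prop
  have h2 : ContDiffAt ℝ ∞ (fun z : Amb × Amb => z.1.2) z := by fun_prop
  exact ((((contDiff_re h1).pow 2).add ((contDiff_im h1).pow 2)).mul (h2.inv hz)).add h2

theorem contDiffAt_dRho {z : Amb × Amb} (hz : z.1.2 ≠ 0) :
    ContDiffAt ℝ ∞ (fun z : Amb × Amb => dRho z.1 z.2) z := by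
  have h1 : ContDiffAt ℝ ∞ (fun z : Amb × Amb => z.1.1) z := by fun_prop
  have h2 : ContDiffAt ℝ ∞ (fun z : Amb × Amb => z.1.2) z := by fun_prop
  have h3 : ContDiffAt ℝ ∞ (fun z : Amb × Amb => z.2.1) z := by fun_prop
  have h4 : ContDiffAt ℝ ∞ (fun z : Amb × Amb => z.2.2) z := by fun_prop
  exact ((((contDiffAt_const.mul (((contDiff_re h1).mul (contDiff_re h3)).add
    ((contDiff_im h1).mul (contDiff_im h3)))).mul (h2.inv hz)).add
    ((((contDiff_re h1).pow 2).add ((contDiff_im h1).pow 2)).mul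
      (h4.neg.div (h2.pow 2) (pow_ne_zero _ hz)))).add h4)

theorem contDiffAt_rhoP {z : Amb × Amb} (hz : z.1.2 ≠ 0) :
    ContDiffAt ℝ ∞ (fun z : Amb × Amb => rhoP z.1 z.2) z :=
  contDiffAt_const.mul ((contDiffAt_rho hz).add (contDiffAt_dRho hz))

theorem contDiffAt_rhoM {z : Amb × Amb} (hz : z.1.2 ≠ 0) :
    ContDiffAt ℝ ∞ (fun z : Amb × Amb => rhoM z.1 z.2) z :=
  contDiffAt_const.mul ((contDiffAt_rho hz).sub (contDiffAt_dRho hz))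

namespace GeomFiniteEnd

variable {Γ T : Type*} [Group Γ] [TopologicalSpace T] [ChartedSpace ℂ T] [MulAction Γ T]

/-! ### The developing map in local coordinates -/

/-- The point of the boundary surface. -/
def basePt (M : GeomFiniteEnd Γ T) (p : T) : Amb := M.dev (p, 0)

/-- The unit normal of the boundary surface. -/
def vel (M : GeomFiniteEnd Γ T) (p : T) : Amb := deriv (fun r => M.dev (p, r)) 0

theorem contMDiffAt_dev (M : GeomFiniteEnd Γ T) (p : T) {t : ℝ} (ht : 0 ≤ t) :
    ContMDiffAt (𝓘(ℝ, ℂ).prod 𝓘(ℝ, ℝ)) 𝓘(ℝ, Amb) ∞ M.dev (p, t) :=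
  (M.dev_localDiffeo ⟨(p, t), ⟨trivial, ht⟩⟩).contMDiffAt

theorem basePt_pos (M : GeomFiniteEnd Γ T) (p : T) : 0 < (M.basePt p).2 := M.dev_pos p 0 le_rfl

theorem isGeodesicRay (M : GeomFiniteEnd Γ T) (p : T) : IsGeodesicRay fun r => M.dev (p, r) where
  smooth t ht := by
    have h1 : ContMDiffAt 𝓘(ℝ, ℝ) (𝓘(ℝ, ℂ).prod 𝓘(ℝ, ℝ)) ∞ (fun r : ℝ => (p, r)) t :=
      contMDiffAt_const.prodMk contMDiffAt_id
    exact ((M.contMDiffAt_dev p ht).comp t h1).contDiffAt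
  pos t ht := M.dev_pos p t ht
  unit_speed t ht := M.unit_speed p t ht
  geodesic t ht := M.geodesic p t ht

theorem unit_vel (M : GeomFiniteEnd Γ T) (p : T) : hypInner (M.basePt p) (M.vel p) (M.vel p) = 1 :=
  M.unit_speed p 0 le_rfl

/-- The developing map in the preferred chart at `p`. -/
def devChart (M : GeomFiniteEnd Γ T) (p : T) (z : ℂ × ℝ) : Amb :=
  M.dev ((chartAt ℂ p).symm z.1, z.2)

theorem contDiffAt_of_contMDiffAt [IsManifold 𝓘(ℝ, ℂ) ∞ T] {F : Type*} [NormedAddCommGroup F]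
    [NormedSpace ℝ F] {f : T → F} {p q : T} (hq : q ∈ (chartAt ℂ p).source)
    (hf : ContMDiffAt 𝓘(ℝ, ℂ) 𝓘(ℝ, F) ∞ f q) :
    ContDiffAt ℝ ∞ (f ∘ (chartAt ℂ p).symm) (chartAt ℂ p q) := by
  have h1 : ContMDiffAt 𝓘(ℝ, ℂ) 𝓘(ℝ, ℂ) ∞ (chartAt ℂ p).symm (chartAt ℂ p q) :=
    contMDiffOn_chart_symm.contMDiffAt
      ((chartAt ℂ p).open_target.mem_nhds ((chartAt ℂ p).map_source hq))
  have h2 : ContMDiffAt 𝓘(ℝ, ℂ) 𝓘(ℝ, F) ∞ f ((chartAt ℂ p).symm (chartAt ℂ p q)) := by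
    rwa [(chartAt ℂ p).left_inv hq]
  exact (h2.comp _ h1).contDiffAt

theorem contMDiffAt_chart [IsManifold 𝓘(ℝ, ℂ) ∞ T] {p q : T} (hq : q ∈ (chartAt ℂ p).source) :
    ContMDiffAt 𝓘(ℝ, ℂ) 𝓘(ℝ, ℂ) ∞ (chartAt ℂ p) q :=
  contMDiffOn_chart.contMDiffAt ((chartAt ℂ p).open_source.mem_nhds hq)

theorem mfderiv_eq_fderiv [IsManifold 𝓘(ℝ, ℂ) ∞ T] {F : Type*} [NormedAddCommGroup F]
    [NormedSpace ℝ F] {f : T → F} {p : T} (hf : MDifferentiableAt 𝓘(ℝ, ℂ) 𝓘(ℝ, F) f p) (u : ℂ) :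
    mfderiv 𝓘(ℝ, ℂ) 𝓘(ℝ, F) f p u = fderiv ℝ (f ∘ (chartAt ℂ p).symm) (chartAt ℂ p p) u := by
  have h := hf.mfderiv
  rw [h]
  simp only [writtenInExtChartAt, extChartAt, mfld_simps, fderivWithin_univ]
  rfl

/-- The product manifold structure on ℂ × ℝ is identified with its structure as a normed space. -/
theorem contDiffAt_of_prod_model {F : Type*} [NormedAddCommGroup F] [NormedSpace ℝ F]
    {f : ℂ × ℝ → F} {z : ℂ × ℝ} (hf : ContMDiffAt (𝓘(ℝ, ℂ).prod 𝓘(ℝ, ℝ)) 𝓘(ℝ, F) ∞ f z) :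
    ContDiffAt ℝ ∞ f z := by
  rw [← modelWithCornersSelf_prod, chartedSpaceSelf_prod] at hf
  exact hf.contDiffAt

theorem contDiffAt_devChart [IsManifold 𝓘(ℝ, ℂ) ∞ T] (M : GeomFiniteEnd Γ T) {p q : T}
    (hq : q ∈ (chartAt ℂ p).source) {t : ℝ} (ht : 0 ≤ t) :
    ContDiffAt ℝ ∞ (M.devChart p) (chartAt ℂ p q, t) := by
  have h1 : ContMDiffAt 𝓘(ℝ, ℂ) 𝓘(ℝ, ℂ) ∞ (chartAt ℂ p).symm (chartAt ℂ p q) :=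
    contMDiffOn_chart_symm.contMDiffAt
      ((chartAt ℂ p).open_target.mem_nhds ((chartAt ℂ p).map_source hq))
  have h2 : ContMDiffAt (𝓘(ℝ, ℂ).prod 𝓘(ℝ, ℝ)) (𝓘(ℝ, ℂ).prod 𝓘(ℝ, ℝ)) ∞
      (fun z : ℂ × ℝ => ((chartAt ℂ p).symm z.1, z.2)) (chartAt ℂ p q, t) :=
    (h1.comp (chartAt ℂ p q, t) contMDiffAt_fst).prodMk contMDiffAt_snd
  have h3 : ContMDiffAt (𝓘(ℝ, ℂ).prod 𝓘(ℝ, ℝ)) 𝓘(ℝ, Amb) ∞ M.dev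
      ((chartAt ℂ p).symm (chartAt ℂ p q), t) := M.contMDiffAt_dev _ ht
  have h4 := h3.comp (chartAt ℂ p q, t) h2
  exact contDiffAt_of_prod_model h4

theorem contMDiff_basePt (M : GeomFiniteEnd Γ T) :
    ContMDiff 𝓘(ℝ, ℂ) 𝓘(ℝ, Amb) ∞ M.basePt := by
  intro p
  have h1 : ContMDiffAt 𝓘(ℝ, ℂ) (𝓘(ℝ, ℂ).prod 𝓘(ℝ, ℝ)) ∞ (fun q : T => (q, (0 : ℝ))) p :=
    contMDiffAt_id.prodMk contMDiffAt_const
  exact (M.contMDiffAt_dev p le_rfl).comp p h1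

theorem contMDiff_vel [IsManifold 𝓘(ℝ, ℂ) ∞ T] (M : GeomFiniteEnd Γ T) :
    ContMDiff 𝓘(ℝ, ℂ) 𝓘(ℝ, Amb) ∞ M.vel := by
  intro p
  have hp := mem_chart_source ℂ p
  have hs := M.contDiffAt_devChart hp le_rfl
  have h1 : ContDiffAt ℝ ∞ (fun z : ℂ => fderiv ℝ (M.devChart p) (z, 0) (0, 1)) (chartAt ℂ p p) :=
    ((hs.fderiv_right (m := ∞) (mod_cast le_top)).comp (chartAt ℂ p p)
      (f := fun z : ℂ => (z, (0 : ℝ))) (by fun_prop)).clm_apply contDiffAt_const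
  have h2 : ContMDiffAt 𝓘(ℝ, ℂ) 𝓘(ℝ, Amb) ∞
      (fun q => fderiv ℝ (M.devChart p) (chartAt ℂ p q, 0) (0, 1)) p :=
    h1.contMDiffAt.comp p (contMDiffAt_chart hp)
  refine h2.congr_of_eventuallyEq ?_
  filter_upwards [(chartAt ℂ p).open_source.mem_nhds hp] with q hq
  have h3 := ((M.contDiffAt_devChart hq le_rfl).differentiableAt (by simp)).hasFDerivAt
  have h4 : HasDerivAt (fun r : ℝ => (chartAt ℂ p q, r)) ((0 : ℂ), (1 : ℝ)) 0 :=
    (hasDerivAt_const (0 : ℝ) (chartAt ℂ p q)).prodMk (hasDerivAt_id (0 : ℝ))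
  have h5 := h3.comp_hasDerivAt (0 : ℝ) h4
  have h6 : M.devChart p ∘ (fun r : ℝ => (chartAt ℂ p q, r)) = fun r => M.dev (q, r) := by
    ext1 r
    simp only [devChart, Function.comp_apply, (chartAt ℂ p).left_inv hq]
  rw [h6] at h5
  exact h5.deriv

theorem contMDiff_comp_frame [IsManifold 𝓘(ℝ, ℂ) ∞ T] (M : GeomFiniteEnd Γ T) {F : Type*}
    [NormedAddCommGroup F] [NormedSpace ℝ F] {g : Amb × Amb → F}
    (hg : ∀ z : Amb × Amb, z.1.2 ≠ 0 → ContDiffAt ℝ ∞ g z) :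
    ContMDiff 𝓘(ℝ, ℂ) 𝓘(ℝ, F) ∞ fun p => g (M.basePt p, M.vel p) := by
  intro p
  have h1 : ContMDiffAt 𝓘(ℝ, ℂ) 𝓘(ℝ, Amb × Amb) ∞ (fun p => (M.basePt p, M.vel p)) p := by
    have := (M.contMDiff_basePt p).prodMk_space (M.contMDiff_vel p)
    exact this
  exact (hg (M.basePt p, M.vel p) (M.basePt_pos p).ne').contMDiffAt.comp p h1

/-! ### The endpoint map -/

theorem tendsto_dev (M : GeomFiniteEnd Γ T) (p : T) :
    Filter.Tendsto (fun t : ℝ => (M.dev (p, t) : OnePoint Amb)) Filter.atTop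
      (𝓝 (sphereIncl (M.devInf p))) :=
  (M.dev_tendsto p).comp (tendsto_const_nhds.prodMk Filter.tendsto_id)

theorem inv_snd_dev (M : GeomFiniteEnd Γ T) (p : T) {t : ℝ} (ht : 0 ≤ t) : (M.dev (p, t)).2⁻¹ =
    Real.exp t * sigP (M.basePt p) (M.vel p) + Real.exp (-t) * sigM (M.basePt p) (M.vel p) :=
  (M.isGeodesicRay p).inv_snd_eq ht

theorem fst_dev (M : GeomFiniteEnd Γ T) (p : T) {t : ℝ} (ht : 0 ≤ t) :
    (M.dev (p, t)).2⁻¹ • (M.dev (p, t)).1 =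
    Real.exp t • muP (M.basePt p) (M.vel p) + Real.exp (-t) • muM (M.basePt p) (M.vel p) :=
  (M.isGeodesicRay p).fst_eq ht

theorem rho_dev (M : GeomFiniteEnd Γ T) (p : T) {t : ℝ} (ht : 0 ≤ t) : rho (M.dev (p, t)) =
    Real.exp t * rhoP (M.basePt p) (M.vel p) + Real.exp (-t) * rhoM (M.basePt p) (M.vel p) :=
  (M.isGeodesicRay p).rho_eq ht

end GeomFiniteEnd

/-- Coordinates of a point from its coordinates in the hyperboloid model, rescaled. -/
theorem eq_of_exp_combination {y : Amb} (hy : 0 < y.2) {t α β : ℝ} {m n : ℂ}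
    (h2 : y.2⁻¹ = Real.exp t * α + Real.exp (-t) * β)
    (h1 : y.2⁻¹ • y.1 = Real.exp t • m + Real.exp (-t) • n) :
    0 < α + β * Real.exp (-t) ^ 2 ∧ y = ((α + β * Real.exp (-t) ^ 2)⁻¹ •
      (m + (Real.exp (-t) ^ 2) • n), Real.exp (-t) / (α + β * Real.exp (-t) ^ 2)) := by
  have he : Real.exp t * Real.exp (-t) = 1 := by rw [← Real.exp_add]; simp
  have hpos := Real.exp_pos t
  have hpos' := Real.exp_pos (-t)
  generalize Real.exp t = e at *
  generalize Real.exp (-t) = e' at *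
  have e1 : α + β * e' ^ 2 = e' * y.2⁻¹ := by
    rw [h2]
    linear_combination (-α) * he
  have e2 : m + (e' ^ 2) • n = e' • (y.2⁻¹ • y.1) := by
    rw [h1, smul_add, smul_smul, smul_smul, mul_comm e', he, one_smul, pow_two]
  rw [e1, e2]
  refine ⟨by positivity, Prod.ext ?_ ?_⟩
  · simp only [smul_smul]
    field_simp
    simp
  · simp only
    field_simp

namespace GeomFiniteEnd

variable {Γ T : Type*} [Group Γ] [TopologicalSpace T] [ChartedSpace ℂ T] [MulAction Γ T]

/-- As a function of e⁻ᵗ the ray extends continuously to 0, where its value is (μ₊ / σ₊, 0).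
Uniqueness of limits identifies this with the value of `devInf`. -/
theorem devInf_of_sigP_pos (M : GeomFiniteEnd Γ T) {p : T}
    (h : 0 < sigP (M.basePt p) (M.vel p)) :
    M.devInf p = ((muP (M.basePt p) (M.vel p) / (sigP (M.basePt p) (M.vel p) : ℂ) : ℂ) :
      OnePoint ℂ) := by
  set α := sigP (M.basePt p) (M.vel p)
  set m := muP (M.basePt p) (M.vel p)
  have he : Filter.Tendsto (fun t : ℝ => Real.exp (-t)) Filter.atTop (𝓝 0) :=
    Real.tendsto_exp_neg_atTop_nhds_zero
  have h1 : Filter.Tendsto (fun t : ℝ => M.dev (p, t)) Filter.atTop (𝓝 ((m / (α : ℂ), 0) : Amb)) :=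
      by
    have hF : ContinuousAt (fun e : ℝ => (((α + sigM (M.basePt p) (M.vel p) * e ^ 2)⁻¹ •
        (m + (e ^ 2) • muM (M.basePt p) (M.vel p)),
        e / (α + sigM (M.basePt p) (M.vel p) * e ^ 2)) : Amb)) 0 := by
      have : α + sigM (M.basePt p) (M.vel p) * (0 : ℝ) ^ 2 ≠ 0 := by simpa using h.ne'
      fun_prop (disch := assumption)
    have h2 := hF.tendsto.comp he
    have h3 : (((α + sigM (M.basePt p) (M.vel p) * (0 : ℝ) ^ 2)⁻¹ •
        (m + ((0 : ℝ) ^ 2) • muM (M.basePt p) (M.vel p)),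
        (0 : ℝ) / (α + sigM (M.basePt p) (M.vel p) * (0 : ℝ) ^ 2)) : Amb) = (m / (α : ℂ), 0) := by
      simp [div_eq_inv_mul]
    rw [h3] at h2
    refine h2.congr' ?_
    filter_upwards [Filter.eventually_ge_atTop 0] with t ht
    exact (eq_of_exp_combination (M.dev_pos p t ht) (M.inv_snd_dev p ht) (M.fst_dev p ht)).2.symm
  have h4 := tendsto_nhds_unique (M.tendsto_dev p)
    ((OnePoint.continuous_coe.tendsto _).comp h1)
  rcases hd : M.devInf p with _ | z
  · rw [hd] at h4
    exact absurd h4 (OnePoint.infty_ne_coe _)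
  · rw [hd] at h4
    have h5 : ((z, 0) : Amb) = (m / (α : ℂ), 0) := OnePoint.coe_injective h4
    exact congrArg OnePoint.some (congrArg Prod.fst h5)

/-- A finite endpoint would force the height to 0, while here the inverse height is a multiple of
e⁻ᵗ; the product of the two is constantly 1 and would tend to 0. -/
theorem devInf_of_sigP_zero (M : GeomFiniteEnd Γ T) {p : T}
    (h : sigP (M.basePt p) (M.vel p) = 0) : M.devInf p = OnePoint.infty := by
  by_contra hne
  obtain ⟨z, hz⟩ := OnePoint.ne_infty_iff_exists.1 hne
  have h1 := M.tendsto_dev p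
  rw [← hz] at h1
  have h2 : Filter.Tendsto (fun t : ℝ => M.dev (p, t)) Filter.atTop (𝓝 ((z, 0) : Amb)) :=
    OnePoint.isOpenEmbedding_coe.tendsto_nhds_iff.2 h1
  have h3 : Filter.Tendsto (fun t : ℝ => (M.dev (p, t)).2) Filter.atTop (𝓝 0) :=
    (continuous_snd.tendsto ((z, 0) : Amb)).comp h2
  have he : Filter.Tendsto (fun t : ℝ => Real.exp (-t)) Filter.atTop (𝓝 0) :=
    Real.tendsto_exp_neg_atTop_nhds_zero
  have h4 := h3.mul (he.mul_const (sigM (M.basePt p) (M.vel p)))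
  simp only [zero_mul, mul_zero] at h4
  have h5 : Filter.Tendsto (fun _ : ℝ => (1 : ℝ)) Filter.atTop (𝓝 0) := by
    refine h4.congr' ?_
    filter_upwards [Filter.eventually_ge_atTop 0] with t ht
    have := M.inv_snd_dev p ht
    rw [h, mul_zero, zero_add] at this
    rw [← this, mul_inv_cancel₀ (M.dev_pos p t ht).ne']
  exact one_ne_zero (tendsto_nhds_unique tendsto_const_nhds h5)

end GeomFiniteEnd

theorem smul_some_of_ne {A : SL(2, ℂ)} {z : ℂ} (h : A 1 0 * z + A 1 1 ≠ 0) :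
    (A : GL (Fin 2) ℂ) • (z : OnePoint ℂ) =
      (((A 0 0 * z + A 0 1) / (A 1 0 * z + A 1 1) : ℂ) : OnePoint ℂ) := by
  rw [OnePoint.smul_some_eq_ite]
  exact if_neg h

theorem smul_some_eq_infty {A : SL(2, ℂ)} {z : ℂ} (h : A 1 0 * z + A 1 1 = 0) :
    (A : GL (Fin 2) ℂ) • (z : OnePoint ℂ) = OnePoint.infty := by
  rw [OnePoint.smul_some_eq_ite]
  exact if_pos h

theorem smul_infty_of_ne {A : SL(2, ℂ)} (h : A 1 0 ≠ 0) :
    (A : GL (Fin 2) ℂ) • (OnePoint.infty : OnePoint ℂ) = ((A 0 0 / A 1 0 : ℂ) : OnePoint ℂ) := by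
  rw [OnePoint.smul_infty_eq_ite]
  exact if_neg h

namespace GeomFiniteEnd

variable {Γ T : Type*} [Group Γ] [TopologicalSpace T] [ChartedSpace ℂ T] [MulAction Γ T]

/-! ### The endpoint map is a local diffeomorphism -/

/-- The boundary surface is immersed because the developing map has an invertible differential at
time 0. -/
theorem eq_zero_of_mfderiv_basePt (M : GeomFiniteEnd Γ T) (p : T) (u : ℂ)
    (h : mfderiv 𝓘(ℝ, ℂ) 𝓘(ℝ, Amb) M.basePt p u = 0) : u = 0 := by
  have hd := M.dev_localDiffeo ⟨(p, 0), ⟨trivial, le_refl (0 : ℝ)⟩⟩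
  have h1 : MDifferentiableAt 𝓘(ℝ, ℂ) (𝓘(ℝ, ℂ).prod 𝓘(ℝ, ℝ)) (fun q : T => (q, (0 : ℝ))) p :=
    mdifferentiableAt_id.prodMk mdifferentiableAt_const
  have hchain : mfderiv 𝓘(ℝ, ℂ) 𝓘(ℝ, Amb) M.basePt p =
      (mfderiv (𝓘(ℝ, ℂ).prod 𝓘(ℝ, ℝ)) 𝓘(ℝ, Amb) M.dev (p, 0)).comp
        (mfderiv 𝓘(ℝ, ℂ) (𝓘(ℝ, ℂ).prod 𝓘(ℝ, ℝ)) (fun q : T => (q, (0 : ℝ))) p) :=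
    mfderiv_comp p (hd.mdifferentiableAt (by simp)) h1
  rw [mfderiv_prod_left, ← hd.mfderivToContinuousLinearEquiv_coe (by simp)] at hchain
  rw [hchain] at h
  have h2 := (hd.mfderivToContinuousLinearEquiv (by simp)).map_eq_zero_iff.1 h
  exact congrArg Prod.fst h2

theorem hasDerivAt_chart_curve [IsManifold 𝓘(ℝ, ℂ) ∞ T] {F : Type*} [NormedAddCommGroup F]
    [NormedSpace ℝ F] {g : T → F} {p : T} (hg : ContMDiffAt 𝓘(ℝ, ℂ) 𝓘(ℝ, F) ∞ g p) (u : ℂ) :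
    HasDerivAt (fun r : ℝ => g ((chartAt ℂ p).symm (chartAt ℂ p p + r • u)))
      (fderiv ℝ (g ∘ (chartAt ℂ p).symm) (chartAt ℂ p p) u) 0 := by
  have h1 := ((contDiffAt_of_contMDiffAt (mem_chart_source ℂ p) hg).differentiableAt
    (by simp)).hasFDerivAt
  have h2 : HasDerivAt (fun r : ℝ => chartAt ℂ p p + r • u) u 0 := by
    simpa using ((hasDerivAt_id (0 : ℝ)).smul_const u).const_add (chartAt ℂ p p)
  have h3 : chartAt ℂ p p + (0 : ℝ) • u = chartAt ℂ p p := by simp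
  rw [← h3] at h1
  have h4 := h1.comp_hasDerivAt (0 : ℝ) h2
  rw [h3] at h4
  exact h4

theorem chart_curve_zero (p : T) (u : ℂ) : (chartAt ℂ p).symm (chartAt ℂ p p + (0 : ℝ) • u)
    = p := by
  rw [zero_smul, add_zero, (chartAt ℂ p).left_inv (mem_chart_source ℂ p)]

/-- The variation of the endpoint of the normal geodesics in the direction `u`, as a tangent vector
along the boundary surface. -/
def endVar (M : GeomFiniteEnd Γ T) (p : T) (u : ℂ) : Amb :=
  let Y := fderiv ℝ (M.basePt ∘ (chartAt ℂ p).symm) (chartAt ℂ p p) u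
  Y + covDeriv (M.basePt p) (M.vel p) Y
    (fderiv ℝ (M.vel ∘ (chartAt ℂ p).symm) (chartAt ℂ p p) u)

section EndVar

variable [IsManifold 𝓘(ℝ, ℂ) ∞ T] (M : GeomFiniteEnd Γ T) (p : T) (u : ℂ)

theorem surfDeriv_basePt : surfDeriv (fun q => M.dev (q, 0)) p u =
    fderiv ℝ (M.basePt ∘ (chartAt ℂ p).symm) (chartAt ℂ p p) u :=
  mfderiv_eq_fderiv ((M.contMDiff_basePt p).mdifferentiableAt (by simp)) u

theorem surfDeriv_vel : surfDeriv (fun q => deriv (fun r => M.dev (q, r)) 0) p u =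
    fderiv ℝ (M.vel ∘ (chartAt ℂ p).symm) (chartAt ℂ p p) u :=
  mfderiv_eq_fderiv ((M.contMDiff_vel p).mdifferentiableAt (by simp)) u

theorem normal_chart : hypInner (M.basePt p)
    (fderiv ℝ (M.basePt ∘ (chartAt ℂ p).symm) (chartAt ℂ p p) u) (M.vel p) = 0 := by
  have h := M.normal p u
  rw [surfDeriv_basePt] at h
  exact h

/-- A stationary endpoint means ∇_Y n = -Y, so the second fundamental form at Y is -|Y|². Convexity
gives Y = 0, and the immersion property gives u = 0. -/
theorem eq_zero_of_endVar (h : M.endVar p u = 0) : u = 0 := by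
  have hc := M.convex p u
  rw [surfDeriv_basePt, surfDeriv_vel] at hc
  have h1 := eq_zero_of_convex (M.basePt_pos p) h hc
  refine M.eq_zero_of_mfderiv_basePt p u ?_
  rw [mfderiv_eq_fderiv ((M.contMDiff_basePt p).mdifferentiableAt (by simp)) u]
  exact h1

theorem euc_endVar : euc (M.endVar p u) (M.vel p) = 0 := by
  have h1 := hasDerivAt_chart_curve (M.contMDiff_basePt p) u
  have h2 := hasDerivAt_chart_curve (M.contMDiff_vel p) u
  have h0 := chart_curve_zero p u
  have := hypInner_covDeriv (by rw [h0]; exact M.basePt_pos p) h1 h2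
    (by rw [h0]; exact M.normal_chart p u)
    (Filter.Eventually.of_forall fun r => ⟨M.basePt_pos _, M.unit_vel _⟩)
  rw [h0] at this
  exact this

theorem hasDerivAt_sigP_curve :
    HasDerivAt (fun r : ℝ => sigP (M.basePt ((chartAt ℂ p).symm (chartAt ℂ p p + r • u)))
      (M.vel ((chartAt ℂ p).symm (chartAt ℂ p p + r • u))))
      (-(M.endVar p u).2 / (2 * (M.basePt p).2 ^ 2)) 0 := by
  have h1 := hasDerivAt_chart_curve (M.contMDiff_basePt p) u
  have h2 := hasDerivAt_chart_curve (M.contMDiff_vel p) u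
  have h0 := chart_curve_zero p u
  have := hasDerivAt_sigP (by rw [h0]; exact M.basePt_pos p) h1 h2
    (by rw [h0]; exact M.normal_chart p u)
  rw [h0] at this
  exact this

theorem hasDerivAt_muP_curve :
    HasDerivAt (fun r : ℝ => muP (M.basePt ((chartAt ℂ p).symm (chartAt ℂ p p + r • u)))
      (M.vel ((chartAt ℂ p).symm (chartAt ℂ p p + r • u))))
      ((1 / 2 : ℝ) • ((M.basePt p).2⁻¹ • (M.endVar p u).1 -
        ((M.endVar p u).2 / (M.basePt p).2 ^ 2) • (M.basePt p).1)) 0 := by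
  have h1 := hasDerivAt_chart_curve (M.contMDiff_basePt p) u
  have h2 := hasDerivAt_chart_curve (M.contMDiff_vel p) u
  have h0 := chart_curve_zero p u
  have := hasDerivAt_muP (by rw [h0]; exact M.basePt_pos p) h1 h2
    (by rw [h0]; exact M.normal_chart p u)
  rw [h0] at this
  exact this

end EndVar

/-! ### Normal forms of the normal geodesics -/

/-- The normal geodesics, moved by `A`, in the hyperboloid model: `α, m` and `β, n` are the
expanding and contracting parts of `1 / x.2` and `x.1 / x.2`. Near `p` the endpoint is finite,
equal to `m / α`, and a local coordinate. -/
structure RayChart (M : GeomFiniteEnd Γ T) (A : SL(2, ℂ)) (p : T) (α β : T → ℝ) (m n : T → ℂ) :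
    Prop where
  smooth_α : ContMDiff 𝓘(ℝ, ℂ) 𝓘(ℝ, ℝ) ∞ α
  smooth_β : ContMDiff 𝓘(ℝ, ℂ) 𝓘(ℝ, ℝ) ∞ β
  smooth_m : ContMDiff 𝓘(ℝ, ℂ) 𝓘(ℝ, ℂ) ∞ m
  smooth_n : ContMDiff 𝓘(ℝ, ℂ) 𝓘(ℝ, ℂ) ∞ n
  pos : 0 < α p
  endpoint : ∀ q, 0 < α q → (A : GL (Fin 2) ℂ) • M.devInf q = ((m q / (α q : ℂ) : ℂ) : OnePoint ℂ)
  inv_snd : ∀ q t, 0 ≤ t → (hypAct A (M.dev (q, t))).2⁻¹ =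
    Real.exp t * α q + Real.exp (-t) * β q
  fst : ∀ q t, 0 ≤ t → (hypAct A (M.dev (q, t))).2⁻¹ • (hypAct A (M.dev (q, t))).1 =
    Real.exp t • m q + Real.exp (-t) • n q
  deriv : ∀ u : ℂ, fderiv ℝ ((fun q => m q / (α q : ℂ)) ∘ (chartAt ℂ p).symm)
      (chartAt ℂ p p) u = 0 →
    u = 0

theorem contMDiffAt_div {p : T} {m : T → ℂ} {α : T → ℝ} (hm : ContMDiffAt 𝓘(ℝ, ℂ) 𝓘(ℝ, ℂ) ∞ m p)
    (hα : ContMDiffAt 𝓘(ℝ, ℂ) 𝓘(ℝ, ℝ) ∞ α p) (h0 : α p ≠ 0) :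
    ContMDiffAt 𝓘(ℝ, ℂ) 𝓘(ℝ, ℂ) ∞ (fun q => m q / (α q : ℂ)) p := by
  have h1 : ContDiffAt ℝ ∞ (fun z : ℂ × ℝ => z.1 / (z.2 : ℂ)) (m p, α p) := by
    have h2 : ContDiffAt ℝ ∞ (fun z : ℂ × ℝ => (z.2 : ℂ)) (m p, α p) :=
      Complex.ofRealCLM.contDiff.contDiffAt.comp _ contDiffAt_snd
    exact contDiffAt_fst.mul (h2.inv (by simpa using h0))
  exact h1.contMDiffAt.comp p (hm.prodMk_space hα)

theorem hypAct_inversion_snd (x : Amb) (hx : 0 < x.2) : (hypAct inversion x).2⁻¹ = rho x := by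
  rw [hypAct_inversion, rho]
  simp
  field_simp

theorem hypAct_inversion_fst (x : Amb) (hx : 0 < x.2) :
    (hypAct inversion x).2⁻¹ • (hypAct inversion x).1 = -starRingEnd ℂ (x.2⁻¹ • x.1) := by
  have h : 0 < x.1.re ^ 2 + x.1.im ^ 2 + x.2 ^ 2 := by positivity
  rw [hypAct_inversion]
  simp only [Prod.smul_fst, Prod.smul_snd, smul_eq_mul, mul_inv, inv_inv, smul_smul]
  rw [mul_right_comm, mul_inv_cancel₀ h.ne', one_mul]
  simp

section Exists

variable [IsManifold 𝓘(ℝ, ℂ) ∞ T] (M : GeomFiniteEnd Γ T) {p : T}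

/-- The endpoint is finite at p without any motion. By the quotient rule, a vanishing derivative of
μ₊ / σ₊ is the proportionality assumed in `variation_eq_zero`. -/
theorem rayChart_one (hp : 0 < sigP (M.basePt p) (M.vel p)) :
    M.RayChart 1 p (fun q => sigP (M.basePt q) (M.vel q)) (fun q => sigM (M.basePt q) (M.vel q))
      (fun q => muP (M.basePt q) (M.vel q)) (fun q => muM (M.basePt q) (M.vel q)) where
  smooth_α := M.contMDiff_comp_frame fun _ => contDiffAt_sigP
  smooth_β := M.contMDiff_comp_frame fun _ => contDiffAt_sigM
  smooth_m := M.contMDiff_comp_frame fun _ => contDiffAt_muP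
  smooth_n := M.contMDiff_comp_frame fun _ => contDiffAt_muM
  pos := hp
  endpoint q hq := by
    rw [M.devInf_of_sigP_pos hq]
    simp
  inv_snd q t ht := by rw [hypAct_one, M.inv_snd_dev q ht]
  fst q t ht := by rw [hypAct_one, M.fst_dev q ht]
  deriv u hu := by
    have hα : ContMDiff 𝓘(ℝ, ℂ) 𝓘(ℝ, ℝ) ∞ (fun q => sigP (M.basePt q) (M.vel q)) :=
      M.contMDiff_comp_frame fun _ => contDiffAt_sigP
    have hm : ContMDiff 𝓘(ℝ, ℂ) 𝓘(ℝ, ℂ) ∞ (fun q => muP (M.basePt q) (M.vel q)) :=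
      M.contMDiff_comp_frame fun _ => contDiffAt_muP
    have h1 := hasDerivAt_chart_curve (contMDiffAt_div (hm p) (hα p) hp.ne') u
    rw [hu] at h1
    have h0 := chart_curve_zero p u
    have h2 := (M.hasDerivAt_muP_curve p u).div (M.hasDerivAt_sigP_curve p u).ofReal_comp
      (by rw [h0]; exact_mod_cast hp.ne')
    have h3 := h2.unique h1
    rw [h0, div_eq_zero_iff, or_iff_left (pow_ne_zero _ (by exact_mod_cast hp.ne')), sub_eq_zero]
      at h3
    exact M.eq_zero_of_endVar p u (variation_eq_zero (M.basePt_pos p) (M.unit_vel p)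
      (M.euc_endVar p u) h3 hp.ne')

/-- The endpoint at p is ∞ and the inversion moves it to 0. In the hyperboloid model inversion
exchanges 1 / x.2 with `rho` and replaces x.1 / x.2 by minus its conjugate. -/
theorem rayChart_inversion (hp : sigP (M.basePt p) (M.vel p) = 0) :
    M.RayChart inversion p (fun q => rhoP (M.basePt q) (M.vel q))
      (fun q => rhoM (M.basePt q) (M.vel q))
      (fun q => -starRingEnd ℂ (muP (M.basePt q) (M.vel q)))
      (fun q => -starRingEnd ℂ (muM (M.basePt q) (M.vel q))) where
  smooth_α := M.contMDiff_comp_frame fun _ => contDiffAt_rhoP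
  smooth_β := M.contMDiff_comp_frame fun _ => contDiffAt_rhoM
  smooth_m := M.contMDiff_comp_frame (g := fun z => -starRingEnd ℂ (muP z.1 z.2)) fun z hz =>
    (Complex.conjCLE.contDiff.contDiffAt.comp z (contDiffAt_muP hz)).neg
  smooth_n := M.contMDiff_comp_frame (g := fun z => -starRingEnd ℂ (muM z.1 z.2)) fun z hz =>
    (Complex.conjCLE.contDiff.contDiffAt.comp z (contDiffAt_muM hz)).neg
  pos := by
    have hx := M.basePt_pos p
    rw [vertical_of_sigP_eq_zero hx (M.unit_vel p) hp, rhoP_of_vertical hx]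
    exact hx
  endpoint q hq := by
    have hx := M.basePt_pos q
    rcases (sigP_nonneg hx (M.unit_vel q)).eq_or_lt with h | h
    · rw [M.devInf_of_sigP_zero h.symm, vertical_of_sigP_eq_zero hx (M.unit_vel q) h.symm,
        muP_of_vertical hx]
      rw [smul_infty_of_ne (by simp [inversion])]
      simp [inversion]
    · rw [M.devInf_of_sigP_pos h]
      have h1 := sigP_mul_rhoP hx (M.unit_vel q)
      -- The light cone relation |μ|² = σρ turns -1 / (μ / σ) into -μ̄ / ρ.
      have h2 : muP (M.basePt q) (M.vel q) * starRingEnd ℂ (muP (M.basePt q) (M.vel q)) =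
          (sigP (M.basePt q) (M.vel q) : ℂ) * (rhoP (M.basePt q) (M.vel q) : ℂ) := by
        rw [Complex.mul_conj, Complex.normSq_apply]
        norm_cast
        rw [h1]
        ring
      have h3 : (sigP (M.basePt q) (M.vel q) : ℂ) ≠ 0 := by exact_mod_cast h.ne'
      have h4 : (rhoP (M.basePt q) (M.vel q) : ℂ) ≠ 0 := by exact_mod_cast hq.ne'
      have h5 : muP (M.basePt q) (M.vel q) ≠ 0 := fun h0 => by
        rw [h0, zero_mul] at h2
        exact mul_ne_zero h3 h4 h2.symm
      rw [smul_some_of_ne (by simp [inversion, h3, h5])]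
      congr 1
      simp [inversion]
      field_simp
      linear_combination h2
  inv_snd q t ht := by
    rw [hypAct_inversion_snd _ (M.dev_pos q t ht), M.rho_dev q ht]
  fst q t ht := by
    rw [hypAct_inversion_fst _ (M.dev_pos q t ht), M.fst_dev q ht]
    simp only [Complex.real_smul, map_add, map_mul, Complex.conj_ofReal]
    ring
  deriv u hu := by
    have hx := M.basePt_pos p
    have hv := vertical_of_sigP_eq_zero hx (M.unit_vel p) hp
    have hα : ContMDiff 𝓘(ℝ, ℂ) 𝓘(ℝ, ℝ) ∞ (fun q => rhoP (M.basePt q) (M.vel q)) :=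
      M.contMDiff_comp_frame fun _ => contDiffAt_rhoP
    have hm : ContMDiff 𝓘(ℝ, ℂ) 𝓘(ℝ, ℂ) ∞
        (fun q => -starRingEnd ℂ (muP (M.basePt q) (M.vel q))) :=
      M.contMDiff_comp_frame (g := fun z => -starRingEnd ℂ (muP z.1 z.2)) fun z hz =>
        (Complex.conjCLE.contDiff.contDiffAt.comp z (contDiffAt_muP hz)).neg
    have hpos : rhoP (M.basePt p) (M.vel p) ≠ 0 := by
      rw [hv, rhoP_of_vertical hx]
      exact hx.ne'
    have h1 := hasDerivAt_chart_curve (contMDiffAt_div (hm p) (hα p) hpos) u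
    rw [hu] at h1
    have h0 := chart_curve_zero p u
    have hr := hasDerivAt_chart_curve (hα p) u
    -- The numerator vanishes at p, so a stationary quotient makes the numerator stationary too.
    -- Since the normal is vertical there, `endVar` is horizontal by orthogonality, and both of its
    -- components vanish.
    have h2 := h1.mul hr.ofReal_comp
    have h3 : (-(starRingEnd ℂ) (muP (M.basePt p) (M.vel p))) = 0 := by
      rw [hv, muP_of_vertical hx]
      simp
    rw [h0, h3] at h2
    simp only [zero_mul, zero_div, add_zero] at h2
    have hc := hr.continuousAt.eventually_ne (y := 0) (by rw [h0]; exact hpos)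
    have h5 : HasDerivAt (fun r : ℝ => -starRingEnd ℂ
        (muP (M.basePt ((chartAt ℂ p).symm (chartAt ℂ p p + r • u)))
          (M.vel ((chartAt ℂ p).symm (chartAt ℂ p p + r • u))))) 0 0 := by
      refine h2.congr_of_eventuallyEq ?_
      filter_upwards [hc] with r hr
      exact (div_mul_cancel₀ _ (Complex.ofReal_ne_zero.2 hr)).symm
    have h6 : HasDerivAt (fun r : ℝ => -starRingEnd ℂ
        (muP (M.basePt ((chartAt ℂ p).symm (chartAt ℂ p p + r • u)))
          (M.vel ((chartAt ℂ p).symm (chartAt ℂ p p + r • u)))))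
        (-Complex.conjCLE ((1 / 2 : ℝ) • ((M.basePt p).2⁻¹ • (M.endVar p u).1 -
        ((M.endVar p u).2 / (M.basePt p).2 ^ 2) • (M.basePt p).1))) 0 :=
      (Complex.conjCLE.toContinuousLinearMap.hasFDerivAt.comp_hasDerivAt (0 : ℝ)
        (M.hasDerivAt_muP_curve p u)).neg
    have h7 := h6.unique h5
    have h8 : (1 / 2 : ℝ) • ((M.basePt p).2⁻¹ • (M.endVar p u).1 -
        ((M.endVar p u).2 / (M.basePt p).2 ^ 2) • (M.basePt p).1) = 0 := by
      have := neg_eq_zero.1 h7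
      exact (map_eq_zero_iff _ Complex.conjCLE.injective).1 this
    have h9 : (M.endVar p u).2 = 0 := by
      have := M.euc_endVar p u
      rw [hv] at this
      simpa [euc, coordOf, Fin.sum_univ_three, hx.ne'] using this
    rw [h9] at h8
    simp [hx.ne'] at h8
    exact M.eq_zero_of_endVar p u (Prod.ext h8 h9)

theorem exists_rayChart (p : T) : ∃ A α β m n, M.RayChart A p α β m n := by
  rcases (sigP_nonneg (M.basePt_pos p) (M.unit_vel p)).eq_or_lt with h | h
  · exact ⟨_, _, _, _, _, M.rayChart_inversion h.symm⟩
  · exact ⟨_, _, _, _, _, M.rayChart_one h⟩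

end Exists

end GeomFiniteEnd

/-! ### Local inverses -/

section LocalInv

variable {X Y : Type*} [TopologicalSpace X] [TopologicalSpace Y] {f : X → Y} {x : X}

/-- The map `f` is a local homeomorphism near `x`. -/
def IsLocalHomeoNear (f : X → Y) (x : X) : Prop :=
  ∃ e : OpenPartialHomeomorph X Y, x ∈ e.source ∧ Set.EqOn f e e.source

theorem IsLocalHomeoNear.exists_localInv_eq (h : IsLocalHomeoNear f x) :
    ∃ e : OpenPartialHomeomorph X Y, x ∈ e.source ∧ Set.EqOn f e e.source ∧
      localInv f x = e.symm := by
  refine ⟨h.choose, h.choose_spec.1, h.choose_spec.2, ?_⟩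
  have h' : ∃ e : OpenPartialHomeomorph X Y, x ∈ e.source ∧ Set.EqOn f e e.source := h
  rw [localInv, dif_pos h']

theorem IsLocalHomeoNear.eventually_localInv_comp (h : IsLocalHomeoNear f x) {Z : Type*}
    {l : Filter Z} {g : Z → X} (hg : Filter.Tendsto g l (𝓝 x)) :
    ∀ᶠ z in l, localInv f x (f (g z)) = g z := by
  obtain ⟨e, hx, he, hl⟩ := h.exists_localInv_eq
  filter_upwards [hg (e.open_source.mem_nhds hx)] with z hz
  rw [hl, he hz, e.left_inv hz]

theorem localInv_eventuallyEq {e : OpenPartialHomeomorph X Y} (hx : x ∈ e.source)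
    (he : Set.EqOn f e e.source) : localInv f x =ᶠ[𝓝 (f x)] e.symm := by
  have h : IsLocalHomeoNear f x := ⟨e, hx, he⟩
  rw [he hx]
  have h1 : Filter.Tendsto e.symm (𝓝 (e x)) (𝓝 x) := e.tendsto_symm hx
  filter_upwards [h.eventually_localInv_comp h1,
    h1 (e.open_source.mem_nhds hx), e.open_target.mem_nhds (e.map_source hx)] with y h2 h3 h4
  rw [← h2, he h3, e.right_inv h4]

theorem IsLocalHomeoNear.tendsto_localInv (h : IsLocalHomeoNear f x) :
    Filter.Tendsto (localInv f x) (𝓝 (f x)) (𝓝 x) := by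
  obtain ⟨e, hx, he, hl⟩ := h.exists_localInv_eq
  rw [hl, he hx]
  exact e.tendsto_symm hx

theorem IsLocalHomeoNear.eventually_right_inv (h : IsLocalHomeoNear f x) :
    ∀ᶠ y in 𝓝 (f x), f (localInv f x y) = y := by
  obtain ⟨e, hx, he, hl⟩ := h.exists_localInv_eq
  rw [hl, he hx]
  filter_upwards [e.tendsto_symm hx (e.open_source.mem_nhds hx),
    e.open_target.mem_nhds (e.map_source hx)] with y h1 h2
  rw [he h1, e.right_inv h2]

/-- The germs of the inverses chosen separately at nearby points agree with the one chosen at x, so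
local formulas can be written with a single inverse. -/
theorem IsLocalHomeoNear.eventually_localInv_eq (h : IsLocalHomeoNear f x) :
    ∀ᶠ x' in 𝓝 x, localInv f x' =ᶠ[𝓝 (f x')] localInv f x := by
  obtain ⟨e, hx, he, hl⟩ := h.exists_localInv_eq
  filter_upwards [e.open_source.mem_nhds hx] with x' hx'
  rw [hl]
  exact localInv_eventuallyEq hx' he

end LocalInv

/-! ### Möbius transformations -/

/-- The Möbius transformation of the complex plane. -/
def mob (A : SL(2, ℂ)) (z : ℂ) : ℂ := (A 0 0 * z + A 0 1) / (A 1 0 * z + A 1 1)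

theorem coe_mul_smul (A B : SL(2, ℂ)) (x : OnePoint ℂ) :
    ((A * B : SL(2, ℂ)) : GL (Fin 2) ℂ) • x = (A : GL (Fin 2) ℂ) • (B : GL (Fin 2) ℂ) • x := by
  rw [map_mul, mul_smul]

theorem coe_one_smul (x : OnePoint ℂ) : ((1 : SL(2, ℂ)) : GL (Fin 2) ℂ) • x = x := by
  rw [map_one, one_smul]

theorem coe_inv_smul_smul (A : SL(2, ℂ)) (x : OnePoint ℂ) :
    ((A⁻¹ : SL(2, ℂ)) : GL (Fin 2) ℂ) • (A : GL (Fin 2) ℂ) • x = x := by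
  rw [← coe_mul_smul, inv_mul_cancel, coe_one_smul]

theorem coe_smul_inv_smul (A : SL(2, ℂ)) (x : OnePoint ℂ) :
    (A : GL (Fin 2) ℂ) • ((A⁻¹ : SL(2, ℂ)) : GL (Fin 2) ℂ) • x = x := by
  rw [← coe_mul_smul, mul_inv_cancel, coe_one_smul]

theorem hasDerivAt_mob (A : SL(2, ℂ)) {z : ℂ} (h : A 1 0 * z + A 1 1 ≠ 0) :
    HasDerivAt (mob A) (((A 1 0 * z + A 1 1) ^ 2)⁻¹) z := by
  have h1 : HasDerivAt (fun z => A 0 0 * z + A 0 1) (A 0 0) z := by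
    simpa using ((hasDerivAt_id z).const_mul (A 0 0)).add_const (A 0 1)
  have h2 : HasDerivAt (fun z => A 1 0 * z + A 1 1) (A 1 0) z := by
    simpa using ((hasDerivAt_id z).const_mul (A 1 0)).add_const (A 1 1)
  refine (h1.div h2 h).congr_deriv ?_
  have := det_eq A
  field_simp
  linear_combination this

theorem eventually_den_ne (A : SL(2, ℂ)) {z : ℂ} (h : A 1 0 * z + A 1 1 ≠ 0) :
    ∀ᶠ y in 𝓝 z, A 1 0 * y + A 1 1 ≠ 0 :=
  ContinuousAt.eventually_ne (by fun_prop) h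

/-- The Möbius action is continuous. -/
theorem tendsto_smul_coe (A : SL(2, ℂ)) (z : ℂ) :
    Filter.Tendsto (fun y : ℂ => (A : GL (Fin 2) ℂ) • (y : OnePoint ℂ)) (𝓝 z)
      (𝓝 ((A : GL (Fin 2) ℂ) • (z : OnePoint ℂ))) := by
  by_cases h : A 1 0 * z + A 1 1 = 0
  -- At the pole the punctured neighbourhood is treated separately: the denominator tends to 0, and
  -- the numerator stays away from 0 because the determinant is 1.
  · rw [smul_some_eq_infty h, ← nhdsNE_sup_pure, Filter.tendsto_sup]
    refine ⟨?_, ?_⟩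
    · have hc : A 1 0 ≠ 0 := by
        intro hc
        have h1 := det_eq A
        rw [hc, zero_mul, zero_add] at h
        rw [hc, h] at h1
        simp at h1
      have hnum : A 0 0 * z + A 0 1 ≠ 0 := by
        intro hn
        have h1 := det_eq A
        have h2 : (1 : ℂ) = 0 := by linear_combination -h1 + A 0 0 * h - A 1 0 * hn
        exact one_ne_zero h2
      have hinj : ∀ y, A 1 0 * y + A 1 1 = A 1 0 * (y - z) := by
        intro y
        linear_combination h
      have h1 : Filter.Tendsto (fun y => ‖A 1 0 * y + A 1 1‖) (𝓝[≠] z) (𝓝[>] 0) := by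
        refine tendsto_nhdsWithin_iff.2 ⟨?_, ?_⟩
        · have : ContinuousAt (fun y => ‖A 1 0 * y + A 1 1‖) z := by fun_prop
          have h2 := this.tendsto
          rw [h, norm_zero] at h2
          exact h2.mono_left nhdsWithin_le_nhds
        · filter_upwards [self_mem_nhdsWithin] with y hy
          rw [Set.mem_Ioi, norm_pos_iff, hinj]
          exact mul_ne_zero hc (sub_ne_zero.2 hy)
      have h2 : Filter.Tendsto (fun y => ‖A 0 0 * y + A 0 1‖) (𝓝[≠] z) (𝓝 ‖A 0 0 * z + A 0 1‖) := by
        have : ContinuousAt (fun y => ‖A 0 0 * y + A 0 1‖) z := by fun_prop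
        exact this.tendsto.mono_left nhdsWithin_le_nhds
      have h3 : Filter.Tendsto (mob A) (𝓝[≠] z) (Filter.coclosedCompact ℂ) := by
        rw [Filter.coclosedCompact_eq_cocompact, ← Metric.cobounded_eq_cocompact,
          ← tendsto_norm_atTop_iff_cobounded]
        refine (h2.pos_mul_atTop (norm_pos_iff.2 hnum)
          (tendsto_inv_nhdsGT_zero.comp h1)).congr fun y => ?_
        rw [mob, norm_div, div_eq_mul_inv]
        rfl
      have h4 : Filter.Tendsto (fun y => ((mob A y : ℂ) : OnePoint ℂ)) (𝓝[≠] z)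
          (𝓝 OnePoint.infty) := by
        rw [OnePoint.nhds_infty_eq]
        exact (Filter.tendsto_map.comp h3).mono_right le_sup_left
      refine h4.congr' ?_
      filter_upwards [self_mem_nhdsWithin] with y hy
      rw [smul_some_of_ne (by rw [hinj]; exact mul_ne_zero hc (sub_ne_zero.2 hy)), mob]
    · rw [Filter.tendsto_pure_left]
      intro s hs
      rw [smul_some_eq_infty h]
      exact mem_of_mem_nhds hs
  · rw [smul_some_of_ne h]
    have h1 : ContinuousAt (fun y : ℂ => ((mob A y : ℂ) : OnePoint ℂ)) z :=
      OnePoint.continuous_coe.continuousAt.comp (hasDerivAt_mob A h).continuousAt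
    refine h1.tendsto.congr' ?_
    filter_upwards [eventually_den_ne A h] with y hy
    rw [smul_some_of_ne hy, mob]

/-! ### The osculating field under Möbius transformations -/

theorem osculating_congr {f g : ℂ → ℂ} {w : ℂ} (h : f =ᶠ[𝓝 w] g) :
    osculating f w = osculating g w := by
  rw [osculating, osculating, h.eq_of_nhds, h.deriv_eq, h.deriv.deriv_eq]

/-- A quadratic polynomial is its own Taylor polynomial of order two; hence a projective field
changes the canonical lift only by a constant. -/
theorem osculating_eval (k : ProjField) (w : ℂ) : osculating k.eval w = k := by
  have h1 : ∀ z, HasDerivAt k.eval (k 1 + 2 * k 2 * z) z := fun z => by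
    have := (((hasDerivAt_id z).const_mul (k 1)).const_add (k 0)).add
      (((hasDerivAt_id z).pow 2).const_mul (k 2))
    refine this.congr_deriv ?_
    simp
    ring
  have h2 : deriv k.eval = fun z => k 1 + 2 * k 2 * z := funext fun z => (h1 z).deriv
  have h3 : HasDerivAt (fun z => k 1 + 2 * k 2 * z) (2 * k 2) w := by
    simpa using ((hasDerivAt_id w).const_mul (2 * k 2)).const_add (k 1)
  rw [osculating, h2, h3.deriv]
  ext i
  fin_cases i <;> simp [quadAt, ProjField.eval]
  ring

theorem osculating_add {f g : ℂ → ℂ} {w : ℂ} (hf : AnalyticAt ℂ f w) (hg : AnalyticAt ℂ g w) :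
    osculating (fun z => f z + g z) w = osculating f w + osculating g w := by
  have h1 : deriv (fun z => f z + g z) =ᶠ[𝓝 w] fun z => deriv f z + deriv g z := by
    filter_upwards [hf.eventually_analyticAt, hg.eventually_analyticAt] with z h1 h2
    exact deriv_fun_add h1.differentiableAt h2.differentiableAt
  rw [osculating, osculating, osculating, h1.eq_of_nhds, h1.deriv_eq,
    deriv_fun_add hf.deriv.differentiableAt hg.deriv.differentiableAt]
  ext i
  fin_cases i <;> simp [quadAt] <;> ring

/-- Möbius pullback preserves projective fields and 2-jets, so it commutes with osculation. This
makes the canonical lift independent of the projective chart. -/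
theorem osculating_transform (A : SL(2, ℂ)) {f g : ℂ → ℂ} {w : ℂ} (hw : A 1 0 * w + A 1 1 ≠ 0)
    (hg : AnalyticAt ℂ g (mob A w))
    (h : f =ᶠ[𝓝 w] fun z => (A 1 0 * z + A 1 1) ^ 2 * g (mob A z)) :
    osculating f w = pullback A (osculating g (mob A w)) := by
  have hden : ∀ z, HasDerivAt (fun z => A 1 0 * z + A 1 1) (A 1 0) z := fun z => by
    simpa using ((hasDerivAt_id z).const_mul (A 1 0)).add_const (A 1 1)
  have hm := (hasDerivAt_mob A hw)
  have h1 : deriv f =ᶠ[𝓝 w] fun z => 2 * A 1 0 * (A 1 0 * z + A 1 1) * g (mob A z) +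
      deriv g (mob A z) := by
    refine h.deriv.trans ?_
    filter_upwards [eventually_den_ne A hw,
      hm.continuousAt.eventually hg.eventually_analyticAt] with z hz hgz
    refine (((hden z).pow 2).mul
      (hgz.differentiableAt.hasDerivAt.comp z (hasDerivAt_mob A hz))).deriv.trans ?_
    simp
    field_simp
  have h2 : deriv (deriv f) w = 2 * A 1 0 ^ 2 * g (mob A w) +
      2 * A 1 0 * deriv g (mob A w) / (A 1 0 * w + A 1 1) +
      deriv (deriv g) (mob A w) / (A 1 0 * w + A 1 1) ^ 2 := by
    rw [h1.deriv_eq]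
    have e1 := hg.differentiableAt.hasDerivAt.comp w hm
    have e2 := hg.deriv.differentiableAt.hasDerivAt.comp w hm
    refine ((((hden w).const_mul (2 * A 1 0)).mul e1).add e2).deriv.trans ?_
    simp
    field_simp
  rw [osculating, h.eq_of_nhds, h1.eq_of_nhds, h2, osculating]
  generalize deriv (deriv g) (mob A w) = g2
  generalize deriv g (mob A w) = g1
  generalize g (mob A w) = g0
  have hdet := det_eq A
  simp only [mob, pullback, quadAt]
  generalize A 0 0 = a at *
  generalize A 0 1 = b at *
  generalize A 1 0 = c at *
  generalize A 1 1 = d at *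
  -- Inserting powers of the determinant turns the claim into an identity of rational functions that
  -- needs no further relation.
  have e1 : g1 = g1 * (a * d - b * c) := by rw [hdet, mul_one]
  have e2 : g2 = g2 * (a * d - b * c) ^ 2 := by rw [hdet, one_pow, mul_one]
  conv_lhs => rw [e1, e2]
  ext i
  fin_cases i
  all_goals
    simp
    field_simp
    ring

namespace GeomFiniteEnd

variable {Γ T : Type*} [Group Γ] [TopologicalSpace T] [ChartedSpace ℂ T] [MulAction Γ T]

/-! ### Projective charts -/

/-- The projective chart `chart A` is finite at `p`. -/
def IsFiniteAt (M : GeomFiniteEnd Γ T) (A : SL(2, ℂ)) (p : T) : Prop :=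
  (A : GL (Fin 2) ℂ) • M.devInf p ≠ OnePoint.infty

theorem chart_eq_of_smul (M : GeomFiniteEnd Γ T) {A : SL(2, ℂ)} {p : T} {z : ℂ}
    (h : (A : GL (Fin 2) ℂ) • M.devInf p = (z : OnePoint ℂ)) : M.chart A p = z := by
  rw [chart, h]
  rfl

theorem isFiniteAt_of_smul (M : GeomFiniteEnd Γ T) {A : SL(2, ℂ)} {p : T} {z : ℂ}
    (h : (A : GL (Fin 2) ℂ) • M.devInf p = (z : OnePoint ℂ)) : M.IsFiniteAt A p := by
  rw [IsFiniteAt, h]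
  exact OnePoint.coe_ne_infty z

theorem IsFiniteAt.smul_eq {M : GeomFiniteEnd Γ T} {A : SL(2, ℂ)} {p : T} (h : M.IsFiniteAt A p) :
    (A : GL (Fin 2) ℂ) • M.devInf p = (M.chart A p : OnePoint ℂ) := by
  obtain ⟨z, hz⟩ := OnePoint.ne_infty_iff_exists.1 h
  rw [M.chart_eq_of_smul hz.symm, hz]

theorem IsFiniteAt.devInf_eq {M : GeomFiniteEnd Γ T} {A : SL(2, ℂ)} {p : T}
    (h : M.IsFiniteAt A p) :
    M.devInf p = ((A⁻¹ : SL(2, ℂ)) : GL (Fin 2) ℂ) • (M.chart A p : OnePoint ℂ) := by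
  rw [← h.smul_eq, coe_inv_smul_smul]

theorem IsFiniteAt.mul_smul_eq {M : GeomFiniteEnd Γ T} {A C : SL(2, ℂ)} {p : T}
    (h : M.IsFiniteAt A p) (hC : C 1 0 * M.chart A p + C 1 1 ≠ 0) :
    ((C * A : SL(2, ℂ)) : GL (Fin 2) ℂ) • M.devInf p = (mob C (M.chart A p) : OnePoint ℂ) := by
  rw [coe_mul_smul, h.smul_eq, smul_some_of_ne hC, mob]

theorem IsFiniteAt.den_ne {M : GeomFiniteEnd Γ T} {A C : SL(2, ℂ)} {p : T}
    (h : M.IsFiniteAt A p) (h' : M.IsFiniteAt (C * A) p) : C 1 0 * M.chart A p + C 1 1 ≠ 0 := by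
  intro h0
  rw [IsFiniteAt, coe_mul_smul, h.smul_eq] at h'
  exact h' (smul_some_eq_infty h0)

/-- In the chart of a `RayChart` the endpoint is the smooth quotient m / α. Every other finite
projective chart differs from it by a Möbius map without a pole at the point. Smoothness of the
projective boundary relative to S thus comes from the normal rays. -/
theorem IsFiniteAt.contMDiffAt_chart_and [IsManifold 𝓘(ℝ, ℂ) ∞ T] {M : GeomFiniteEnd Γ T}
    {A : SL(2, ℂ)} {p : T} (h : M.IsFiniteAt A p) :
    ContMDiffAt 𝓘(ℝ, ℂ) 𝓘(ℝ, ℂ) ∞ (M.chart A) p ∧ ∀ᶠ q in 𝓝 p, M.IsFiniteAt A q := by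
  obtain ⟨A₀, α, β, m, n, hR⟩ := M.exists_rayChart p
  have hpos : ∀ᶠ q in 𝓝 p, 0 < α q :=
    continuousAt_const.eventually_lt (hR.smooth_α p).continuousAt hR.pos
  have h0 : ContMDiffAt 𝓘(ℝ, ℂ) 𝓘(ℝ, ℂ) ∞ (M.chart A₀) p := by
    refine (contMDiffAt_div (hR.smooth_m p) (hR.smooth_α p) hR.pos.ne').congr_of_eventuallyEq ?_
    filter_upwards [hpos] with q hq
    exact M.chart_eq_of_smul (hR.endpoint q hq)
  have hf0 := M.isFiniteAt_of_smul (hR.endpoint p hR.pos)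
  have hC : A = (A * A₀⁻¹) * A₀ := by simp
  generalize A * A₀⁻¹ = C at hC
  subst hC
  have hden := hf0.den_ne h
  have h1 : ∀ᶠ q in 𝓝 p, ((C * A₀ : SL(2, ℂ)) : GL (Fin 2) ℂ) • M.devInf q =
      (mob C (M.chart A₀ q) : OnePoint ℂ) := by
    filter_upwards [hpos, h0.continuousAt.eventually (eventually_den_ne C hden)] with q hq hq'
    exact (M.isFiniteAt_of_smul (hR.endpoint q hq)).mul_smul_eq hq'
  refine ⟨?_, h1.mono fun q hq => M.isFiniteAt_of_smul hq⟩
  have h2 : ContDiffAt ℝ ∞ (mob C) (M.chart A₀ p) := by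
    have : ContDiffAt ℂ ∞ (mob C) (M.chart A₀ p) := by
      unfold mob
      fun_prop (disch := assumption)
    exact this.restrict_scalars ℝ
  refine (h2.contMDiffAt.comp p h0).congr_of_eventuallyEq ?_
  exact h1.mono fun q hq => M.chart_eq_of_smul hq

theorem isLocalHomeoNear_devInf (M : GeomFiniteEnd Γ T) (p : T) : IsLocalHomeoNear M.devInf p := by
  obtain ⟨e, he, h⟩ := M.devInf_localHomeo p
  exact ⟨e, he, fun x _ => congrFun h x⟩

/-- The inverse of the projective chart `chart A` near `p`. -/
def chartInv (M : GeomFiniteEnd Γ T) (A : SL(2, ℂ)) (p : T) (z : ℂ) : T :=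
  localInv M.devInf p (((A⁻¹ : SL(2, ℂ)) : GL (Fin 2) ℂ) • (z : OnePoint ℂ))

theorem IsFiniteAt.tendsto_inv_smul {M : GeomFiniteEnd Γ T} {A : SL(2, ℂ)} {p : T}
    (h : M.IsFiniteAt A p) : Filter.Tendsto
      (fun z : ℂ => ((A⁻¹ : SL(2, ℂ)) : GL (Fin 2) ℂ) • (z : OnePoint ℂ)) (𝓝 (M.chart A p))
      (𝓝 (M.devInf p)) := by
  rw [h.devInf_eq]
  exact tendsto_smul_coe A⁻¹ (M.chart A p)

theorem IsFiniteAt.tendsto_chartInv {M : GeomFiniteEnd Γ T} {A : SL(2, ℂ)} {p : T}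
    (h : M.IsFiniteAt A p) : Filter.Tendsto (M.chartInv A p) (𝓝 (M.chart A p)) (𝓝 p) :=
  (M.isLocalHomeoNear_devInf p).tendsto_localInv.comp h.tendsto_inv_smul

theorem IsFiniteAt.eventually_smul_chartInv {M : GeomFiniteEnd Γ T} {A : SL(2, ℂ)} {p : T}
    (h : M.IsFiniteAt A p) :
    ∀ᶠ z in 𝓝 (M.chart A p), (A : GL (Fin 2) ℂ) • M.devInf (M.chartInv A p z) = (z : OnePoint ℂ) :=
        by
  filter_upwards [h.tendsto_inv_smul.eventually
    (M.isLocalHomeoNear_devInf p).eventually_right_inv] with z hz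
  rw [chartInv, hz, coe_smul_inv_smul]

/-! ### The coefficients of a vector field in projective charts -/

variable (v : ∀ p : T, TangentSpace 𝓘(ℝ, ℂ) p)

/-- The derivative of the projective chart `chart A`. -/
def chartDeriv (M : GeomFiniteEnd Γ T) (A : SL(2, ℂ)) (p : T) : ℂ →L[ℝ] ℂ :=
  mfderiv 𝓘(ℝ, ℂ) 𝓘(ℝ, ℂ) (M.chart A) p

theorem coeff_eq (M : GeomFiniteEnd Γ T) (A : SL(2, ℂ)) (p : T) (z : ℂ) : M.coeff v A p z =
    M.chartDeriv A (M.chartInv A p z) (v (M.chartInv A p z)) := rfl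

theorem IsFiniteAt.chartDeriv_mul [IsManifold 𝓘(ℝ, ℂ) ∞ T] {M : GeomFiniteEnd Γ T}
    {A C : SL(2, ℂ)} {p : T} (h : M.IsFiniteAt A p) (hC : C 1 0 * M.chart A p + C 1 1 ≠ 0)
    (u : ℂ) :
    M.chartDeriv (C * A) p u = ((C 1 0 * M.chart A p + C 1 1) ^ 2)⁻¹ * M.chartDeriv A p u := by
  obtain ⟨hs, hf⟩ := h.contMDiffAt_chart_and
  have h1 : M.chart (C * A) =ᶠ[𝓝 p] mob C ∘ M.chart A := by
    filter_upwards [hf, hs.continuousAt.eventually (eventually_den_ne C hC)] with q hq hq'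
    exact M.chart_eq_of_smul (hq.mul_smul_eq hq')
  have h2 := ((hasDerivAt_mob C hC).hasFDerivAt.restrictScalars ℝ).hasMFDerivAt
  have h3 := (h2.comp p (hs.mdifferentiableAt (by simp)).hasMFDerivAt)
  rw [chartDeriv, (h3.congr_of_eventuallyEq h1).mfderiv]
  change M.chartDeriv A p u • ((C 1 0 * M.chart A p + C 1 1) ^ 2)⁻¹ = _
  rw [smul_eq_mul, mul_comm]

/-- The change of charts has derivative (cz + d)⁻², and both chart inverses are built from the same
local inverse of `devInf`, hence give the same point of T. -/
theorem IsFiniteAt.coeff_transform [IsManifold 𝓘(ℝ, ℂ) ∞ T] {M : GeomFiniteEnd Γ T}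
    {A C : SL(2, ℂ)} {p : T} (h : M.IsFiniteAt A p) (h' : M.IsFiniteAt (C * A) p) :
    M.coeff v A p =ᶠ[𝓝 (M.chart A p)] fun z =>
      (C 1 0 * z + C 1 1) ^ 2 * M.coeff v (C * A) p (mob C z) := by
  filter_upwards [h.eventually_smul_chartInv, eventually_den_ne C (h.den_ne h')] with z hz hC
  have h1 : M.chartInv (C * A) p (mob C z) = M.chartInv A p z := by
    rw [chartInv, chartInv, mul_inv_rev, coe_mul_smul]
    congr 2
    rw [mob, ← smul_some_of_ne hC, coe_inv_smul_smul]
  have h2 := M.isFiniteAt_of_smul hz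
  have h3 := M.chart_eq_of_smul hz
  have h4 := h2.chartDeriv_mul (C := C) (by rwa [h3]) (v (M.chartInv A p z))
  rw [h3] at h4
  rw [coeff_eq, coeff_eq, h1]
  exact ((eq_inv_mul_iff_mul_eq₀ (pow_ne_zero _ hC)).1 h4).symm

theorem IsFiniteAt.canonicalLift_eq [IsManifold 𝓘(ℝ, ℂ) ∞ T] {M : GeomFiniteEnd Γ T}
    (hconf : M.IsConformal v) {A : SL(2, ℂ)} {p : T} (h : M.IsFiniteAt A p) :
    M.canonicalLift v p = pullback A (osculating (M.coeff v A p) (M.chart A p)) := by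
  have key : ∀ A₀ : SL(2, ℂ), M.IsFiniteAt A₀ p →
      pullback A₀ (osculating (M.coeff v A₀ p) (M.chart A₀ p)) =
        pullback A (osculating (M.coeff v A p) (M.chart A p)) := by
    intro A₀ h0
    have hC : A = (A * A₀⁻¹) * A₀ := by simp
    generalize A * A₀⁻¹ = C at hC
    subst hC
    have h1 := M.chart_eq_of_smul (h0.mul_smul_eq (h0.den_ne h))
    rw [osculating_transform C (h0.den_ne h) (by rw [← h1]; exact hconf p _ h)
      (h0.coeff_transform v h), pullback_mul, h1]
  unfold canonicalLift
  split_ifs with hinf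
  · refine key _ ?_
    rw [IsFiniteAt, hinf, smul_infty_of_ne (by simp [inversion])]
    exact OnePoint.coe_ne_infty _
  · refine key _ ?_
    rwa [IsFiniteAt, coe_one_smul]

theorem IsFiniteAt.eventually_coeff_eq [IsManifold 𝓘(ℝ, ℂ) ∞ T] {M : GeomFiniteEnd Γ T}
    {A : SL(2, ℂ)} {p : T} (h : M.IsFiniteAt A p) :
    ∀ᶠ q in 𝓝 p, M.IsFiniteAt A q ∧ M.coeff v A q =ᶠ[𝓝 (M.chart A q)] M.coeff v A p := by
  filter_upwards [h.contMDiffAt_chart_and.2,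
    (M.isLocalHomeoNear_devInf p).eventually_localInv_eq] with q hq hl
  refine ⟨hq, ?_⟩
  filter_upwards [hq.tendsto_inv_smul.eventually hl] with z hz
  have : M.chartInv A q z = M.chartInv A p z := hz
  rw [coeff_eq, coeff_eq, this]

theorem IsFiniteAt.eventually_canonicalLift_eq [IsManifold 𝓘(ℝ, ℂ) ∞ T] {M : GeomFiniteEnd Γ T}
    (hconf : M.IsConformal v) {A : SL(2, ℂ)} {p : T} (h : M.IsFiniteAt A p) :
    ∀ᶠ q in 𝓝 p, M.canonicalLift v q =
      pullback A (osculating (M.coeff v A p) (M.chart A q)) := by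
  filter_upwards [h.eventually_coeff_eq v] with q hq
  rw [hq.1.canonicalLift_eq v hconf, osculating_congr hq.2]

/-- The canonical lift is automorphic. -/
theorem canonicalLift_smul [IsManifold 𝓘(ℝ, ℂ) ∞ T] (M : GeomFiniteEnd Γ T)
    (hconf : M.IsConformal v) (haut : M.IsAutomorphic v) {γ : Γ} {B : SL(2, ℂ)}
    (hB : (B : Matrix.ProjectiveSpecialLinearGroup (Fin 2) ℂ) = M.hol γ) :
    ∃ c : ProjField, ∀ p : T, pullback B (M.canonicalLift v (γ • p)) = M.canonicalLift v p + c := by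
  obtain ⟨k, hk⟩ := haut γ
  -- The projective field k is read at γ • p; the holonomy carries it back to p.
  refine ⟨pullback B k, fun p => ?_⟩
  obtain ⟨A, h⟩ : ∃ A : SL(2, ℂ), M.IsFiniteAt A (γ • p) := by
    obtain ⟨A, α, β, m, n, hR⟩ := M.exists_rayChart (γ • p)
    exact ⟨A, M.isFiniteAt_of_smul (hR.endpoint _ hR.pos)⟩
  have hdev : ∀ q, (A : GL (Fin 2) ℂ) • M.devInf (γ • q) =
      ((A * B : SL(2, ℂ)) : GL (Fin 2) ℂ) • M.devInf q := fun q => by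
    rw [M.devInf_equivariant γ B hB, coe_mul_smul]
  have hchart : ∀ q, M.chart A (γ • q) = M.chart (A * B) q := fun q => by
    rw [chart, chart, hdev]
  have h' : M.IsFiniteAt (A * B) p := by rwa [IsFiniteAt, ← hdev]
  -- Equivariance of `devInf`: the local inverse at γ • p is the translate by γ of the one at p, in
  -- the chart moved by the holonomy.
  have hinv : ∀ᶠ z in 𝓝 (M.chart (A * B) p),
      M.chartInv A (γ • p) z = γ • M.chartInv (A * B) p z := by
    have hc : Filter.Tendsto (fun z => γ • M.chartInv (A * B) p z) (𝓝 (M.chart (A * B) p))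
        (𝓝 (γ • p)) := (M.smooth_smul γ).continuous.continuousAt.tendsto.comp h'.tendsto_chartInv
    filter_upwards [(M.isLocalHomeoNear_devInf (γ • p)).eventually_localInv_comp hc,
      h'.eventually_smul_chartInv] with z h1 h2
    rw [← h1, chartInv]
    congr 1
    rw [M.devInf_equivariant γ B hB, ← h2, coe_mul_smul, coe_inv_smul_smul]
  have hcoeff : M.coeff v A (γ • p) =ᶠ[𝓝 (M.chart (A * B) p)] fun z =>
      M.coeff v (A * B) p z + (pullback A⁻¹ k).eval z := by
    filter_upwards [hinv, h'.eventually_smul_chartInv] with z h1 h2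
    rw [coeff_eq, coeff_eq, h1]
    generalize M.chartInv (A * B) p z = q at *
    have h3 : (A : GL (Fin 2) ℂ) • M.devInf (γ • q) = (z : OnePoint ℂ) := by rw [hdev, h2]
    have h4 : M.chartDeriv A (γ • q)
        (v (γ • q) - mfderiv 𝓘(ℝ, ℂ) 𝓘(ℝ, ℂ) (fun q : T => γ • q) q (v q) : ℂ) =
        (pullback A⁻¹ k).eval (M.chart A (γ • q)) := hk q A (M.isFiniteAt_of_smul h3)
    rw [M.chart_eq_of_smul h3] at h4
    have h6 := (map_sub (M.chartDeriv A (γ • q)) (v (γ • q) : ℂ)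
      (mfderiv 𝓘(ℝ, ℂ) 𝓘(ℝ, ℂ) (fun q : T => γ • q) q (v q) : ℂ)).symm.trans h4
    have hs := ((M.isFiniteAt_of_smul h3).contMDiffAt_chart_and.1.mdifferentiableAt (by simp))
    have h5 : M.chartDeriv (A * B) q = (mfderiv 𝓘(ℝ, ℂ) 𝓘(ℝ, ℂ) (M.chart A) (γ • q)).comp
          (mfderiv 𝓘(ℝ, ℂ) 𝓘(ℝ, ℂ) (fun q : T => γ • q) q) := by
      rw [← mfderiv_comp q hs ((M.smooth_smul γ).mdifferentiableAt (by simp)), chartDeriv]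
      congr 1
      exact funext fun q => (hchart q).symm
    rw [h5]
    exact sub_eq_iff_eq_add'.1 h6
  have hw := hchart p
  rw [h.canonicalLift_eq v hconf, h'.canonicalLift_eq v hconf, ← pullback_mul, hw,
    osculating_congr hcoeff, osculating_add (hconf p _ h') ?_, osculating_eval, pullback_add,
    ← pullback_mul, inv_mul_cancel_left]
  exact ((contDiff_const.add (contDiff_const.mul contDiff_id)).add
    (contDiff_const.mul (contDiff_id.pow 2)) :
        ContDiff ℂ ω (pullback A⁻¹ k).eval).contDiffAt.analyticAt

end GeomFiniteEnd

namespace GeomFiniteEnd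

variable {Γ T : Type*} [Group Γ] [TopologicalSpace T] [ChartedSpace ℂ T] [MulAction Γ T]

/-! ### Local forms of the pulled back canonical lift -/

theorem exists_openPartialHomeomorph_dev (M : GeomFiniteEnd Γ T) {x : T × ℝ} (hx : 0 ≤ x.2) :
    ∃ e : OpenPartialHomeomorph (T × ℝ) Amb, x ∈ e.source ∧ Set.EqOn M.dev e e.source ∧
      ContMDiffOn 𝓘(ℝ, Amb) (𝓘(ℝ, ℂ).prod 𝓘(ℝ, ℝ)) ∞ e.symm e.target := by
  obtain ⟨Φ, hΦ, he⟩ := M.dev_localDiffeo ⟨x, ⟨trivial, hx⟩⟩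
  exact ⟨Φ.toOpenPartialHomeomorph, hΦ, he, Φ.contMDiffOn_invFun⟩

theorem isLocalHomeoNear_dev (M : GeomFiniteEnd Γ T) {x : T × ℝ} (hx : 0 ≤ x.2) :
    IsLocalHomeoNear M.dev x := by
  obtain ⟨e, hx, he, -⟩ := M.exists_openPartialHomeomorph_dev hx
  exact ⟨e, hx, he⟩

theorem continuousAt_dev (M : GeomFiniteEnd Γ T) {x : T × ℝ} (hx : 0 ≤ x.2) :
    ContinuousAt M.dev x := by
  obtain ⟨e, hx, he, -⟩ := M.exists_openPartialHomeomorph_dev hx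
  exact (e.continuousAt hx).congr (he.eventuallyEq_of_mem (e.open_source.mem_nhds hx)).symm

theorem exists_isFiniteAt [IsManifold 𝓘(ℝ, ℂ) ∞ T] (M : GeomFiniteEnd Γ T) (p : T) :
    ∃ A : SL(2, ℂ), M.IsFiniteAt A p := by
  obtain ⟨A, α, β, m, n, hR⟩ := M.exists_rayChart p
  exact ⟨A, M.isFiniteAt_of_smul (hR.endpoint _ hR.pos)⟩

variable [IsManifold 𝓘(ℝ, ℂ) ∞ T] {M : GeomFiniteEnd Γ T} {v : ∀ p : T, TangentSpace 𝓘(ℝ, ℂ) p}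

/-- Near `p` the canonical lift is given by the coefficient at `p`. -/
theorem IsFiniteAt.exists_lift_nhds (hconf : M.IsConformal v) {A : SL(2, ℂ)} {p : T}
    (h : M.IsFiniteAt A p) : ∃ V : Set T, IsOpen V ∧ p ∈ V ∧ ∀ q ∈ V, M.IsFiniteAt A q ∧
      AnalyticAt ℂ (M.coeff v A p) (M.chart A q) ∧
      M.canonicalLift v q = pullback A (osculating (M.coeff v A p) (M.chart A q)) := by
  obtain ⟨V, hV, hVo, hp⟩ := eventually_nhds_iff.1 (h.contMDiffAt_chart_and.2.and
    ((h.contMDiffAt_chart_and.1.continuousAt.eventually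
      (hconf p A h).eventually_analyticAt).and (h.eventually_canonicalLift_eq v hconf)))
  exact ⟨V, hVo, hp, hV⟩

/-- At a finite point no decay is at stake: on x.2 > 0 the coefficient κ is obtained by solving x.1
- x.2² κ = π. The local inverse of the developing map supplies a smooth π, also at the boundary
surface, since `dev` is a local diffeomorphism there. -/
theorem exists_localForm (hconf : M.IsConformal v) {x₀ : T × ℝ} (h0 : 0 ≤ x₀.2) :
    ∃ (A : SL(2, ℂ)) (O : Set Amb) (κ : Amb → ℂ) (f : ℂ → ℂ) (s : Amb → ProjField),
      LocalForm O κ f s ∧ hypAct A (M.dev x₀) ∈ O ∧ ∀ᶠ x in 𝓝 x₀,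
        M.germ (normalPullback (M.canonicalLift v)) x =ᶠ[𝓝 (M.dev x)]
          fun y => pullback A (s (hypAct A y)) := by
  obtain ⟨A, hA⟩ := M.exists_isFiniteAt x₀.1
  obtain ⟨V, hVo, hpV, hV⟩ := hA.exists_lift_nhds hconf
  obtain ⟨e, hxe, he, hes⟩ := M.exists_openPartialHomeomorph_dev h0
  have hpos0 : 0 < (M.dev x₀).2 := M.dev_pos x₀.1 x₀.2 h0
  set f := M.coeff v A x₀.1 with hf
  set g : Amb → T := fun y => (e.symm (hypAct A⁻¹ y)).1 with hg
  set π : Amb → ℂ := fun y => M.chart A (g y) with hπ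
  set P : Amb → Prop := fun y => 0 < y.2 ∧ hypAct A⁻¹ y ∈ e.target ∧ g y ∈ V with hP
  have hπs : ∀ y, P y → ContDiffAt ℝ ∞ π y := by
    rintro y ⟨hy, hye, hyV⟩
    have h1 : ContMDiffAt 𝓘(ℝ, Amb) 𝓘(ℝ, Amb) ∞ (hypAct A⁻¹) y :=
      (contDiffAt_hypAct A⁻¹ hy).contMDiffAt
    have h2 := (hes.contMDiffAt (e.open_target.mem_nhds hye)).comp y h1
    have h3 : ContMDiffAt 𝓘(ℝ, Amb) 𝓘(ℝ, ℂ) ∞ g y := h2.fst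
    exact ((hV _ hyV).1.contMDiffAt_chart_and.1.comp y h3).contDiffAt
  have hPe : ∀ᶠ y in 𝓝 (hypAct A (M.dev x₀)), P y := by
    have h1 : 0 < (hypAct A (M.dev x₀)).2 := hypAct_pos A hpos0
    have h2 := (contDiffAt_hypAct A⁻¹ h1).continuousAt
    have h3 : Filter.Tendsto (hypAct A⁻¹) (𝓝 (hypAct A (M.dev x₀))) (𝓝 (e x₀)) := by
      have := h2.tendsto
      rw [hypAct_inv A hpos0] at this
      rwa [← he hxe]
    filter_upwards [eventually_pos h1, h3 (e.open_target.mem_nhds (e.map_source hxe)),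
      (continuous_fst.continuousAt.tendsto.comp ((e.tendsto_symm hxe).comp h3))
        (hVo.mem_nhds hpV)] with y h1 h2 h3
    exact ⟨h1, h2, h3⟩
  have hproj : ∀ y : Amb, 0 < y.2 →
      y.1 - (y.2 : ℂ) ^ 2 * ((y.1 - π y) / (y.2 : ℂ) ^ 2) = π y := by
    intro y hy
    have : (y.2 : ℂ) ^ 2 ≠ 0 := pow_ne_zero _ (Complex.ofReal_ne_zero.2 hy.ne')
    rw [mul_div_cancel₀ _ this]
    ring
  refine ⟨A, interior {y | P y}, fun y => (y.1 - π y) / (y.2 : ℂ) ^ 2, f,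
    fun y => osculating f (π y), ⟨isOpen_interior, ?_, ?_, ?_⟩, mem_interior_iff_mem_nhds.2 hPe, ?_⟩
  · intro y hy
    have hPy : P y := interior_subset (s := {y | P y}) hy
    have h1 : ContDiffAt ℝ ∞ (fun y : Amb => (y.2 : ℂ)) y :=
      Complex.ofRealCLM.contDiff.contDiffAt.comp y contDiffAt_snd
    exact (contDiffAt_fst.sub (hπs y hPy)).mul
      ((h1.pow 2).inv (pow_ne_zero _ (Complex.ofReal_ne_zero.2 hPy.1.ne')))
  · intro y hy
    have hPy : P y := interior_subset (s := {y | P y}) hy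
    rw [hproj y hPy.1]
    exact (hV _ hPy.2.2).2.1
  · intro y hy
    have hPy : P y := interior_subset (s := {y | P y}) hy
    rw [hproj y hPy.1]
  · have hc : ContinuousAt M.dev x₀ := M.continuousAt_dev h0
    filter_upwards [e.open_source.mem_nhds hxe, hc.eventually (eventually_pos hpos0),
      continuous_fst.continuousAt (hVo.mem_nhds hpV)] with x hx hpos hxV
    have h1 := e.tendsto_symm hx
    have h2 : ∀ᶠ y in 𝓝 (M.dev x), (e.symm y).1 ∈ V := by
      rw [he hx]
      exact (continuous_fst.continuousAt.tendsto.comp h1) (hVo.mem_nhds hxV)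
    filter_upwards [localInv_eventuallyEq hx he, h2, eventually_pos hpos] with y h3 h4 h5
    rw [germ, Function.comp_apply, h3, normalPullback, (hV _ h4).2.2]
    simp only [hπ, hg, hypAct_inv A h5]

end GeomFiniteEnd

namespace GeomFiniteEnd

variable {Γ T : Type*} [Group Γ] [TopologicalSpace T] [ChartedSpace ℂ T] [MulAction Γ T]

/-! ### The developing map near infinity -/

/-- The moved developing map as a function of `(p, e⁻ᵗ)`. -/
def collar (α β : ℂ → ℝ) (m n : ℂ → ℂ) (z : ℂ × ℝ) : Amb :=
  ((α z.1 + β z.1 * z.2 ^ 2)⁻¹ • (m z.1 + (z.2 ^ 2) • n z.1), z.2 / (α z.1 + β z.1 * z.2 ^ 2))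

theorem contDiffAt_collar {α β : ℂ → ℝ} {m n : ℂ → ℂ} {z : ℂ × ℝ} (hα : ContDiffAt ℝ ∞ α z.1)
    (hβ : ContDiffAt ℝ ∞ β z.1) (hm : ContDiffAt ℝ ∞ m z.1) (hn : ContDiffAt ℝ ∞ n z.1)
    (h0 : α z.1 + β z.1 * z.2 ^ 2 ≠ 0) : ContDiffAt ℝ ∞ (collar α β m n) z := by
  have h1 : ContDiffAt ℝ ∞ (fun z : ℂ × ℝ => z.1) z := contDiffAt_fst
  have h2 : ContDiffAt ℝ ∞ (fun z : ℂ × ℝ => z.2) z := contDiffAt_snd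
  have hd : ContDiffAt ℝ ∞ (fun z : ℂ × ℝ => α z.1 + β z.1 * z.2 ^ 2) z :=
    (hα.comp z h1).add ((hβ.comp z h1).mul (h2.pow 2))
  exact ((hd.inv h0).smul ((hm.comp z h1).add ((h2.pow 2).smul (hn.comp z h1)))).prodMk
    (h2.div hd h0)

/-- The horizontal part is even in ε, so at ε = 0 the differential is block diagonal: the
differential of the endpoint m / α, and multiplication by α⁻¹. -/
theorem fderiv_collar_injective {α β : ℂ → ℝ} {m n : ℂ → ℂ} {w : ℂ} (hα : ContDiffAt ℝ ∞ α w)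
    (hβ : ContDiffAt ℝ ∞ β w) (hm : ContDiffAt ℝ ∞ m w) (hn : ContDiffAt ℝ ∞ n w) (h0 : 0 < α w)
    (hW : ∀ u : ℂ, fderiv ℝ (fun z => m z / (α z : ℂ)) w u = 0 → u = 0) :
    Function.Injective (fderiv ℝ (collar α β m n) (w, 0)) := by
  have hd := ((contDiffAt_collar (z := (w, 0)) hα hβ hm hn (by simpa using h0.ne')).differentiableAt
    (by simp)).hasFDerivAt
  set D := fderiv ℝ (collar α β m n) (w, 0)
  have h1 : HasFDerivAt (fun z : ℂ => (z, (0 : ℝ))) (ContinuousLinearMap.inl ℝ ℂ ℝ) w :=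
    hasFDerivAt_prodMk_left w 0
  have h2 : HasFDerivAt (fun ε : ℝ => (w, ε)) (ContinuousLinearMap.inr ℝ ℂ ℝ) 0 :=
    hasFDerivAt_prodMk_right w 0
  have e1 : ∀ u, D (u, 0) = (fderiv ℝ (fun z => m z / (α z : ℂ)) w u, 0) := by
    intro u
    have h3 := hd.comp w h1
    have h4 : collar α β m n ∘ (fun z : ℂ => (z, (0 : ℝ))) = fun z => (m z / (α z : ℂ), 0) := by
      ext1 z
      simp [collar, div_eq_inv_mul]
    rw [h4] at h3
    have hdiff : DifferentiableAt ℝ (fun z => m z / (α z : ℂ)) w := by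
      have : DifferentiableAt ℝ (fun z => (α z : ℂ)) w :=
        Complex.ofRealCLM.differentiableAt.comp w (hα.differentiableAt (by simp))
      exact (hm.differentiableAt (by simp)).mul
        (this.inv (Complex.ofReal_ne_zero.2 h0.ne'))
    have h5 := h3.unique (hdiff.hasFDerivAt.prodMk (hasFDerivAt_const (0 : ℝ) w))
    exact congrArg (fun L : ℂ →L[ℝ] Amb => L u) h5
  have e2 : D (0, 1) = (0, (α w)⁻¹) := by
    have h3 := (hd.comp (0 : ℝ) h2).hasDerivAt
    have h4 : HasDerivAt (fun ε : ℝ => α w + β w * ε ^ 2) 0 0 := by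
      simpa using (((hasDerivAt_id (0 : ℝ)).pow 2).const_mul (β w)).const_add (α w)
    have h5 : HasDerivAt (fun ε : ℝ => m w + (ε ^ 2) • n w) 0 0 := by
      simpa using ((((hasDerivAt_id (0 : ℝ)).pow 2)).smul_const (n w)).const_add (m w)
    have hne : α w + β w * (0 : ℝ) ^ 2 ≠ 0 := by simpa using h0.ne'
    have h6 := ((h4.fun_inv hne).smul h5).prodMk ((hasDerivAt_id (0 : ℝ)).div h4 hne)
    have h7 := h3.unique h6
    have h8 : α w ≠ 0 := h0.ne'
    have h9 : D (0, 1) = (D.comp (ContinuousLinearMap.inr ℝ ℂ ℝ)) 1 := by simp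
    rw [h9, h7]
    simp
    field_simp
  refine (injective_iff_map_eq_zero D).2 fun x hx => ?_
  have h3 : x = (x.1, 0) + x.2 • ((0, 1) : ℂ × ℝ) := by ext <;> simp
  rw [h3, map_add, map_smul, e1, e2] at hx
  have h4 := congrArg Prod.fst hx
  have h5 := congrArg Prod.snd hx
  simp [h0.ne'] at h4 h5
  exact Prod.ext (hW _ h4) h5

/-- The inverse function theorem with smoothness of the inverse on its whole domain. -/
theorem exists_openPartialHomeomorph {E : Type*} [NormedAddCommGroup E] [NormedSpace ℝ E]
    [FiniteDimensional ℝ E] {Ψ : E → E} {a : E} (hΨ : ∀ᶠ x in 𝓝 a, ContDiffAt ℝ ∞ Ψ x)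
    (hinj : Function.Injective (fderiv ℝ Ψ a)) :
    ∃ e : OpenPartialHomeomorph E E, a ∈ e.source ∧ (∀ x, e x = Ψ x) ∧
      ∀ᶠ x in 𝓝 a, ContDiffAt ℝ ∞ e.symm (e x) := by
  have : CompleteSpace E := FiniteDimensional.complete ℝ E
  let L : E ≃L[ℝ] E :=
    (LinearEquiv.ofInjectiveEndo (fderiv ℝ Ψ a).toLinearMap hinj).toContinuousLinearEquiv
  have hL : (L : E →L[ℝ] E) = fderiv ℝ Ψ a := by
    ext x
    rfl
  have ha := hΨ.self_of_nhds
  have hd : HasFDerivAt Ψ (L : E →L[ℝ] E) a := by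
    rw [hL]
    exact (ha.differentiableAt (by simp)).hasFDerivAt
  let e := ha.toOpenPartialHomeomorph Ψ hd (by simp)
  have hea : a ∈ e.source := ha.mem_toOpenPartialHomeomorph_source hd (by simp)
  refine ⟨e, hea, fun x => rfl, ?_⟩
  have h1 : ContinuousAt (fderiv ℝ Ψ) a := (ha.fderiv_right (m := 0) (by simp)).continuousAt
  have h2 : ∀ᶠ x in 𝓝 a, fderiv ℝ Ψ x ∈ Set.range ((↑) : (E ≃L[ℝ] E) → E →L[ℝ] E) := by
    refine h1.eventually ?_
    rw [← hL]
    exact ContinuousLinearEquiv.nhds L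
  filter_upwards [hΨ, h2, e.open_source.mem_nhds hea] with x h3 h4 h5
  obtain ⟨L', hL'⟩ := h4
  refine e.contDiffAt_symm (f₀' := L') (e.map_source h5) ?_ ?_
  · rw [hL', e.left_inv h5]
    exact (h3.differentiableAt (by simp)).hasFDerivAt
  · rw [e.left_inv h5]
    exact h3

end GeomFiniteEnd

/-! ### Local form of the lift up to the ideal boundary -/

namespace GeomFiniteEnd

variable {Γ T : Type*} [Group Γ] [TopologicalSpace T] [ChartedSpace ℂ T] [MulAction Γ T]
variable {M : GeomFiniteEnd Γ T} {v : ∀ p : T, TangentSpace 𝓘(ℝ, ℂ) p}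

theorem RayChart.hypAct_dev {A : SL(2, ℂ)} {p : T} {α β : T → ℝ} {m n : T → ℂ}
    (hR : M.RayChart A p α β m n) {q : T} (hq : q ∈ (chartAt ℂ p).source) {t : ℝ} (ht : 0 ≤ t) :
    0 < α q + β q * Real.exp (-t) ^ 2 ∧ hypAct A (M.dev (q, t)) =
      collar (α ∘ (chartAt ℂ p).symm) (β ∘ (chartAt ℂ p).symm) (m ∘ (chartAt ℂ p).symm)
        (n ∘ (chartAt ℂ p).symm) (chartAt ℂ p q, Real.exp (-t)) := by
  have h := eq_of_exp_combination (hypAct_pos A (M.dev_pos q t ht)) (hR.inv_snd q t ht)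
    (hR.fst q t ht)
  refine ⟨h.1, ?_⟩
  simp only [collar, Function.comp_apply, (chartAt ℂ p).left_inv hq]
  exact h.2

/-- The moved developing map is the collar map at (p, e⁻ᵗ), invertible near ε = 0. In the inverse
coordinates the endpoint and κ are smooth on a full neighbourhood `O` of the ideal point y₀,
including its boundary points. The same inverse shows that the developing map is injective far out
over a small piece of surface. -/
theorem exists_localForm_infty [IsManifold 𝓘(ℝ, ℂ) ∞ T] (hconf : M.IsConformal v) (p₀ : T) :
    ∃ (A : SL(2, ℂ)) (O : Set Amb) (κ : Amb → ℂ) (f : ℂ → ℂ) (s : Amb → ProjField) (y₀ : Amb),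
      LocalForm O κ f s ∧ y₀ ∈ O ∧
      Filter.Tendsto (fun x => hypAct A (M.dev x)) (𝓝 p₀ ×ˢ Filter.atTop) (𝓝 y₀) ∧
      (∀ᶠ x in 𝓝 p₀ ×ˢ Filter.atTop,
        M.germ (normalPullback (M.canonicalLift v)) x =ᶠ[𝓝 (M.dev x)]
          fun y => pullback A (s (hypAct A y))) ∧
      ∃ U ∈ 𝓝 p₀, ∃ t₁ : ℝ, 0 ≤ t₁ ∧ Set.InjOn M.dev (U ×ˢ Set.Ici t₁) := by
  obtain ⟨A, α, β, m, n, hR⟩ := M.exists_rayChart p₀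
  have hA : M.IsFiniteAt A p₀ := M.isFiniteAt_of_smul (hR.endpoint _ hR.pos)
  obtain ⟨V, hVo, hpV, hV⟩ := hA.exists_lift_nhds hconf
  set c := chartAt ℂ p₀ with hc
  have hp₀ : p₀ ∈ c.source := mem_chart_source ℂ p₀
  set f := M.coeff v A p₀
  set α' := α ∘ c.symm with hα'
  set β' := β ∘ c.symm with hβ'
  set m' := m ∘ c.symm with hm'
  set n' := n ∘ c.symm with hn'
  set Ψ := collar α' β' m' n' with hΨ
  have smooth : ∀ {F : Type} [NormedAddCommGroup F] [NormedSpace ℝ F] {g : T → F},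
      ContMDiff 𝓘(ℝ, ℂ) 𝓘(ℝ, F) ∞ g → ∀ z ∈ c.target, ContDiffAt ℝ ∞ (g ∘ c.symm) z := by
    intro F _ _ g hg z hz
    have := contDiffAt_of_contMDiffAt (p := p₀) (c.map_target hz) (hg _)
    rwa [← hc, c.right_inv hz] at this
  have sα := smooth hR.smooth_α
  have sβ := smooth hR.smooth_β
  have sm := smooth hR.smooth_m
  have sn := smooth hR.smooth_n
  set w := c p₀ with hw
  have hwt : w ∈ c.target := c.map_source hp₀
  have hsw : c.symm w = p₀ := c.left_inv hp₀
  have hαw : 0 < α' w := by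
    rw [hα', Function.comp_apply, hsw]
    exact hR.pos
  set P : ℂ × ℝ → Prop := fun z => z.1 ∈ c.target ∧ 0 < α' z.1 ∧ 0 < α' z.1 + β' z.1 * z.2 ^ 2 ∧
    c.symm z.1 ∈ V with hP
  have hPe : ∀ᶠ z in 𝓝 (w, (0 : ℝ)), P z := by
    have h1 : Filter.Tendsto (fun z : ℂ × ℝ => z.1) (𝓝 (w, 0)) (𝓝 w) :=
      continuous_fst.tendsto (w, (0 : ℝ))
    have hcα : ContinuousAt (fun z : ℂ × ℝ => α' z.1) (w, 0) :=
      (sα w hwt).continuousAt.comp (f := fun z : ℂ × ℝ => z.1) (x := (w, 0)) continuousAt_fst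
    have hcβ : ContinuousAt (fun z : ℂ × ℝ => β' z.1) (w, 0) :=
      (sβ w hwt).continuousAt.comp (f := fun z : ℂ × ℝ => z.1) (x := (w, 0)) continuousAt_fst
    have hcd : ContinuousAt (fun z : ℂ × ℝ => α' z.1 + β' z.1 * z.2 ^ 2) (w, 0) :=
      hcα.add (hcβ.mul (continuousAt_snd.pow 2))
    have hcV : Filter.Tendsto c.symm (𝓝 w) (𝓝 p₀) := c.tendsto_symm hp₀
    filter_upwards [h1 (c.open_target.mem_nhds hwt),
      continuousAt_const.eventually_lt hcα hαw,
      continuousAt_const.eventually_lt hcd (by simpa using hαw),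
      (hcV.comp h1) (hVo.mem_nhds hpV)] with z e1 e2 e3 e4
    exact ⟨e1, e2, e3, e4⟩
  have hΨs : ∀ᶠ z in 𝓝 (w, (0 : ℝ)), ContDiffAt ℝ ∞ Ψ z := by
    filter_upwards [hPe] with z hz
    exact contDiffAt_collar (sα _ hz.1) (sβ _ hz.1) (sm _ hz.1) (sn _ hz.1) hz.2.2.1.ne'
  obtain ⟨e, hae, heΨ, hes⟩ := exists_openPartialHomeomorph hΨs
    (fderiv_collar_injective (sα w hwt) (sβ w hwt) (sm w hwt) (sn w hwt) hαw hR.deriv)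
  obtain ⟨Q, hQ, hQo, hwQ⟩ := eventually_nhds_iff.1 (hPe.and hes)
  -- the endpoint and its defect in the coordinates of the collar
  set π : Amb → ℂ := fun y => m' (e.symm y).1 / (α' (e.symm y).1 : ℂ) with hπ
  set κ : Amb → ℂ := fun y => (n' (e.symm y).1 * (α' (e.symm y).1 : ℂ) -
    m' (e.symm y).1 * (β' (e.symm y).1 : ℂ)) *
    ((α' (e.symm y).1 + β' (e.symm y).1 * (e.symm y).2 ^ 2 : ℝ) : ℂ) / (α' (e.symm y).1 : ℂ) with hκ
  set O : Set Amb := e.target ∩ e.symm ⁻¹' Q with hO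
  have hOo : IsOpen O := e.symm.isOpen_inter_preimage hQo
  -- The choice of κ: with δ = α + βε² one has y.1 - π = ε² (nα - mβ) / (αδ) and y.2² = ε² / δ². In
  -- the quotient (nα - mβ) δ / α the powers of ε cancel, so κ needs no division by y.2.
  have hproj : ∀ y ∈ O, y.1 - (y.2 : ℂ) ^ 2 * κ y = π y := by
    rintro y ⟨hy, hyQ⟩
    obtain ⟨⟨-, h1, h2, -⟩, -⟩ := hQ _ hyQ
    have h3 : Ψ (e.symm y) = y := by rw [← heΨ, e.right_inv hy]
    rw [hκ, hπ]
    simp only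
    generalize e.symm y = z at *
    rw [← h3, hΨ]
    simp only [collar]
    have h1' : (α' z.1 : ℂ) ≠ 0 := Complex.ofReal_ne_zero.2 h1.ne'
    have h2' : (α' z.1 : ℂ) + β' z.1 * (z.2 : ℂ) ^ 2 ≠ 0 := by exact_mod_cast h2.ne'
    simp only [Complex.real_smul]
    push_cast
    field_simp
    ring
  have hchart : ∀ z : ℂ × ℝ, P z → m' z.1 / (α' z.1 : ℂ) = M.chart A (c.symm z.1) := by
    intro z hz
    exact (M.chart_eq_of_smul (hR.endpoint _ hz.2.1)).symm
  have hform : LocalForm O κ f (fun y => osculating f (π y)) := by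
    refine ⟨hOo, ?_, ?_, ?_⟩
    · rintro y ⟨hy, hyQ⟩
      obtain ⟨⟨h0, h1, h2, -⟩, h3⟩ := hQ _ hyQ
      rw [e.right_inv hy] at h3
      have g1 : ContDiffAt ℝ ∞ (fun y => (e.symm y).1) y := contDiffAt_fst.comp y h3
      have g2 : ContDiffAt ℝ ∞ (fun y => (e.symm y).2) y := contDiffAt_snd.comp y h3
      have a1 := (sα _ h0).comp y g1
      have a2 := (sβ _ h0).comp y g1
      have a3 := (sm _ h0).comp y g1
      have a4 := (sn _ h0).comp y g1
      have b1 : ContDiffAt ℝ ∞ (fun y => (α' (e.symm y).1 : ℂ)) y :=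
        Complex.ofRealCLM.contDiff.contDiffAt.comp y a1
      have b2 : ContDiffAt ℝ ∞ (fun y => (β' (e.symm y).1 : ℂ)) y :=
        Complex.ofRealCLM.contDiff.contDiffAt.comp y a2
      have b3 : ContDiffAt ℝ ∞
          (fun y => ((α' (e.symm y).1 + β' (e.symm y).1 * (e.symm y).2 ^ 2 : ℝ) : ℂ)) y :=
        Complex.ofRealCLM.contDiff.contDiffAt.comp y (a1.add (a2.mul (g2.pow 2)))
      exact (((a4.mul b1).sub (a3.mul b2)).mul b3).mul
        (b1.inv (Complex.ofReal_ne_zero.2 h1.ne'))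
    · intro y hy
      rw [hproj y hy]
      have hz := (hQ _ hy.2).1
      rw [hπ]
      simp only
      rw [hchart _ hz]
      exact (hV _ hz.2.2.2).2.1
    · intro y hy
      rw [hproj y hy]
  have hw0 : e.symm (Ψ (w, 0)) = (w, 0) := by rw [← heΨ, e.left_inv hae]
  have hlim : Filter.Tendsto (fun x : T × ℝ => (c x.1, Real.exp (-x.2)))
      (𝓝 p₀ ×ˢ Filter.atTop) (𝓝 (w, 0)) := by
    rw [nhds_prod_eq]
    exact (c.continuousAt hp₀).tendsto.prodMap Real.tendsto_exp_neg_atTop_nhds_zero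
  have hdev : ∀ᶠ x in 𝓝 p₀ ×ˢ Filter.atTop, x.1 ∈ c.source ∧ 0 ≤ x.2 ∧
      hypAct A (M.dev x) = Ψ (c x.1, Real.exp (-x.2)) := by
    filter_upwards [(c.open_source.eventually_mem hp₀).prod_mk
      (Filter.eventually_ge_atTop (0 : ℝ))] with x hx
    exact ⟨hx.1, hx.2, (hR.hypAct_dev hx.1 hx.2).2⟩
  have hgood : ∀ᶠ x in 𝓝 p₀ ×ˢ Filter.atTop, x.1 ∈ c.source ∧ 0 ≤ x.2 ∧
      hypAct A (M.dev x) = Ψ (c x.1, Real.exp (-x.2)) ∧ (c x.1, Real.exp (-x.2)) ∈ Q ∧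
      (c x.1, Real.exp (-x.2)) ∈ e.source := by
    filter_upwards [hdev, hlim (hQo.mem_nhds hwQ), hlim (e.open_source.mem_nhds hae)]
      with x h1 h2 h3
    exact ⟨h1.1, h1.2.1, h1.2.2, h2, h3⟩
  obtain ⟨pa, ha, pb, hb, hab⟩ := Filter.eventually_prod_iff.1 hgood
  obtain ⟨U, hU, hUo, hpU⟩ := eventually_nhds_iff.1 ha
  obtain ⟨t₁, ht₁⟩ := Filter.eventually_atTop.1 hb
  have hall : ∀ p ∈ U, ∀ t, t₁ ≤ t → _ := fun p hp t ht => hab (hU p hp) (ht₁ t ht)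
  have hinv : ∀ p ∈ U, ∀ t, t₁ ≤ t →
      e.symm (hypAct A (M.dev (p, t))) = (c p, Real.exp (-t)) := fun p hp t ht => by
    obtain ⟨-, -, h3, -, h5⟩ := hall p hp t ht
    rw [h3, ← heΨ, e.left_inv h5]
  refine ⟨A, O, κ, f, _, Ψ (w, 0), hform, ?_, ?_, ?_, U, hUo.mem_nhds hpU, max t₁ 0,
    le_max_right _ _, ?_⟩
  · refine ⟨?_, ?_⟩
    · rw [← heΨ]
      exact e.map_source hae
    · rw [Set.mem_preimage, hw0]
      exact hwQ
  · refine ((hΨs.self_of_nhds.continuousAt.tendsto).comp hlim).congr' ?_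
    exact hdev.mono fun x hx => hx.2.2.symm
  -- The inequality is strict so that the local inverse near `M.dev x` still takes its values at
  -- times beyond t₁, where the collar formula holds.
  · filter_upwards [(hUo.eventually_mem hpU).prod_mk
      (Filter.eventually_gt_atTop (max t₁ 0))] with x hx
    obtain ⟨hxU, hxt⟩ := hx
    have h0 : 0 ≤ x.2 := (le_max_right _ _).trans hxt.le
    have hloc := M.isLocalHomeoNear_dev h0
    have hlim' := hloc.tendsto_localInv
    have g1 := (continuous_fst.tendsto x).comp hlim'
    have g2 := (continuous_snd.tendsto x).comp hlim'
    filter_upwards [hloc.eventually_right_inv, g1 (hUo.mem_nhds hxU),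
      g2 (lt_mem_nhds hxt)] with y e1 e2 e3
    rw [germ, Function.comp_apply, normalPullback]
    replace e2 : (localInv M.dev x y).1 ∈ U := e2
    replace e3 : max t₁ 0 < (localInv M.dev x y).2 := e3
    generalize localInv M.dev x y = x' at *
    replace e3 : t₁ ≤ x'.2 := (le_max_left _ _).trans e3.le
    have e4 := hinv x'.1 e2 x'.2 e3
    rw [← e1]
    obtain ⟨f1, -, -, f4, -⟩ := hall x'.1 e2 x'.2 e3
    have e4 : e.symm (hypAct A (M.dev x')) = (c x'.1, Real.exp (-x'.2)) := e4
    have hPz := (hQ _ f4).1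
    have f5 : c.symm (c x'.1) = x'.1 := c.left_inv f1
    have f6 := hPz.2.2.2
    simp only [f5] at f6
    rw [(hV _ f6).2.2, hπ]
    simp only
    rw [e4, hchart _ hPz]
    simp only [f5]
  -- The inverse collar map recovers both the chart coordinate of p and e⁻ᵗ from the developed
  -- point.
  · rintro ⟨p, t⟩ ⟨hp, ht⟩ ⟨p', t'⟩ ⟨hp', ht'⟩ heq
    have h1 := hinv p hp t ((le_max_left _ _).trans ht)
    have h2 := hinv p' hp' t' ((le_max_left _ _).trans ht')
    rw [heq, h2] at h1
    have h3 := congrArg Prod.fst h1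
    have h4 := congrArg Prod.snd h1
    have h5 := (hall p hp t ((le_max_left _ _).trans ht)).1
    have h6 := (hall p' hp' t' ((le_max_left _ _).trans ht')).1
    refine Prod.ext (c.injOn h5 h6 h3.symm) ?_
    exact (neg_injective (Real.exp_injective h4)).symm

end GeomFiniteEnd

namespace GeomFiniteEnd

variable {Γ T : Type*} [Group Γ] [TopologicalSpace T] [ChartedSpace ℂ T] [MulAction Γ T]

/-! ### Pointwise norms of derivatives of the pulled back canonical lift -/

/-- The pointwise norm on the end given by a norm of derivatives of sections over hyperbolic
space. -/
def normOn (M : GeomFiniteEnd Γ T) (N : (Amb → ProjField) → Amb → ℝ) (s : T × ℝ → ProjField)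
    (x : T × ℝ) : ℝ :=
  N (M.germ s x) (M.dev x)

/-- A set on which the developing map is injective with bounded image after the motion `A`, and on
which the norm is small near the boundary of hyperbolic space. -/
def IsTame (M : GeomFiniteEnd Γ T) (n : T × ℝ → ℝ) (E : Set (T × ℝ)) : Prop :=
  Set.InjOn M.dev E ∧ ∃ (A : SL(2, ℂ)) (C : ℝ) (y₀ : Amb), 0 ≤ C ∧ ∀ x ∈ E, 0 < (M.dev x).2 ∧
    hypAct A (M.dev x) ∈ Metric.closedBall y₀ 1 ∧ |n x| ≤ C * (hypAct A (M.dev x)).2 ^ 2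

/-- Continuity of G at the limit bounds it by |G y₀| + 1. The filter is arbitrary so that finite
points and the ideal boundary are treated together. -/
theorem isTame_of_tendsto {M : GeomFiniteEnd Γ T} {n : T × ℝ → ℝ} {l : Filter (T × ℝ)} {E :
    Set (T × ℝ)} (hE : E ∈ l)
    (hinj : Set.InjOn M.dev E) {A : SL(2, ℂ)} {G : Amb → ℝ} {y₀ : Amb} (hG : ContinuousAt G y₀)
    (hlim : Filter.Tendsto (fun x => hypAct A (M.dev x)) l (𝓝 y₀))
    (hev : ∀ᶠ x in l, 0 < (M.dev x).2 ∧
      n x = (hypAct A (M.dev x)).2 ^ 2 * G (hypAct A (M.dev x))) :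
    ∃ E' ∈ l, M.IsTame n E' := by
  have h1 : ∀ᶠ x in l, |G (hypAct A (M.dev x))| < |G y₀| + 1 :=
    (hG.abs.tendsto.comp hlim).eventually (gt_mem_nhds (lt_add_one _))
  have h2 : ∀ᶠ x in l, hypAct A (M.dev x) ∈ Metric.closedBall y₀ 1 :=
    hlim (Metric.closedBall_mem_nhds y₀ one_pos)
  refine ⟨_, Filter.inter_mem hE (hev.and (h1.and h2)),
    hinj.mono Set.inter_subset_left, A, |G y₀| + 1, y₀, by positivity, ?_⟩
  rintro x ⟨-, ⟨h3, h4⟩, h5, h6⟩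
  refine ⟨h3, h6, ?_⟩
  rw [h4, abs_mul, abs_of_nonneg (sq_nonneg _), mul_comm]
  exact mul_le_mul_of_nonneg_right h5.le (sq_nonneg _)

theorem exists_hol_lift (M : GeomFiniteEnd Γ T) (γ : Γ) :
    ∃ B : SL(2, ℂ), (B : Matrix.ProjectiveSpecialLinearGroup (Fin 2) ℂ) = M.hol γ :=
  QuotientGroup.mk_surjective (M.hol γ)

variable [IsManifold 𝓘(ℝ, ℂ) ∞ T] {M : GeomFiniteEnd Γ T} {v : ∀ p : T, TangentSpace 𝓘(ℝ, ℂ) p}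

theorem isSmoothSection (hconf : M.IsConformal v) :
    M.IsSmoothSection (normalPullback (M.canonicalLift v)) := by
  intro x hx
  obtain ⟨A, O, κ, f, s, hL, hO, hev⟩ := exists_localForm hconf hx
  have hpos := M.dev_pos x.1 x.2 hx
  refine ContDiffAt.congr_of_eventuallyEq ?_ hev.self_of_nhds
  have h1 := (hL.contDiffAt hO).comp (M.dev x) (contDiffAt_hypAct A hpos)
  exact ((pullbackLin A).restrictScalars ℝ).contDiff.contDiffAt.comp (M.dev x) h1

variable {N : (Amb → ProjField) → Amb → ℝ}

theorem _root_.HypEnd.IsAdapted.eq_of_eventuallyEq (hN : IsAdapted N) {σ s : Amb → ProjField}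
    {A : SL(2, ℂ)} {y : Amb} (hy : 0 < y.2) (hs : ContDiffAt ℝ ∞ s (hypAct A y))
    (h : σ =ᶠ[𝓝 y] fun y => pullback A (s (hypAct A y))) : N σ y = N s (hypAct A y) := by
  rw [hN.congr h, ← hN.transform A 0 hy hs]
  simp only [add_zero]

/-- Local estimates near finite points. -/
theorem exists_eq_sq_mul (hN : IsAdapted N) (hconf : M.IsConformal v) {x₀ : T × ℝ}
    (h0 : 0 ≤ x₀.2) : ∃ (A : SL(2, ℂ)) (G : Amb → ℝ), ContinuousAt G (hypAct A (M.dev x₀)) ∧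
      ContinuousAt (fun x => hypAct A (M.dev x)) x₀ ∧ ∀ᶠ x in 𝓝 x₀,
        0 < (M.dev x).2 ∧ M.normOn N (normalPullback (M.canonicalLift v)) x =
          (hypAct A (M.dev x)).2 ^ 2 * G (hypAct A (M.dev x)) := by
  obtain ⟨A, O, κ, f, s, hL, hO, hev⟩ := exists_localForm hconf h0
  obtain ⟨G, hG, hGe⟩ := hN.local_form hL
  have hpos := M.dev_pos x₀.1 x₀.2 h0
  have hc := M.continuousAt_dev h0
  have hcA : ContinuousAt (fun x => hypAct A (M.dev x)) x₀ :=
    (contDiffAt_hypAct A hpos).continuousAt.comp hc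
  refine ⟨A, G, hG.continuousAt (hL.isOpen.mem_nhds hO), hcA, ?_⟩
  filter_upwards [hev, hc.eventually (eventually_pos hpos), hcA (hL.isOpen.mem_nhds hO)]
    with x h1 h2 h3
  refine ⟨h2, ?_⟩
  rw [normOn, hN.eq_of_eventuallyEq h2 (hL.contDiffAt h3) h1, hGe _ h3 (hypAct_pos A h2)]

theorem continuousAt_normOn (hN : IsAdapted N) (hconf : M.IsConformal v) {x₀ : T × ℝ}
    (h0 : 0 ≤ x₀.2) :
    ContinuousAt (M.normOn N (normalPullback (M.canonicalLift v))) x₀ := by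
  obtain ⟨A, G, hG, hc, hev⟩ := exists_eq_sq_mul hN hconf h0
  have h1 : ContinuousAt (fun x => (hypAct A (M.dev x)).2 ^ 2 * G (hypAct A (M.dev x))) x₀ :=
    ((continuousAt_snd.comp hc).pow 2).mul (ContinuousAt.comp (f := fun x =>
        hypAct A (M.dev x)) hG hc)
  exact h1.congr (hev.mono fun x hx => hx.2.symm)

theorem exists_isTame_nhds (hN : IsAdapted N) (hconf : M.IsConformal v) {x₀ : T × ℝ}
    (h0 : 0 ≤ x₀.2) :
    ∃ E ∈ 𝓝 x₀, M.IsTame (M.normOn N (normalPullback (M.canonicalLift v))) E := by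
  obtain ⟨A, G, hG, hc, hev⟩ := exists_eq_sq_mul hN hconf h0
  obtain ⟨e, hx, he⟩ := M.isLocalHomeoNear_dev h0
  exact isTame_of_tendsto (e.open_source.mem_nhds hx) (e.injOn.congr he.symm) hG hc.tendsto hev

theorem exists_isTame_infty (hN : IsAdapted N) (hconf : M.IsConformal v) (p₀ : T) :
    ∃ E ∈ 𝓝 p₀ ×ˢ Filter.atTop,
      M.IsTame (M.normOn N (normalPullback (M.canonicalLift v))) E := by
  obtain ⟨A, O, κ, f, s, y₀, hL, hO, hlim, hev, U, hU, t₁, -, hinj⟩ :=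
    exists_localForm_infty hconf p₀
  obtain ⟨G, hG, hGe⟩ := hN.local_form hL
  refine isTame_of_tendsto (Filter.prod_mem_prod hU (Filter.Ici_mem_atTop t₁)) hinj
    (hG.continuousAt (hL.isOpen.mem_nhds hO)) hlim ?_
  have hge : ∀ᶠ x : T × ℝ in 𝓝 p₀ ×ˢ Filter.atTop, 0 ≤ x.2 :=
    Filter.tendsto_snd (Filter.eventually_ge_atTop 0)
  filter_upwards [hev, hge, hlim (hL.isOpen.mem_nhds hO)] with x h1 h2 h3
  have hpos := M.dev_pos x.1 x.2 h2
  refine ⟨hpos, ?_⟩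
  rw [normOn, hN.eq_of_eventuallyEq hpos (hL.contDiffAt h3) h1, hGe _ h3 (hypAct_pos A hpos)]

/-! ### Invariance -/

/-- Positivity of t keeps the local inverse at positive times; equivariance of `dev` is only known
for nonnegative ones. -/
theorem germ_smul (hconf : M.IsConformal v) (haut : M.IsAutomorphic v) {γ : Γ} {B : SL(2, ℂ)}
    (hB : (B : Matrix.ProjectiveSpecialLinearGroup (Fin 2) ℂ) = M.hol γ) {p : T} {t : ℝ}
    (ht : 0 < t) : ∃ c : ProjField,
      M.germ (normalPullback (M.canonicalLift v)) (p, t) =ᶠ[𝓝 (M.dev (p, t))] fun y =>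
        pullback B (M.germ (normalPullback (M.canonicalLift v)) (γ • p, t) (hypAct B y)) + c := by
  obtain ⟨c, hc⟩ := M.canonicalLift_smul v hconf haut hB
  refine ⟨-c, ?_⟩
  have hloc := M.isLocalHomeoNear_dev (x := (p, t)) ht.le
  have hloc' := M.isLocalHomeoNear_dev (x := (γ • p, t)) ht.le
  have hlim := hloc.tendsto_localInv
  have hlim' : Filter.Tendsto (fun y => (γ • (localInv M.dev (p, t) y).1,
      (localInv M.dev (p, t) y).2)) (𝓝 (M.dev (p, t))) (𝓝 (γ • p, t)) :=
    (((M.smooth_smul γ).continuous.comp continuous_fst).prodMk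
        continuous_snd).continuousAt.tendsto.comp
      hlim
  have hpos : ∀ᶠ y in 𝓝 (M.dev (p, t)), 0 < (localInv M.dev (p, t) y).2 :=
    (continuous_snd.continuousAt.tendsto.comp hlim).eventually (lt_mem_nhds ht)
  filter_upwards [hloc'.eventually_localInv_comp hlim', hloc.eventually_right_inv, hpos]
    with y h1 h2 h3
  rw [M.dev_equivariant γ B hB _ _ h3.le, Prod.mk.eta, h2] at h1
  simp only [germ, Function.comp_apply, normalPullback, h1, hc]
  simp

/-- For positive times this is `germ_smul` and the invariance of adapted norms. At time 0 the
identity follows by letting the time decrease to 0, as the norm is continuous up to the boundary. -/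
theorem normOn_smul (hN : IsAdapted N) (hconf : M.IsConformal v) (haut : M.IsAutomorphic v)
    (γ : Γ) (p : T) {t : ℝ} (ht : 0 ≤ t) :
    M.normOn N (normalPullback (M.canonicalLift v)) (γ • p, t) =
      M.normOn N (normalPullback (M.canonicalLift v)) (p, t) := by
  obtain ⟨B, hB⟩ := M.exists_hol_lift γ
  have main : ∀ r, 0 < r → M.normOn N (normalPullback (M.canonicalLift v)) (γ • p, r) =
      M.normOn N (normalPullback (M.canonicalLift v)) (p, r) := by
    intro r hr
    obtain ⟨c, hc⟩ := germ_smul hconf haut hB (p := p) hr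
    have he := M.dev_equivariant γ B hB p r hr.le
    have hs := isSmoothSection hconf (γ • p, r) hr.le
    rw [normOn, normOn, hN.congr hc, he]
    rw [he] at hs
    exact (hN.transform B c (M.dev_pos p r hr.le) hs).symm
  rcases ht.eq_or_lt with rfl | ht
  · have h1 : ∀ q : T, Filter.Tendsto
        (fun r : ℝ => M.normOn N (normalPullback (M.canonicalLift v)) (q, r)) (𝓝[>] 0)
        (𝓝 (M.normOn N (normalPullback (M.canonicalLift v)) (q, 0))) := fun q => by
      have h2 := continuousAt_normOn hN hconf (x₀ := (q, 0)) le_rfl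
      have h3 : ContinuousAt (fun r : ℝ => (q, r)) 0 := by fun_prop
      exact (ContinuousAt.comp (f := fun r : ℝ => (q, r)) h2 h3).tendsto.mono_left
        nhdsWithin_le_nhds
    refine tendsto_nhds_unique (h1 (γ • p)) ((h1 p).congr' ?_)
    filter_upwards [self_mem_nhdsWithin] with r hr
    exact (main r hr).symm
  · exact main t ht

end GeomFiniteEnd

open MeasureTheory

/-! ### Sums over the fibres of a map -/

section FibreSum

variable {X Y : Type*} (d : X → Y) (φ : X → ENNReal)

/-- The sum of `φ` over the points of `E` in the fibre of `d` over `y`. -/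
def fibreSum (E : Set X) (y : Y) : ENNReal := ∑' x, (E ∩ d ⁻¹' {y}).indicator φ x

variable {d φ}

theorem fibreSum_mono {E E' : Set X} (h : E ⊆ E') (y : Y) :
    fibreSum d φ E y ≤ fibreSum d φ E' y :=
  ENNReal.tsum_le_tsum fun x => Set.indicator_le_indicator_of_subset
    (Set.inter_subset_inter_left _ h) (fun _ => zero_le) x

theorem fibreSum_union_le (E E' : Set X) (y : Y) :
    fibreSum d φ (E ∪ E') y ≤ fibreSum d φ E y + fibreSum d φ E' y := by
  rw [fibreSum, fibreSum, fibreSum, ← ENNReal.tsum_add]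
  refine ENNReal.tsum_le_tsum fun x => ?_
  rw [Set.union_inter_distrib_right]
  by_cases h : x ∈ E ∩ d ⁻¹' {y} <;> by_cases h' : x ∈ E' ∩ d ⁻¹' {y} <;>
    simp [Set.indicator, h, h', -Set.mem_inter_iff, -Set.mem_preimage]

theorem fibreSum_iUnion {E : ℕ → Set X} (h : Pairwise (Function.onFun Disjoint E)) (y : Y) :
    fibreSum d φ (⋃ i, E i) y = ∑' i, fibreSum d φ (E i) y := by
  simp only [fibreSum]
  rw [ENNReal.tsum_comm]
  refine tsum_congr fun x => ?_
  rw [Set.iUnion_inter]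
  by_cases hx : x ∈ ⋃ i, E i ∩ d ⁻¹' {y}
  · obtain ⟨i, hi⟩ := Set.mem_iUnion.1 hx
    rw [Set.indicator_of_mem hx, tsum_eq_single i, Set.indicator_of_mem hi]
    intro j hj
    exact Set.indicator_of_notMem (fun hxj => Set.disjoint_left.1 (h hj) hxj.1 hi.1) _
  · rw [Set.indicator_of_notMem hx, eq_comm, ENNReal.tsum_eq_zero]
    exact fun i => Set.indicator_of_notMem (fun hi => hx (Set.mem_iUnion.2 ⟨i, hi⟩)) _

theorem fibreSum_of_injOn {E : Set X} (h : Set.InjOn d E) {x : X} (hx : x ∈ E) :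
    fibreSum d φ E (d x) = φ x := by
  rw [fibreSum, tsum_eq_single x]
  · exact Set.indicator_of_mem (by exact ⟨hx, rfl⟩) _
  · intro x' hx'
    refine Set.indicator_of_notMem ?_ _
    rintro ⟨h1, h2⟩
    exact hx' (h h1 hx h2)

theorem fibreSum_of_notMem {E : Set X} {y : Y} (h : ∀ x ∈ E, d x ≠ y) : fibreSum d φ E y = 0 := by
  rw [fibreSum, ENNReal.tsum_eq_zero]
  exact fun x => Set.indicator_of_notMem (fun hx => h x hx.1 hx.2) _

/-- `fibreSum d φ E` is bounded by an integrable function. -/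
def HasFiniteFibreSum [MeasurableSpace Y] (μ : Measure Y) (d : X → Y) (φ : X → ENNReal)
    (E : Set X) : Prop :=
  ∃ F : Y → ENNReal, Measurable F ∧ (∀ y, fibreSum d φ E y ≤ F y) ∧ ∫⁻ y, F y ∂μ < ⊤

variable [MeasurableSpace Y] {μ : Measure Y}

theorem HasFiniteFibreSum.mono {E E' : Set X} (h : HasFiniteFibreSum μ d φ E') (hE : E ⊆ E') :
    HasFiniteFibreSum μ d φ E := by
  obtain ⟨F, hF, hle, hfin⟩ := h
  exact ⟨F, hF, fun y => (fibreSum_mono hE y).trans (hle y), hfin⟩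

theorem HasFiniteFibreSum.empty : HasFiniteFibreSum μ d φ (∅ : Set X) :=
  ⟨0, measurable_const, fun y => by rw [fibreSum_of_notMem (by simp)]; exact zero_le, by simp⟩

/-- Working with measurable majorants makes this valid for arbitrary sets, whose fibre sums need not
be measurable. -/
theorem HasFiniteFibreSum.union {E E' : Set X} (h : HasFiniteFibreSum μ d φ E)
    (h' : HasFiniteFibreSum μ d φ E') : HasFiniteFibreSum μ d φ (E ∪ E') := by
  obtain ⟨F, hF, hle, hfin⟩ := h
  obtain ⟨F', hF', hle', hfin'⟩ := h'
  refine ⟨F + F', hF.add hF', fun y => (fibreSum_union_le E E' y).trans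
    (add_le_add (hle y) (hle' y)), ?_⟩
  simp only [Pi.add_apply]
  rw [lintegral_add_left hF]
  exact ENNReal.add_lt_top.2 ⟨hfin, hfin'⟩

/-- Sums over the fibres of a map that is a local homeomorphism on `E` are measurable. -/
theorem measurable_fibreSum [TopologicalSpace X] [SecondCountableTopology X] [MeasurableSpace X]
    [BorelSpace X] [TopologicalSpace Y] [BorelSpace Y] {E : Set X} (hE : MeasurableSet E)
    (hφ : Measurable (E.indicator φ)) (hd : ∀ x ∈ E, IsLocalHomeoNear d x) :
    Measurable (fibreSum d φ E) := by
  rcases E.eq_empty_or_nonempty with rfl | hne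
  · have : fibreSum d φ ∅ = 0 := funext fun y => fibreSum_of_notMem (by simp)
    rw [this]
    exact measurable_const
  have : Nonempty (OpenPartialHomeomorph X Y) := ⟨(hd _ hne.some_mem).choose⟩
  choose! e hxe he using hd
  obtain ⟨c, hcE, hc, hcov⟩ := TopologicalSpace.countable_cover_nhdsWithin (s := E)
    (f := fun x => (e x).source)
    (fun x hx => mem_nhdsWithin_of_mem_nhds ((e x).open_source.mem_nhds (hxe x hx)))
  have hcne : c.Nonempty := by
    obtain ⟨x, hx⟩ := hne
    obtain ⟨y, hy, -⟩ := Set.mem_iUnion₂.1 (hcov hx)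
    exact ⟨y, hy⟩
  obtain ⟨u, rfl⟩ := hc.exists_eq_range hcne
  have hu : ∀ i, u i ∈ E := fun i => hcE ⟨i, rfl⟩
  -- Countably many disjoint pieces, on each of which d is injective; there the fibre sum is φ
  -- composed with the inverse homeomorphism.
  set D : ℕ → Set X := fun i => E ∩ disjointed (fun i => (e (u i)).source) i with hD
  have hDm : ∀ i, MeasurableSet (D i) := fun i =>
    hE.inter (MeasurableSet.disjointed (fun i => (e (u i)).open_source.measurableSet) i)
  have hDU : E = ⋃ i, D i := by
    rw [← Set.inter_iUnion, iUnion_disjointed, eq_comm, Set.inter_eq_left]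
    simpa using hcov
  have hDd : Pairwise (Function.onFun Disjoint D) := fun i j hij =>
    (disjoint_disjointed _ hij).mono Set.inter_subset_right Set.inter_subset_right
  have hsum : fibreSum d φ E = fun y => ∑' i, fibreSum d φ (D i) y := by
    ext1 y
    rw [← fibreSum_iUnion hDd, ← hDU]
  rw [hsum]
  refine Measurable.tsum fun i => ?_
  have hDs : D i ⊆ (e (u i)).source := Set.inter_subset_right.trans (disjointed_subset _ i)
  have hDE : D i ⊆ E := Set.inter_subset_left
  have hφi : Measurable ((D i).indicator φ) := by
    have := hφ.indicator (hDm i)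
    rwa [Set.indicator_indicator, Set.inter_eq_left.2 hDE] at this
  have hdi := he (u i) (hu i)
  generalize e (u i) = ei at *
  have hval : ∀ y ∈ ei.target, fibreSum d φ (D i) y = (D i).indicator φ (ei.symm y) := by
    intro y hy
    by_cases h : ei.symm y ∈ D i
    · have h1 := fibreSum_of_injOn (φ := φ) ((ei.injOn.congr hdi.symm).mono hDs) h
      rwa [hdi (hDs h), ei.right_inv hy, ← Set.indicator_of_mem h φ] at h1
    · rw [Set.indicator_of_notMem h]
      refine fibreSum_of_notMem fun x hx hxy => h ?_
      rw [← hxy, hdi (hDs hx), ei.left_inv (hDs hx)]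
      exact hx
  refine measurable_of_restrict_of_restrict_compl ei.open_target.measurableSet ?_ ?_
  · have h1 : ei.target.domRestrict (fibreSum d φ (D i)) =
        (D i).indicator φ ∘ ei.target.domRestrict ei.symm := funext fun y => hval y y.2
    rw [h1]
    exact hφi.comp (continuousOn_iff_continuous_domRestrict.1 ei.continuousOn_symm).measurable
  · have h1 : (ei.target)ᶜ.domRestrict (fibreSum d φ (D i)) = fun _ => 0 := by
      ext1 ⟨y, hy⟩
      refine fibreSum_of_notMem fun x hx hxy => hy ?_
      have hxy : d x = y := hxy
      rw [← hxy, hdi (hDs hx)]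
      exact ei.map_source (hDs hx)
    rw [h1]
    exact measurable_const

end FibreSum

/-! ### Finiteness of integrals over tame sets -/

theorem measurable_hypAct (A : SL(2, ℂ)) : Measurable (hypAct A) := by
  unfold hypAct
  refine Measurable.prodMk ?_ ?_
  · have : Continuous (starRingEnd ℂ) := Complex.continuous_conj
    refine Measurable.div (Continuous.measurable ?_) (Continuous.measurable ?_)
    · fun_prop
    · fun_prop
  · refine Measurable.div (Continuous.measurable ?_) (Continuous.measurable ?_)
    · fun_prop
    · fun_prop

namespace GeomFiniteEnd

variable {Γ T : Type*} [Group Γ] [TopologicalSpace T] [ChartedSpace ℂ T] [MulAction Γ T]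
variable {M : GeomFiniteEnd Γ T} {n : T × ℝ → ℝ}

/-- Injectivity leaves at most one term in each fibre. After the motion, which preserves hyperbolic
volume, the integrand is at most (C y.2²)² y.2⁻³ = C² y.2 on a ball of finite Euclidean volume. -/
theorem IsTame.hasFiniteFibreSum {E : Set (T × ℝ)} (h : M.IsTame n E) :
    HasFiniteFibreSum hypVol M.dev (fun x => ENNReal.ofReal (n x ^ 2)) E := by
  obtain ⟨hinj, A, C, y₀, hC, hE⟩ := h
  set F : Amb → ENNReal := (Metric.closedBall y₀ 1).indicator
    fun y => ENNReal.ofReal ((C * y.2 ^ 2) ^ 2) with hF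
  have hFm : Measurable F :=
    Measurable.indicator (by fun_prop) Metric.isClosed_closedBall.measurableSet
  refine ⟨F ∘ hypAct A, hFm.comp (measurable_hypAct A), fun y => ?_, ?_⟩
  · by_cases hy : ∃ x ∈ E, M.dev x = y
    · obtain ⟨x, hx, rfl⟩ := hy
      obtain ⟨-, h2, h3⟩ := hE x hx
      rw [fibreSum_of_injOn hinj hx, Function.comp_apply, hF, Set.indicator_of_mem h2]
      refine ENNReal.ofReal_le_ofReal ?_
      rw [← sq_abs (n x)]
      exact pow_le_pow_left₀ (abs_nonneg _) h3 2
    · push Not at hy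
      rw [fibreSum_of_notMem hy]
      exact zero_le
  · simp only [Function.comp_apply]
    rw [lintegral_comp_hypAct, lintegral_hypVol]
    calc ∫⁻ y in {x : Amb | 0 < x.2}, ENNReal.ofReal ((y.2 ^ 3)⁻¹) * F y
        ≤ ∫⁻ y in {x : Amb | 0 < x.2}, (Metric.closedBall y₀ 1).indicator
          (fun _ => ENNReal.ofReal (C ^ 2 * (|y₀.2| + 1))) y := by
          refine setLIntegral_mono' measurableSet_upper fun y hy => ?_
          have hy' : 0 < y.2 := hy
          by_cases hb : y ∈ Metric.closedBall y₀ 1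
          · rw [hF, Set.indicator_of_mem hb, Set.indicator_of_mem hb,
              ← ENNReal.ofReal_mul (by positivity)]
            refine ENNReal.ofReal_le_ofReal ?_
            have h1 : (y.2 ^ 3)⁻¹ * (C * y.2 ^ 2) ^ 2 = C ^ 2 * y.2 := by
              field_simp
            rw [h1]
            have h2 : |y.2 - y₀.2| ≤ 1 := by
              have := (norm_snd_le (y - y₀)).trans (mem_closedBall_iff_norm.1 hb)
              simpa using this
            have h3 := abs_le.1 h2
            have h4 := le_abs_self y₀.2
            exact mul_le_mul_of_nonneg_left (by linarith) (sq_nonneg C)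
          · rw [hF, Set.indicator_of_notMem hb, Set.indicator_of_notMem hb, mul_zero]
      _ ≤ ∫⁻ y, (Metric.closedBall y₀ 1).indicator
          (fun _ => ENNReal.ofReal (C ^ 2 * (|y₀.2| + 1))) y := setLIntegral_le_lintegral _ _
      _ < ⊤ := by
          rw [lintegral_indicator_const Metric.isClosed_closedBall.measurableSet]
          exact ENNReal.mul_lt_top ENNReal.ofReal_lt_top
            (isCompact_closedBall y₀ 1).measure_lt_top

/-- Over a small open subset of the surface the square of the norm is integrable. -/
theorem exists_hasFiniteFibreSum_nhds {φ : T × ℝ → ENNReal} {p₀ : T}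
    (h : ∀ t : ℝ, 0 ≤ t → ∃ E ∈ 𝓝 (p₀, t), HasFiniteFibreSum hypVol M.dev φ E)
    (hinf : ∃ E ∈ 𝓝 p₀ ×ˢ Filter.atTop, HasFiniteFibreSum hypVol M.dev φ E) :
    ∃ U : Set T, IsOpen U ∧ p₀ ∈ U ∧ HasFiniteFibreSum hypVol M.dev φ (U ×ˢ Set.Ici 0) := by
  obtain ⟨E, hE, hfin⟩ := hinf
  obtain ⟨U₁, hU₁, V₁, hV₁, hUV⟩ := Filter.mem_prod_iff.1 hE
  obtain ⟨t₁, ht₁⟩ := Filter.mem_atTop_sets.1 hV₁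
  -- Compactness of the time interval: finitely many times suffice, and the corresponding
  -- neighbourhoods of p₀ are intersected.
  have hcpt : ∃ U ∈ 𝓝 p₀, HasFiniteFibreSum hypVol M.dev φ (U ×ˢ Set.Icc 0 t₁) := by
    refine IsCompact.induction_on (isCompact_Icc (a := (0 : ℝ)) (b := t₁))
      (p := fun s => ∃ U ∈ 𝓝 p₀, HasFiniteFibreSum hypVol M.dev φ (U ×ˢ s)) ?_ ?_ ?_ ?_
    · exact ⟨Set.univ, Filter.univ_mem, by rw [Set.prod_empty]; exact HasFiniteFibreSum.empty⟩
    · rintro s t hst ⟨U, hU, hf⟩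
      exact ⟨U, hU, hf.mono (Set.prod_mono_right hst)⟩
    · rintro s t ⟨U, hU, hf⟩ ⟨U', hU', hf'⟩
      refine ⟨U ∩ U', Filter.inter_mem hU hU', (hf.union hf').mono ?_⟩
      rintro ⟨p, r⟩ ⟨⟨hp, hp'⟩, hr | hr⟩
      · exact Or.inl ⟨hp, hr⟩
      · exact Or.inr ⟨hp', hr⟩
    · intro t ht
      obtain ⟨E, hE, hf⟩ := h t ht.1
      rw [nhds_prod_eq] at hE
      obtain ⟨U, hU, V, hV, hUV⟩ := Filter.mem_prod_iff.1 hE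
      exact ⟨V, mem_nhdsWithin_of_mem_nhds hV, U, hU, hf.mono hUV⟩
  obtain ⟨U₂, hU₂, hf₂⟩ := hcpt
  obtain ⟨U, hUs, hUo, hpU⟩ := mem_nhds_iff.1 (Filter.inter_mem hU₁ hU₂)
  refine ⟨U, hUo, hpU, (hfin.union hf₂).mono ?_⟩
  rintro ⟨p, t⟩ ⟨hp, ht⟩
  rcases le_total t₁ t with h1 | h1
  · exact Or.inl (hUV ⟨(hUs hp).1, ht₁ t h1⟩)
  · exact Or.inr ⟨(hUs hp).2, ht, h1⟩

end GeomFiniteEnd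

/-! ### Integrals over fundamental sets -/

open MeasureTheory

theorem ae_hypVol_pos : ∀ᵐ y ∂hypVol, 0 < y.2 :=
  (withDensity_absolutelyContinuous _ _).ae_le (ae_restrict_mem measurableSet_upper)

theorem hypAct_injOn (A : SL(2, ℂ)) {x y : Amb} (hx : 0 < x.2) (hy : 0 < y.2)
    (h : hypAct A x = hypAct A y) : x = y := by
  rw [← hypAct_inv A hx, h, hypAct_inv A hy]

namespace GeomFiniteEnd

variable {Γ T : Type*} [Group Γ] [TopologicalSpace T] [ChartedSpace ℂ T] [MulAction Γ T]
variable {M : GeomFiniteEnd Γ T} {φ : T × ℝ → ENNReal}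

theorem integralOver_eq (M : GeomFiniteEnd Γ T) (F : Set T) (φ : T × ℝ → ENNReal) :
    M.integralOver F φ = ∫⁻ y, fibreSum M.dev φ (F ×ˢ Set.Ici 0) y ∂hypVol := by
  refine lintegral_congr fun y => ?_
  have h : {x : T × ℝ | x.1 ∈ F ∧ 0 ≤ x.2 ∧ M.dev x = y} =
      (F ×ˢ Set.Ici 0) ∩ M.dev ⁻¹' {y} := by
    ext x
    simp only [Set.mem_ofPred_eq, Set.mem_inter_iff, Set.mem_prod, Set.mem_Ici, Set.mem_preimage,
      Set.mem_singleton_iff, and_assoc]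
  rw [fibreSum, ← h]
  exact tsum_subtype {x : T × ℝ | x.1 ∈ F ∧ 0 ≤ x.2 ∧ M.dev x = y} φ

/-- Deck transformations preserve integrals of invariant functions. -/
theorem lintegral_fibreSum_smul
    (hinv : ∀ (γ : Γ) (p : T) (t : ℝ), 0 ≤ t → φ (γ • p, t) = φ (p, t)) (γ : Γ) (F : Set T) :
    ∫⁻ y, fibreSum M.dev φ (((fun p => γ • p) '' F) ×ˢ Set.Ici 0) y ∂hypVol =
      ∫⁻ y, fibreSum M.dev φ (F ×ˢ Set.Ici 0) y ∂hypVol := by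
  obtain ⟨B, hB⟩ := M.exists_hol_lift γ
  rw [← lintegral_comp_hypAct B]
  refine lintegral_congr_ae (ae_hypVol_pos.mono fun y hy => ?_)
  simp only [fibreSum]
  -- By equivariance γ matches the fibre over y with the fibre over B y, so the sums are reindexed
  -- by the deck transformation.
  rw [← ((MulAction.toPerm γ).prodCongr (Equiv.refl ℝ)).tsum_eq]
  refine tsum_congr fun x => ?_
  have h1 : ((MulAction.toPerm γ).prodCongr (Equiv.refl ℝ)) x = (γ • x.1, x.2) := rfl
  rw [h1]
  by_cases h : x ∈ F ×ˢ Set.Ici 0 ∩ M.dev ⁻¹' {y}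
  · have h0 : 0 ≤ x.2 := h.1.2
    have h2 : M.dev (x.1, x.2) = y := h.2
    rw [Set.indicator_of_mem h, Set.indicator_of_mem, hinv γ x.1 x.2 h0]
    refine ⟨⟨⟨x.1, h.1.1, rfl⟩, h0⟩, ?_⟩
    rw [Set.mem_preimage, M.dev_equivariant γ B hB x.1 x.2 h0, h2]
    rfl
  · rw [Set.indicator_of_notMem h, Set.indicator_of_notMem]
    rintro ⟨⟨⟨p, hp, hpx⟩, h0⟩, h3⟩
    refine h ⟨⟨?_, h0⟩, ?_⟩
    · have : p = x.1 := MulAction.injective γ hpx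
      rwa [← this]
    · have h0 : 0 ≤ x.2 := h0
      rw [Set.mem_preimage, M.dev_equivariant γ B hB x.1 x.2 h0] at h3
      exact hypAct_injOn B (M.dev_pos x.1 x.2 h0) hy h3

/-- Finitely many small open sets cover the surface, up to deck transformations. -/
theorem exists_open_hasFiniteFibreSum (M : GeomFiniteEnd Γ T)
    (hfin : ∀ p : T, ∃ U : Set T, IsOpen U ∧ p ∈ U ∧
      HasFiniteFibreSum hypVol M.dev φ (U ×ˢ Set.Ici 0)) :
    ∃ U : Set T, IsOpen U ∧ (∀ p : T, ∃ γ : Γ, γ • p ∈ U) ∧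
      HasFiniteFibreSum hypVol M.dev φ (U ×ˢ Set.Ici 0) := by
  have : ContinuousConstSMul Γ T := ⟨fun γ => (M.smooth_smul γ).continuous⟩
  have := M.compact_quotient
  choose U hUo hpU hUf using hfin
  let _ := MulAction.orbitRel Γ T
  let q : T → Quotient (MulAction.orbitRel Γ T) := Quotient.mk'
  obtain ⟨s, hs⟩ := isCompact_univ.elim_finite_subcover (fun p => q '' U p)
    (fun p => isOpenMap_quotient_mk'_mul _ (hUo p))
    (fun x _ => by
      obtain ⟨p, rfl⟩ := Quotient.exists_rep x
      exact Set.mem_iUnion.2 ⟨p, p, hpU p, rfl⟩)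
  refine ⟨⋃ p ∈ s, U p, isOpen_biUnion fun p _ => hUo p, fun p => ?_, ?_⟩
  · obtain ⟨i, hi, r, hr, hrp⟩ := Set.mem_iUnion₂.1 (hs (Set.mem_univ (q p)))
    obtain ⟨γ, hγ⟩ := MulAction.orbitRel_apply.1 (Quotient.exact hrp)
    exact ⟨γ, Set.mem_biUnion hi ((show γ • p = r from hγ) ▸ hr)⟩
  · classical
    clear hs
    induction s using Finset.induction_on with
    | empty => simpa using HasFiniteFibreSum.empty
    | insert a s ha ih =>
      rw [Finset.set_biUnion_insert, Set.union_prod]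
      exact (hUf a).union ih

/-- A fundamental set may be spread over infinitely many translates of the good open set U. It is
cut into countably many pieces, each moved into U by one deck transformation. The moved pieces are
disjoint, so the total is at most the integral of the majorant over U. -/
theorem integralOver_lt_top [SecondCountableTopology T]
    (hcont : ContinuousOn φ (Set.univ ×ˢ Set.Ici 0))
    (hinv : ∀ (γ : Γ) (p : T) (t : ℝ), 0 ≤ t → φ (γ • p, t) = φ (p, t))
    (hfin : ∀ p : T, ∃ U : Set T, IsOpen U ∧ p ∈ U ∧
      HasFiniteFibreSum hypVol M.dev φ (U ×ˢ Set.Ici 0))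
    {F : Set T} (hF : IsFundamentalSet Γ F) : M.integralOver F φ < ⊤ := by
  obtain ⟨U, hUo, hU, G, hG, hGle, hGfin⟩ := M.exists_open_hasFiniteFibreSum hfin
  rw [integralOver_eq]
  rcases isEmpty_or_nonempty T with hT | hT
  · have : F = ∅ := Set.eq_empty_of_isEmpty F
    rw [this, Set.empty_prod]
    simp [fibreSum]
  borelize T
  have hcs : ∀ γ : Γ, Continuous fun p : T => γ • p := fun γ => (M.smooth_smul γ).continuous
  have hFm : MeasurableSet F := hF.1
  have hmeas : ∀ E : Set T, MeasurableSet E →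
      Measurable (fibreSum M.dev φ (E ×ˢ Set.Ici (0 : ℝ))) := by
    intro E hE
    refine measurable_fibreSum (hE.prod measurableSet_Ici) ?_ fun x hx =>
      M.isLocalHomeoNear_dev hx.2
    have h1 : Measurable ((Set.univ ×ˢ Set.Ici (0 : ℝ)).indicator φ) := by
      classical
      rw [← Set.piecewise_eq_indicator]
      exact hcont.measurable_piecewise continuousOn_const
        (MeasurableSet.univ.prod measurableSet_Ici)
    have h2 := h1.indicator (hE.prod (measurableSet_Ici (a := (0 : ℝ))))
    rwa [Set.indicator_indicator, Set.inter_eq_left.2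
      (Set.prod_mono_left (Set.subset_univ E))] at h2
  -- the countably many pieces of the fundamental set
  obtain ⟨c, hc, hcov⟩ := TopologicalSpace.isOpen_iUnion_countable
    (fun γ : Γ => (fun p => γ • p) ⁻¹' U) (fun γ => hUo.preimage (hcs γ))
  have huniv : ⋃ γ ∈ c, (fun p => γ • p) ⁻¹' U = Set.univ := by
    rw [hcov]
    exact Set.eq_univ_of_forall fun p => Set.mem_iUnion.2 (hU p)
  have hcne : c.Nonempty := by
    obtain ⟨p⟩ := hT
    obtain ⟨γ, hγ, -⟩ := Set.mem_iUnion₂.1 (huniv.symm ▸ Set.mem_univ p)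
    exact ⟨γ, hγ⟩
  obtain ⟨g, rfl⟩ := hc.exists_eq_range hcne
  set V : ℕ → Set T := fun i => (fun p => g i • p) ⁻¹' U with hV
  have hVU : ⋃ i, V i = Set.univ := by simpa using huniv
  have hVm : ∀ i, MeasurableSet (V i) := fun i => (hUo.preimage (hcs (g i))).measurableSet
  set D : ℕ → Set T := fun i => F ∩ disjointed V i with hD
  have hDm : ∀ i, MeasurableSet (D i) := fun i => hFm.inter (MeasurableSet.disjointed hVm i)
  have hDd : Pairwise (Function.onFun Disjoint D) := fun i j hij =>
    (disjoint_disjointed _ hij).mono Set.inter_subset_right Set.inter_subset_right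
  have hDF : F = ⋃ i, D i := by
    rw [← Set.inter_iUnion, iUnion_disjointed, hVU, Set.inter_univ]
  set D' : ℕ → Set T := fun i => (fun p => g i • p) '' D i with hD'
  have hD'm : ∀ i, MeasurableSet (D' i) := fun i => by
    have : D' i = (fun p => (g i)⁻¹ • p) ⁻¹' D i := by
      ext p
      simp only [hD', Set.mem_image, Set.mem_preimage]
      constructor
      · rintro ⟨q, hq, rfl⟩
        rwa [inv_smul_smul]
      · intro h
        exact ⟨_, h, smul_inv_smul _ _⟩
    rw [this]
    exact (hcs _).measurable (hDm i)
  have hD'd : Pairwise (Function.onFun Disjoint D') := by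
    intro i j hij
    refine Set.disjoint_left.2 ?_
    rintro _ ⟨p, hp, rfl⟩ ⟨q, hq, hpq⟩
    -- Two moved pieces meet only if inverse translates of one point both lie in F; uniqueness in
    -- the fundamental set forces g i = g j, and then p = q lies in two disjoint pieces.
    have h1 : g j • q = g i • p := hpq
    have h2 : (g i)⁻¹ = (g j)⁻¹ := (hF.2 (g i • p)).unique
      (by rw [inv_smul_smul]; exact hp.1) (by rw [← h1, inv_smul_smul]; exact hq.1)
    rw [inv_inj.1 h2] at h1
    have h3 : q = p := MulAction.injective _ h1
    subst h3
    exact Set.disjoint_left.1 (hDd hij) hp hq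
  have hprod : ∀ {E : ℕ → Set T}, Pairwise (Function.onFun Disjoint E) →
      Pairwise (Function.onFun Disjoint fun i => E i ×ˢ Set.Ici (0 : ℝ)) :=
    fun hE i j hij => Set.disjoint_prod.2 (Or.inl (hE hij))
  have hint : ∀ {E : ℕ → Set T}, Pairwise (Function.onFun Disjoint E) →
      (∀ i, MeasurableSet (E i)) →
      ∫⁻ y, fibreSum M.dev φ ((⋃ i, E i) ×ˢ Set.Ici 0) y ∂hypVol =
        ∑' i, ∫⁻ y, fibreSum M.dev φ (E i ×ˢ Set.Ici 0) y ∂hypVol := by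
    intro E hE hEm
    rw [← lintegral_tsum fun i => (hmeas _ (hEm i)).aemeasurable]
    refine lintegral_congr fun y => ?_
    rw [Set.iUnion_prod_const, fibreSum_iUnion (hprod hE)]
  calc ∫⁻ y, fibreSum M.dev φ (F ×ˢ Set.Ici 0) y ∂hypVol
      = ∑' i, ∫⁻ y, fibreSum M.dev φ (D i ×ˢ Set.Ici 0) y ∂hypVol := by
        rw [← hint hDd hDm, ← hDF]
    _ = ∑' i, ∫⁻ y, fibreSum M.dev φ (D' i ×ˢ Set.Ici 0) y ∂hypVol :=
        tsum_congr fun i => (lintegral_fibreSum_smul hinv (g i) (D i)).symm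
    _ = ∫⁻ y, fibreSum M.dev φ ((⋃ i, D' i) ×ˢ Set.Ici 0) y ∂hypVol := (hint hD'd hD'm).symm
    _ ≤ ∫⁻ y, G y ∂hypVol := by
        refine lintegral_mono fun y => (fibreSum_mono (Set.prod_mono_left ?_) y).trans (hGle y)
        refine Set.iUnion_subset fun i => ?_
        rintro _ ⟨p, hp, rfl⟩
        exact disjointed_subset V i hp.2
    _ < ⊤ := hGfin

/-- Norms of derivatives of the pulled back canonical lift have finite `L²` norm. -/
theorem hasFiniteL2Norm [SecondCountableTopology T] [IsManifold 𝓘(ℝ, ℂ) ∞ T]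
    {v : ∀ p : T, TangentSpace 𝓘(ℝ, ℂ) p} {N : (Amb → ProjField) → Amb → ℝ} (hN : IsAdapted N)
    (hconf : M.IsConformal v) (haut : M.IsAutomorphic v) :
    M.HasFiniteL2Norm (M.normOn N (normalPullback (M.canonicalLift v))) := by
  have hcont : ContinuousOn (M.normOn N (normalPullback (M.canonicalLift v)))
      (Set.univ ×ˢ Set.Ici 0) := fun x hx =>
    (continuousAt_normOn hN hconf hx.2).continuousWithinAt
  refine ⟨hcont, fun γ p t ht => normOn_smul hN hconf haut γ p ht, fun F hF => ?_⟩
  refine integralOver_lt_top (ENNReal.continuous_ofReal.comp_continuousOn (hcont.pow 2)) ?_ ?_ hF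
  · intro γ p t ht
    simp only [Function.comp_apply, Pi.pow_apply]
    rw [normOn_smul hN hconf haut γ p ht]
  · intro p
    refine exists_hasFiniteFibreSum_nhds ?_ ?_
    · intro t ht
      obtain ⟨E, hE, hT⟩ := exists_isTame_nhds hN hconf (x₀ := (p, t)) ht
      exact ⟨E, hE, hT.hasFiniteFibreSum⟩
    · obtain ⟨E, hE, hT⟩ := exists_isTame_infty hN hconf p
      exact ⟨E, hE, hT.hasFiniteFibreSum⟩

end GeomFiniteEnd

end HypEnd

end

/-- Each of the four norms is by definition `normOn` of an adapted norm, so one finiteness argument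
serves all of them. -/
theorem theorem3p4 {Γ T : Type*} [Group Γ] [TopologicalSpace T] [T2Space T]
    [SecondCountableTopology T] [SimplyConnectedSpace T] [ChartedSpace ℂ T]
    [IsManifold 𝓘(ℝ, ℂ) ∞ T] [MulAction Γ T] [ProperlyDiscontinuousSMul Γ T]
    (M : HypEnd.GeomFiniteEnd Γ T) (v : ∀ p : T, TangentSpace 𝓘(ℝ, ℂ) p)
    (hconf : M.IsConformal v) (haut : M.IsAutomorphic v)
    (s : T × ℝ → HypEnd.ProjField) (hs : s = HypEnd.normalPullback (M.canonicalLift v)) :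
    M.IsSmoothSection s ∧
      M.HasFiniteL2Norm (M.normD s) ∧
      M.HasFiniteL2Norm (M.normLaplacian s) ∧
      M.HasFiniteL2Norm (M.normDivRe s) ∧
      M.HasFiniteL2Norm (M.normDiffDivRe s) := by
  subst hs
  exact ⟨HypEnd.GeomFiniteEnd.isSmoothSection hconf,
    HypEnd.GeomFiniteEnd.hasFiniteL2Norm HypEnd.isAdapted_normD hconf haut,
    HypEnd.GeomFiniteEnd.hasFiniteL2Norm HypEnd.isAdapted_normLaplacian hconf haut,
    HypEnd.GeomFiniteEnd.hasFiniteL2Norm HypEnd.isAdapted_normDivRe hconf haut,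
    HypEnd.GeomFiniteEnd.hasFiniteL2Norm HypEnd.isAdapted_normDiffDivRe hconf haut⟩
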